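/- Let $a_i,b_i,c_i\in\mathbb Q$ ($i=1,2$) with $a_1=\alpha_1^2$, $a_2=\alpha_2^2$, $\alpha_1,\alpha_2\in\mathbb Q$. Put $p_i(x,z)=a_ix^2+b_ixz+c_iz^2$, and let $C\subset\mathbb P^3$, with coordinates $(x:u:v:z)$, be the projective curve over $\mathbb Q$ defined by $$p_1(x,z)=u^2,\qquad p_2(x,z)=v^2 .$$ Assume that $C$ is smooth (i.e. the Jacobian criterion holds at every point of $C(\overline{\mathbb Q})$; then $C$ is irreducible of genus one). Let $P_1=(1:\alpha_1:\alpha_2:0)$, $P_3=(1:-\alpha_1:\alpha_2:0)$, $P_4=(1:\alpha_1:-\alpha_2:0)$, which are rational points of $C$ at infinity. For a point $P=(x_0:u_0:v_0:z_0)\in C(\overline{\mathbb Q})$ there is a linear form $h(x,z)$ with $$v_0^2\,p_1(x,z)-u_0^2\,p_2(x,z)=(z_0x-x_0z)\,h(x,z),$$ so that $C$ lies on the quadric $(v_0u+u_0v)(v_0u-u_0v)=(z_0x-x_0z)\,h(x,z)$, which carries the pencil of lines $$L_{P,\lambda}:\quad v_0u+u_0v=\lambda\, h(x,z),\quad v_0u-u_0v=\lambda^{-1}(z_0x-x_0z)\qquad(\lambda=t/s\in\mathbb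 P^1),$$ i.e. $s(v_0u+u_0v)=t\,h(x,z)$, $t(v_0u-u_0v)=s(z_0x-x_0z)$. A step of the Diophantus–Fermat construction leads from $P$ to $R$ if some line of this pencil passes through $P$ and meets $C$ in exactly the points $P$ and $R$, where $R=P$ if $P$ is the only point of intersection (tangency). A group law on $C$ with origin $P_1$ is an abelian group structure on $C(\overline{\mathbb Q})$ that corresponds to the addition of a Weierstrass elliptic curve under an isomorphism of curves over $\overline{\mathbb Q}$ taking $P_1$ to the point at infinity. Then: 1. $C$ has exactly one group law with origin $P_1$. 2. For every $P\in C(\overline{\mathbb Q})$ there is exactly one $R$ to which a step of the construction leads from $P$, and $R$ is rational if $P$ is rational. 3. In the group law with origin $P_1$, this point is $R=P_3+P_4-3P$. 4. If $S_0=P_1$ and $S_{n+1}$ is obtained from $S_n$ by a step of the construction for all $n\ge 0$, then $S_1=P_3+P_4$ and, with $R=S_1$, for all $n\ge 0$ $$S_n=\frac{1-(-3)^n}{4}\cdot R,$$ where $\frac{1-(-3)^n}{4}$ is an integer. -/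

import Mathlib

open MvPolynomial
open scoped LinearAlgebra.Projectivization

noncomputable section

/-- Regular maps of projective varieties over an algebraically closed field `K`, in terms of
their `K`-points.  Here `X`, `Y` are sets of points, placed in projective spaces by `ι`, `κ`.
A map `f : X → Y` is regular if near every point `p` it is given by homogeneous polynomials of
one common degree: they do not all vanish at `p`, and they compute `f` on the whole Zariski-open
set of those `q` where they do not all vanish. -/
def IsRegularMap {K : Type*} [Field K] {m n : ℕ} {X Y : Type*}
    (ι : X → ℙ K (Fin m → K)) (κ : Y → ℙ K (Fin n → K)) (f : X → Y) : Prop :=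
  ∀ p : X, ∃ (d : ℕ) (F : Fin n → MvPolynomial (Fin m) K),
    (∀ j, (F j).IsHomogeneous d) ∧
    (fun j => eval (ι p).rep (F j)) ≠ 0 ∧
    ∀ (q : X) (hq : (fun j => eval (ι q).rep (F j)) ≠ 0),
      κ (f q) = Projectivization.mk K (fun j => eval (ι q).rep (F j)) hq

/-- The usual embedding of the points of a Weierstrass curve in the projective plane:
`O ↦ (0 : 1 : 0)` and `(x, y) ↦ (x : y : 1)`. -/
def weierstrassToPlane {K : Type*} [Field K] (W : WeierstrassCurve.Affine K) :
    W.Point → ℙ K (Fin 3 → K)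
  | .zero => Projectivization.mk K ![0, 1, 0] (fun h => by simpa using congrFun h 1)
  | .some x y _ => Projectivization.mk K ![x, y, 1] (fun h => by simpa using congrFun h 2)

/-- The double equation `a₁ x² + b₁ x + c₁ = u²`, `a₂ x² + b₂ x + c₂ = v²`. -/
structure DoubleEquation (k : Type*) where
  (a₁ b₁ c₁ a₂ b₂ c₂ : k)

namespace DoubleEquation

variable {k : Type*} [Field k] (E : DoubleEquation k) (K : Type*) [Field K] [Algebra k K]

/-- The quadratic form `a₁ x² + b₁ x z + c₁ z² - u²`; the coordinates of `ℙ³` are `(x : u : v : z)`,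
numbered `0, 1, 2, 3`. -/
def form₁ : MvPolynomial (Fin 4) k :=
  C E.a₁ * X 0 ^ 2 + C E.b₁ * X 0 * X 3 + C E.c₁ * X 3 ^ 2 - X 1 ^ 2

/-- The quadratic form `a₂ x² + b₂ x z + c₂ z² - v²`. -/
def form₂ : MvPolynomial (Fin 4) k :=
  C E.a₂ * X 0 ^ 2 + C E.b₂ * X 0 * X 3 + C E.c₂ * X 3 ^ 2 - X 2 ^ 2

/-- The vector `w = (x, u, v, z)` satisfies the two homogeneous equations. -/
def OnCurve (w : Fin 4 → K) : Prop := aeval w E.form₁ = 0 ∧ aeval w E.form₂ = 0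

/-- The `K`-points of the projective curve `C` in `ℙ³` defined by the double equation. -/
def Pt : Type _ := {p : ℙ K (Fin 4 → K) // E.OnCurve K p.rep}

/-- The inclusion of the curve in `ℙ³`. -/
def toSpace (p : E.Pt K) : ℙ K (Fin 4 → K) := p.1

/-- The Jacobian criterion: at every `K`-point of the curve the gradients of the two equations are
linearly independent.  (It is used with `K` algebraically closed.) -/
def IsSmooth : Prop :=
  ∀ p : E.Pt K, LinearIndependent K
    ![fun j => aeval (E.toSpace K p).rep (pderiv j E.form₁),
      fun j => aeval (E.toSpace K p).rep (pderiv j E.form₂)]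

/-- The point has coordinates in the ground field `k`. -/
def IsRational {E : DoubleEquation k} {K : Type*} [Field K] [Algebra k K] (p : E.Pt K) : Prop :=
  ∃ (w : Fin 4 → k) (hw : (fun i => algebraMap k K (w i)) ≠ 0),
    E.toSpace K p = Projectivization.mk K (fun i => algebraMap k K (w i)) hw

theorem onCurve_smul {w : Fin 4 → K} (h : E.OnCurve K w) (a : K) : E.OnCurve K (a • w) := by
  obtain ⟨h₁, h₂⟩ := h
  simp only [form₁, form₂, map_add, map_sub, map_mul, map_pow, aeval_X, algHom_C] at h₁ h₂
  constructor
  · simp only [form₁, map_add, map_sub, map_mul, map_pow, aeval_X, algHom_C, Pi.smul_apply,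
      smul_eq_mul]
    linear_combination a ^ 2 * h₁
  · simp only [form₂, map_add, map_sub, map_mul, map_pow, aeval_X, algHom_C, Pi.smul_apply,
      smul_eq_mul]
    linear_combination a ^ 2 * h₂

/-- The point of the curve with homogeneous coordinates `w`. -/
def mkPt (w : Fin 4 → K) (hw : w ≠ 0) (h : E.OnCurve K w) : E.Pt K :=
  ⟨Projectivization.mk K w hw, by
    obtain ⟨a, ha⟩ := Projectivization.exists_smul_eq_mk_rep K w hw
    rw [← ha]
    exact E.onCurve_smul K h a⟩

/-- The point at infinity `(1 : β₁ : β₂ : 0)`, where `β₁² = a₁` and `β₂² = a₂`. -/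
def infPt (β₁ β₂ : k) (h₁ : β₁ ^ 2 = E.a₁) (h₂ : β₂ ^ 2 = E.a₂) : E.Pt K :=
  E.mkPt K ![1, algebraMap k K β₁, algebraMap k K β₂, 0]
    (fun h => by simpa using congrFun h 0)
    ⟨by simp [form₁, ← h₁], by simp [form₂, ← h₂]⟩

/-- For a vector `w₀ = (x₀, u₀, v₀, z₀)` of coordinates of a point `P` of the curve, the linear
form `h = h₀ x + h₁ z` is the cofactor in
`v₀² (a₁ x² + b₁ x z + c₁ z²) - u₀² (a₂ x² + b₂ x z + c₂ z²) = (z₀ x - x₀ z) (h₀ x + h₁ z)`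
(an identity of binary quadratic forms, written out by coefficients).  The left-hand side agrees
with `(v₀ u + u₀ v) (v₀ u - u₀ v)` on the curve. -/
def IsCofactor (w₀ : Fin 4 → K) (h₀ h₁ : K) : Prop :=
  w₀ 2 ^ 2 * algebraMap k K E.a₁ - w₀ 1 ^ 2 * algebraMap k K E.a₂ = w₀ 3 * h₀ ∧
  w₀ 2 ^ 2 * algebraMap k K E.b₁ - w₀ 1 ^ 2 * algebraMap k K E.b₂ = w₀ 3 * h₁ - w₀ 0 * h₀ ∧
  w₀ 2 ^ 2 * algebraMap k K E.c₁ - w₀ 1 ^ 2 * algebraMap k K E.c₂ = - (w₀ 0 * h₁)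

/-- The vector `w` lies on the line `L_{P, λ}`, `λ = t / s` (with `λ = ∞` for `s = 0`):
`v₀ u + u₀ v = λ h(x, z)`, `v₀ u - u₀ v = λ⁻¹ (z₀ x - x₀ z)`. -/
def OnPencilLine {K : Type*} [Field K] (w₀ : Fin 4 → K) (h₀ h₁ s t : K) (w : Fin 4 → K) : Prop :=
  s * (w₀ 2 * w 1 + w₀ 1 * w 2) = t * (h₀ * w 0 + h₁ * w 3) ∧
  t * (w₀ 2 * w 1 - w₀ 1 * w 2) = s * (w₀ 3 * w 0 - w₀ 0 * w 3)

/-- One step of the method of Diophantus and Fermat leads from `P` to `R`: some line `L` of the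
pencil `L_{P, λ}` attached to `P` passes through `P`, and it meets the curve exactly in `P` and `R`.
The line lies on a quadric containing the curve, so that it meets the curve in a divisor of
degree `2`; hence `R ≠ P` is the other point of intersection, and `R = P` means that `P` is the only
one, with multiplicity `2`. -/
def FermatStep {E : DoubleEquation k} {K : Type*} [Field K] [Algebra k K] (P R : E.Pt K) : Prop :=
  ∃ h₀ h₁ s t : K, (s ≠ 0 ∨ t ≠ 0) ∧
    E.IsCofactor K (E.toSpace K P).rep h₀ h₁ ∧
    ∀ Q : E.Pt K,
      OnPencilLine (E.toSpace K P).rep h₀ h₁ s t (E.toSpace K Q).rep ↔ (Q = P ∨ Q = R)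

open scoped Classical in
/-- `G` is the group law of the elliptic curve `(C, O)`, on its points over the algebraically
closed field `K`: some isomorphism of curves from `C` to a Weierstrass elliptic curve which takes
`O` to the point at infinity carries the addition of `G` to that of the Weierstrass curve. -/
def IsGroupLaw {E : DoubleEquation k} {K : Type*} [Field K] [Algebra k K]
    (O : E.Pt K) (G : AddCommGroup (E.Pt K)) : Prop :=
  ∃ (W : WeierstrassCurve.Affine K) (φ : E.Pt K ≃ W.Point),
    W.IsElliptic ∧
    IsRegularMap (E.toSpace K) (weierstrassToPlane W) φ ∧
    IsRegularMap (weierstrassToPlane W) (E.toSpace K) φ.symm ∧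
    φ O = 0 ∧
    ∀ P Q : E.Pt K, φ (P + Q) = φ P + φ Q

end DoubleEquation

end

/-!
The curve `C` is an intersection of two quadrics in `ℙ³`, hence an elliptic curve once an origin is
chosen, and the construction of Diophantus and Fermat is a statement about one ruling of one quadric
of the pencil through `C`.

*Uniqueness of the group law.*  Two group laws with the same origin differ by an isomorphism of
Weierstrass curves which takes the point at infinity to the point at infinity.  Such a map induces
an isomorphism of the coordinate rings of the affine parts, and it is additive because the group law
is the multiplication of ideal classes in these rings
(`WeierstrassCurve.Affine.Point.map_add_of_isRegularMap`).  That regular functions on the affine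
part belong to the coordinate ring is `WeierstrassCurve.Affine.Point.exists_eq_evalAt`.

*Existence of the group law.*  Over an algebraically closed field a linear change of coordinates
brings `C` into the form `u² = x z`, `v² = x² + b x z + c z²`, and explicit formulas identify this
curve with the Weierstrass curve `y² = (x + b) (x² - 4 c)`
(`DoubleEquation.exists_equiv_normalWeierstrass`).  A translation moves the origin.

*Involutions.*  A regular involution `σ` of an elliptic curve is either a translation or a
reflection, `P + σ P = σ O` (`WeierstrassCurve.Affine.Point.reflection_or_translation`).  The sign
changes `P ↦ P'` of `u` and `P ↦ P''` of `v` have fixed points without being the identity, so they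
are reflections:
`P + P' = P₃` and `P + P'' = P₄`.

*The step.*  Let `u₀ v₀ ≠ 0`.  The lines `L_{P, λ}` of the ruling are pairwise disjoint on `C` and
each meets `C` in two points, counted with multiplicity, and the exchange of
these two points is a regular involution which takes `P` to `R`.  The line `λ = 0` contains
`P'` and `P''`.  The involution is not a translation,
since a translation with this value at `P'` would be `(x : u : v : z) ↦ (x : -u : -v : z)`.
Hence `P + R = P' + P'' = P₃ + P₄ - 2 P` (`DoubleEquation.Pencil.add_eq_add`).  If
`u₀ = 0` or `v₀ = 0` the quadric is a cone; the line through `P` is then `λ = 0`, and `R = P''` or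
`R = P'`, which agrees with the same formula.  The second point of a rational line through a
rational point of a quadric is rational, and the multiples of `P₃ + P₄` follow by solving the
recurrence `S (n + 1) = P₃ + P₄ - 3 S n`.
-/

/-! ### Regular maps in terms of coordinate vectors -/

section Regular

variable {K : Type*} [Field K]

/-- `g` is the polynomial function of a form of degree `d`. -/
def IsForm {m : ℕ} (d : ℕ) (g : (Fin m → K) → K) : Prop :=
  ∃ p : MvPolynomial (Fin m) K, p.IsHomogeneous d ∧ ∀ v, eval v p = g v

namespace IsForm

variable {m d e : ℕ} {g h : (Fin m → K) → K}

theorem coord (i : Fin m) : IsForm 1 (fun v : Fin m → K => v i) :=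
  ⟨X i, isHomogeneous_X _ _, fun _ => eval_X _⟩

theorem add (hg : IsForm d g) (hh : IsForm d h) : IsForm d (fun v => g v + h v) := by
  obtain ⟨p, hp, hp'⟩ := hg
  obtain ⟨q, hq, hq'⟩ := hh
  exact ⟨p + q, hp.add hq, fun v => by rw [map_add, hp', hq']⟩

theorem sub (hg : IsForm d g) (hh : IsForm d h) : IsForm d (fun v => g v - h v) := by
  obtain ⟨p, hp, hp'⟩ := hg
  obtain ⟨q, hq, hq'⟩ := hh
  exact ⟨p - q, hp.sub hq, fun v => by rw [map_sub, hp', hq']⟩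

theorem neg (hg : IsForm d g) : IsForm d (fun v => -g v) := by
  obtain ⟨p, hp, hp'⟩ := hg
  exact ⟨-p, hp.neg, fun v => by rw [map_neg, hp']⟩

theorem mul (hg : IsForm d g) (hh : IsForm e h) : IsForm (d + e) (fun v => g v * h v) := by
  obtain ⟨p, hp, hp'⟩ := hg
  obtain ⟨q, hq, hq'⟩ := hh
  exact ⟨p * q, hp.mul hq, fun v => by rw [map_mul, hp', hq']⟩

theorem const_mul (c : K) (hg : IsForm d g) : IsForm d (fun v => c * g v) := by
  obtain ⟨p, hp, hp'⟩ := hg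
  exact ⟨C c * p, by simpa using (isHomogeneous_C _ c).mul hp,
    fun v => by rw [map_mul, hp', eval_C]⟩

theorem mul_const (c : K) (hg : IsForm d g) : IsForm d (fun v => g v * c) := by
  simpa only [mul_comm] using hg.const_mul c

theorem pow (hg : IsForm d g) (n : ℕ) : IsForm (d * n) (fun v => g v ^ n) := by
  obtain ⟨p, hp, hp'⟩ := hg
  exact ⟨p ^ n, hp.pow n, fun v => by rw [map_pow, hp']⟩

theorem apply_smul (hg : IsForm d g) (c : K) (v : Fin m → K) : g (c • v) = c ^ d * g v := by
  obtain ⟨p, hp, hp'⟩ := hg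
  rw [← hp', ← hp']
  simp only [eval_eq, Finset.mul_sum]
  refine Finset.sum_congr rfl fun a ha => ?_
  have h := hp (mem_support_iff.1 ha)
  have h' : ∑ i ∈ a.support, a i = d := by
    rw [← h, Finsupp.weight_apply]
    simp [Finsupp.sum]
  simp only [Pi.smul_apply, smul_eq_mul, mul_pow, Finset.prod_mul_distrib,
    Finset.prod_pow_eq_pow_sum, h']
  ring

theorem comp {n : ℕ} {g : (Fin n → K) → K} {f : (Fin m → K) → Fin n → K} (hg : IsForm e g)
    (hf : ∀ j, IsForm d (fun v => f v j)) : IsForm (d * e) (fun v => g (f v)) := by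
  obtain ⟨p, hp, hp'⟩ := hg
  choose F hF hF' using hf
  refine ⟨aeval F p, hp.aeval F hF, fun v => ?_⟩
  have : f v = fun j => eval v (F j) := funext fun j => (hF' j v).symm
  show _ = g (f v)
  rw [← hp', aeval_def, eval_eval₂, this]
  show _ = eval₂ (RingHom.id K) _ p
  congr 1
  ext c
  exact eval_C c

end IsForm

/-- `v` chooses homogeneous coordinates for the points of `X`. -/
def IsLift {m : ℕ} {X : Type*} (ι : X → ℙ K (Fin m → K)) (v : X → Fin m → K) : Prop :=
  ∀ p, ∃ h : v p ≠ 0, ι p = Projectivization.mk K (v p) h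

theorem isLift_rep {m : ℕ} {X : Type*} (ι : X → ℙ K (Fin m → K)) :
    IsLift ι (fun p => (ι p).rep) :=
  fun p => ⟨(ι p).rep_nonzero, (ι p).mk_rep.symm⟩

variable {l m n : ℕ} {X Y Z : Type*} {ι : X → ℙ K (Fin m → K)} {κ : Y → ℙ K (Fin n → K)}
  {μ : Z → ℙ K (Fin l → K)} {v : X → Fin m → K} {w : Y → Fin n → K} {u : Z → Fin l → K}
  {f : X → Y} {g : Y → Z}

/-- `f` is regular at `p`, in terms of coordinate vectors: forms of one degree, not all zero at `p`,
are proportional to the coordinates of `f q` at every `q`.  Points where the forms vanish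
need no special treatment, since the factor `c` may be zero. -/
def IsRegularAt (v : X → Fin m → K) (w : Y → Fin n → K) (f : X → Y) (p : X) : Prop :=
  ∃ (d : ℕ) (g : (Fin m → K) → Fin n → K),
    (∀ j, IsForm d (fun x => g x j)) ∧ g (v p) ≠ 0 ∧ ∀ q, ∃ c : K, g (v q) = c • w (f q)

/-- Regularity does not depend on the choice of coordinate vectors. -/
theorem isRegularMap_iff (hv : IsLift ι v) (hw : IsLift κ w) :
    IsRegularMap ι κ f ↔ ∀ p, IsRegularAt v w f p := by
  have hrep : ∀ p, ∃ a : K, a ≠ 0 ∧ (ι p).rep = a • v p := fun p => by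
    obtain ⟨h, e⟩ := hv p
    obtain ⟨a, ha⟩ := Projectivization.exists_smul_eq_mk_rep K (v p) h
    exact ⟨a, a.ne_zero, by rw [e, ← ha]; rfl⟩
  have key : ∀ (d : ℕ) (g : (Fin m → K) → Fin n → K), (∀ j, IsForm d (fun x => g x j)) →
      ∀ (c : K) (x : Fin m → K), g (c • x) = c ^ d • g x :=
    fun d g hg c x => funext fun j => (hg j).apply_smul c x
  refine forall_congr' fun p => exists_congr fun d => ⟨?_, ?_⟩
  · rintro ⟨F, hF, hp, hq⟩
    have hG : ∀ j, IsForm d (fun x => (fun (y : Fin m → K) i => eval y (F i)) x j) :=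
      fun j => ⟨F j, hF j, fun _ => rfl⟩
    refine ⟨fun x j => eval x (F j), hG, fun h0 => ?_, fun q => ?_⟩
    · obtain ⟨a, -, ha⟩ := hrep p
      apply hp
      have := key d _ hG a (v p)
      rw [← ha] at this
      exact this.trans ((congrArg (a ^ d • ·) h0).trans (smul_zero _))
    · obtain ⟨a, ha0, ha⟩ := hrep q
      have h1 := key d _ hG a (v q)
      rw [← ha] at h1
      by_cases h : (fun j => eval (ι q).rep (F j)) = 0
      · refine ⟨0, ?_⟩
        rw [h] at h1
        rw [zero_smul]
        exact (smul_eq_zero.1 h1.symm).resolve_left (pow_ne_zero _ ha0)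
      · obtain ⟨hw0, hw1⟩ := hw (f q)
        have h2 := hq q h
        rw [hw1, eq_comm, Projectivization.mk_eq_mk_iff'] at h2
        obtain ⟨b, hb⟩ := h2
        refine ⟨(a ^ d)⁻¹ * b, ?_⟩
        rw [mul_smul, hb, h1, smul_smul, inv_mul_cancel₀ (pow_ne_zero _ ha0), one_smul]
  · rintro ⟨g, hg, hp, hq⟩
    choose F hF hF' using hg
    have hFg : ∀ x, (fun j => eval x (F j)) = g x := fun x => funext fun j => hF' j x
    refine ⟨F, hF, ?_, fun q => ?_⟩
    · obtain ⟨a, ha0, ha⟩ := hrep p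
      rw [hFg, ha, key d g (fun j => ⟨F j, hF j, hF' j⟩)]
      exact smul_ne_zero (pow_ne_zero _ ha0) hp
    · obtain ⟨a, ha0, ha⟩ := hrep q
      obtain ⟨c, hc⟩ := hq q
      obtain ⟨hw0, hw1⟩ := hw (f q)
      intro h
      rw [hw1, eq_comm, Projectivization.mk_eq_mk_iff']
      refine ⟨a ^ d * c, ?_⟩
      rw [hFg, ha, key d g (fun j => ⟨F j, hF j, hF' j⟩), hc, smul_smul]

theorem IsRegularAt.comp {p : X} (hg : IsRegularAt w u g (f p)) (hf : IsRegularAt v w f p) :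
    IsRegularAt v u (g ∘ f) p := by
  obtain ⟨d, F, hF, hFp, hFq⟩ := hf
  obtain ⟨e, G, hG, hGp, hGq⟩ := hg
  have key : ∀ (c : K) x, G (c • x) = c ^ e • G x :=
    fun c x => funext fun j => (hG j).apply_smul c x
  refine ⟨d * e, fun x => G (F x), fun j => (hG j).comp hF, ?_, fun q => ?_⟩
  · obtain ⟨c, hc⟩ := hFq p
    have hc0 : c ≠ 0 := by
      rintro rfl
      exact hFp (by rw [hc, zero_smul])
    show G (F _) ≠ 0
    rw [hc, key]
    exact smul_ne_zero (pow_ne_zero _ hc0) hGp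
  · obtain ⟨c, hc⟩ := hFq q
    obtain ⟨b, hb⟩ := hGq (f q)
    refine ⟨c ^ e * b, ?_⟩
    show G (F _) = _
    rw [hc, key, hb, smul_smul]
    rfl

theorem IsRegularMap.comp (hg : IsRegularMap κ μ g) (hf : IsRegularMap ι κ f) :
    IsRegularMap ι μ (g ∘ f) := by
  have hι := isLift_rep ι
  have hκ := isLift_rep κ
  have hμ := isLift_rep μ
  rw [isRegularMap_iff hκ hμ] at hg
  rw [isRegularMap_iff hι hκ] at hf
  rw [isRegularMap_iff hι hμ]
  exact fun p => (hg (f p)).comp (hf p)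

theorem isRegularMap_id : IsRegularMap ι ι id :=
  (isRegularMap_iff (isLift_rep ι) (isLift_rep ι)).2 fun p =>
    ⟨1, fun x => x, fun j => .coord j, (ι p).rep_nonzero, fun _ => ⟨1, (one_smul _ _).symm⟩⟩

/-- A map given by one system of forms without common zeros. -/
theorem isRegularMap_of_forall (hv : IsLift ι v) (hw : IsLift κ w) {d : ℕ}
    (G : (Fin m → K) → Fin n → K) (hG : ∀ j, IsForm d (fun x => G x j))
    (h : ∀ q, ∃ c : K, c ≠ 0 ∧ G (v q) = c • w (f q)) : IsRegularMap ι κ f := by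
  refine (isRegularMap_iff hv hw).2 fun p => ⟨d, G, hG, ?_, fun q => ?_⟩
  · obtain ⟨c, hc, e⟩ := h p
    rw [e]
    exact smul_ne_zero hc (hw _).1
  · obtain ⟨c, -, e⟩ := h q
    exact ⟨c, e⟩

end Regular

/-! ### Functions on the affine part of a Weierstrass curve -/

namespace WeierstrassCurve.Affine

section CoordinateRing

variable {K : Type*} [Field K] {W : WeierstrassCurve.Affine K}

variable (W) in
/-- The coordinate function `x`. -/
noncomputable def xFun : W.CoordinateRing :=
  CoordinateRing.mk W (Polynomial.C Polynomial.X)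

variable (W) in
/-- The coordinate function `y`. -/
noncomputable def yFun : W.CoordinateRing :=
  CoordinateRing.mk W Polynomial.X

/-- A solution of the Weierstrass equation in a `K`-algebra, as a homomorphism on the coordinate
ring. -/
noncomputable def coordLift {B : Type*} [CommRing B] [Algebra K B] (x y : B)
    (h : y ^ 2 + algebraMap K B W.a₁ * x * y + algebraMap K B W.a₃ * y =
      x ^ 3 + algebraMap K B W.a₂ * x ^ 2 + algebraMap K B W.a₄ * x + algebraMap K B W.a₆) :
    W.CoordinateRing →ₐ[K] B :=
  AdjoinRoot.liftAlgHom W.polynomial (Polynomial.aeval x) y (by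
    simp only [WeierstrassCurve.Affine.polynomial, Polynomial.eval₂_add, Polynomial.eval₂_sub,
      Polynomial.eval₂_mul, Polynomial.eval₂_pow, Polynomial.eval₂_X, Polynomial.eval₂_C,
      RingHom.coe_coe, map_add, map_mul, map_pow, Polynomial.aeval_X, Polynomial.aeval_C]
    linear_combination h)

section Lift

variable {B : Type*} [CommRing B] [Algebra K B]

@[simp] theorem coordLift_xFun (x y : B) (h) : coordLift (W := W) x y h (xFun W) = x := by
  simp [coordLift, xFun]

@[simp] theorem coordLift_yFun (x y : B) (h) : coordLift (W := W) x y h (yFun W) = y := by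
  simp [coordLift, yFun]

theorem coordHom_ext {f g : W.CoordinateRing →ₐ[K] B} (hx : f (xFun W) = g (xFun W))
    (hy : f (yFun W) = g (yFun W)) : f = g := by
  refine AdjoinRoot.algHom_ext' (Polynomial.algHom_ext ?_) hy
  exact hx

theorem xFun_yFun_equation : yFun W ^ 2 + algebraMap K W.CoordinateRing W.a₁ * xFun W * yFun W +
    algebraMap K W.CoordinateRing W.a₃ * yFun W = xFun W ^ 3 +
      algebraMap K W.CoordinateRing W.a₂ * xFun W ^ 2 +
      algebraMap K W.CoordinateRing W.a₄ * xFun W +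
      algebraMap K W.CoordinateRing W.a₆ := by
  have h : CoordinateRing.mk W W.polynomial = 0 := AdjoinRoot.mk_self
  simp only [WeierstrassCurve.Affine.polynomial, map_add, map_sub, map_mul, map_pow] at h
  have e : ∀ a : K, CoordinateRing.mk W (Polynomial.C (Polynomial.C a)) =
    algebraMap K W.CoordinateRing a := fun a => rfl
  simp only [e] at h
  unfold xFun yFun
  linear_combination h

end Lift

end CoordinateRing

namespace Point

variable {K : Type*} [Field K] {W : WeierstrassCurve.Affine K}

/-- Evaluation of functions at an affine point. -/
noncomputable def evalAt : ∀ P : W.Point, P ≠ 0 → (W.CoordinateRing →ₐ[K] K)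
  | .zero, h => (h rfl).elim
  | .some x y h, _ => coordLift x y ((W.equation_iff x y).1 h.1)

theorem evalAt_xFun {x y : K} (h : W.Nonsingular x y) (h0) :
    evalAt (.some x y h) h0 (xFun W) = x := by
  simp [evalAt]

theorem evalAt_yFun {x y : K} (h : W.Nonsingular x y) (h0) :
    evalAt (.some x y h) h0 (yFun W) = y := by
  simp [evalAt]

/-- The ideal of an affine point; the point at infinity has the unit ideal. -/
noncomputable def ideal : W.Point → Ideal W.CoordinateRing
  | .zero => ⊤
  | .some x y _ => CoordinateRing.XYIdeal W x (Polynomial.C y)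

theorem ideal_zero : ideal (0 : W.Point) = ⊤ := rfl

theorem mem_ideal_iff (P : W.Point) (h : P ≠ 0) (f : W.CoordinateRing) :
    f ∈ ideal P ↔ evalAt P h f = 0 := by
  rcases P with _ | ⟨x, y, hxy⟩
  · exact (h rfl).elim
  have hx : xFun W - algebraMap K _ x ∈ ideal (.some x y hxy) := by
    refine Ideal.subset_span (Or.inl ?_)
    simp only [CoordinateRing.XClass, map_sub]; rfl
  have hy : yFun W - algebraMap K _ y ∈ ideal (.some x y hxy) := by
    refine Ideal.subset_span (Or.inr ?_)
    simp only [CoordinateRing.YClass, map_sub]; rfl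
  constructor
  · intro hf
    have : ideal (.some x y hxy) ≤ RingHom.ker (evalAt (.some x y hxy) h) := by
      refine Ideal.span_le.2 ?_
      rintro _ (rfl | rfl)
      · simp only [CoordinateRing.XClass, map_sub, SetLike.mem_coe, RingHom.mem_ker]
        refine sub_eq_zero.2 ((evalAt_xFun hxy h).trans ?_)
        exact ((evalAt _ h).commutes x).symm
      · simp only [CoordinateRing.YClass, map_sub, SetLike.mem_coe, RingHom.mem_ker]
        refine sub_eq_zero.2 ((evalAt_yFun hxy h).trans ?_)
        exact ((evalAt _ h).commutes y).symm
    exact this hf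
  · -- modulo the ideal every function is congruent to its value
    intro hf
    have key : (Ideal.Quotient.mkₐ K (ideal (.some x y hxy))) =
        (Algebra.ofId K _).comp (evalAt (.some x y hxy) h) := by
      apply coordHom_ext
      · rw [AlgHom.comp_apply, evalAt_xFun]
        exact (Ideal.Quotient.mk_eq_mk_iff_sub_mem _ _).2 hx
      · rw [AlgHom.comp_apply, evalAt_yFun]
        exact (Ideal.Quotient.mk_eq_mk_iff_sub_mem _ _).2 hy
    have := DFunLike.congr_fun key f
    rw [AlgHom.comp_apply, hf, _root_.map_zero] at this
    exact Ideal.Quotient.eq_zero_iff_mem.1 this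

/-- The group law in terms of ideals. -/
theorem add_eq_iff [DecidableEq K] (P Q S : W.Point) :
    P + Q = S ↔ ∃ f g : W.CoordinateRing, f ≠ 0 ∧ g ≠ 0 ∧
    Ideal.span {f} * (ideal P * ideal Q) = Ideal.span {g} * ideal S := by
  have key : ∀ P : W.Point, ∃ u : (FractionalIdeal (nonZeroDivisors W.CoordinateRing)
      W.FunctionField)ˣ,
      u.1 = (ideal P : FractionalIdeal (nonZeroDivisors W.CoordinateRing) W.FunctionField) ∧
      toClass P = Additive.ofMul (ClassGroup.mk W.FunctionField u) := by
    rintro (_ | ⟨x, y, h⟩)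
    · exact ⟨1, by simp [ideal], by rw [map_one]; rfl⟩
    · exact ⟨CoordinateRing.XYIdeal' h, rfl, rfl⟩
  obtain ⟨u, hu, hu'⟩ := key P
  obtain ⟨v, hv, hv'⟩ := key Q
  obtain ⟨w, hw, hw'⟩ := key S
  rw [← toClass_injective.eq_iff, map_add, hu', hv', hw', ← ofMul_mul, ← map_mul]
  refine Additive.ofMul.injective.eq_iff.trans (ClassGroup.mk_eq_mk_of_coe_ideal ?_ hw)
  rw [Units.val_mul, hu, hv, FractionalIdeal.coeIdeal_mul]

section IsElliptic

variable [W.IsElliptic]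

theorem exists_evalAt_eq (χ : W.CoordinateRing →ₐ[K] K) : ∃ (P : W.Point) (h : P ≠ 0),
    χ = evalAt P h := by
  have h := congrArg χ (xFun_yFun_equation (W := W))
  simp only [map_add, map_mul, map_pow, AlgHom.commutes] at h
  have h' := (W.equation_iff (χ (xFun W)) (χ (yFun W))).2 h
  refine ⟨.some _ _ (equation_iff_nonsingular.1 h'), some_ne_zero _, coordHom_ext ?_ ?_⟩
  · rw [evalAt_xFun]
  · rw [evalAt_yFun]

instance : Algebra.FiniteType K W.CoordinateRing :=
  Algebra.FiniteType.trans (S := Polynomial K) inferInstance inferInstance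

variable [IsAlgClosed K]

theorem exists_eq_ideal_of_isMaximal (M : Ideal W.CoordinateRing) [hM : M.IsMaximal] :
    ∃ (P : W.Point), P ≠ 0 ∧ M = ideal P := by
  let : Field (W.CoordinateRing ⧸ M) := Ideal.Quotient.field M
  have : Module.Finite K (W.CoordinateRing ⧸ M) :=
    finite_of_finite_type_of_isJacobsonRing K (W.CoordinateRing ⧸ M)
  have hb := IsAlgClosed.algebraMap_bijective_of_isIntegral (k := K) (K := W.CoordinateRing ⧸ M)
  let e := AlgEquiv.ofBijective (Algebra.ofId K (W.CoordinateRing ⧸ M)) hb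
  obtain ⟨P, h, hP⟩ := exists_evalAt_eq
    ((e.symm : (W.CoordinateRing ⧸ M) →ₐ[K] K).comp (Ideal.Quotient.mkₐ K M))
  refine ⟨P, h, Ideal.ext fun f => ?_⟩
  rw [mem_ideal_iff P h, ← hP, ← Ideal.Quotient.eq_zero_iff_mem]
  simp

/-- A function on the affine points that is locally a quotient of elements of the coordinate ring
comes from the coordinate ring: the possible denominators form an ideal, which lies in no maximal
ideal. -/
theorem exists_eq_evalAt (g : W.Point → K)
    (hg : ∀ P, ∀ h : P ≠ 0, ∃ a b : W.CoordinateRing, evalAt P h b ≠ 0 ∧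
      ∀ Q, ∀ h' : Q ≠ 0, evalAt Q h' b * g Q = evalAt Q h' a) :
    ∃ a : W.CoordinateRing, ∀ Q, ∀ h' : Q ≠ 0, evalAt Q h' a = g Q := by
  let J : Ideal W.CoordinateRing :=
    { carrier := {b | ∃ a, ∀ Q, ∀ h' : Q ≠ 0, evalAt Q h' b * g Q = evalAt Q h' a}
      zero_mem' := ⟨0, fun Q h' => by simp⟩
      add_mem' := by
        rintro b b' ⟨a, ha⟩ ⟨a', ha'⟩
        exact ⟨a + a', fun Q h' => by rw [map_add, map_add, add_mul, ha, ha']⟩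
      smul_mem' := by
        rintro c b ⟨a, ha⟩
        exact ⟨c * a, fun Q h' => by rw [smul_eq_mul, map_mul, map_mul, mul_assoc, ha]⟩ }
  have hJ : J = ⊤ := by
    by_contra hne
    obtain ⟨M, hM, hJM⟩ := Ideal.exists_le_maximal J hne
    obtain ⟨P, h, rfl⟩ := exists_eq_ideal_of_isMaximal M
    obtain ⟨a, b, hb, hab⟩ := hg P h
    exact hb ((mem_ideal_iff P h b).1 (hJM ⟨a, hab⟩))
  obtain ⟨a, ha⟩ : (1 : W.CoordinateRing) ∈ J := hJ ▸ Submodule.mem_top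
  exact ⟨a, fun Q h' => by rw [← ha Q h', map_one, one_mul]⟩

end IsElliptic

/-- A nonzero function has only finitely many zeros. -/
theorem finite_zeros {f : W.CoordinateRing} (hf : f ≠ 0) :
    {P : W.Point | ∃ h : P ≠ 0, evalAt P h f = 0}.Finite := by
  have : Module.Finite (Polynomial K) W.CoordinateRing := .of_basis (CoordinateRing.basis W)
  have hint : _root_.IsIntegral (Polynomial K) f := Algebra.IsIntegral.isIntegral f
  have hne := Ideal.comap_ne_bot_of_integral_mem hf (Ideal.mem_span_singleton_self f) hint
  obtain ⟨p, hp, hp0⟩ := Submodule.exists_mem_ne_zero_of_ne_bot hne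
  obtain ⟨r, hr⟩ := Ideal.mem_span_singleton.1 (Ideal.mem_comap.1 hp)
  -- the zeros have their `x` among the roots of `p`, and each `x` belongs to at most two points
  have heval : ∀ (P : W.Point) (h : P ≠ 0), evalAt P h (algebraMap (Polynomial K) _ p) =
      p.eval (evalAt P h (xFun W)) := by
    intro P h
    have : (evalAt P h).comp (IsScalarTower.toAlgHom K (Polynomial K) W.CoordinateRing) =
        Polynomial.aeval (evalAt P h (xFun W)) := by
      ext
      rw [Polynomial.aeval_X]
      rfl
    have := DFunLike.congr_fun this p
    rwa [← Polynomial.coe_aeval_eq_eval]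
  have hfin : (⋃ x ∈ p.rootSet K, {P : W.Point | P.xRep = ![x, 1]}).Finite := by
    refine (Polynomial.rootSet_finite p K).biUnion fun x _ => ?_
    by_cases hx : ∃ P : W.Point, P.xRep = ![x, 1]
    · obtain ⟨P, hP⟩ := hx
      refine (Set.toFinite {P, -P}).subset fun Q hQ => ?_
      exact eq_or_eq_neg_of_xRep_eq_xRep (hQ.trans hP.symm)
    · exact Set.finite_empty.subset fun Q hQ => hx ⟨Q, hQ⟩
  refine hfin.subset fun P => ?_
  rintro ⟨h, hP⟩
  rcases P with _ | ⟨x, y, hxy⟩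
  · exact (h rfl).elim
  refine Set.mem_biUnion (x := x) ?_ rfl
  rw [Polynomial.mem_rootSet]
  refine ⟨hp0, ?_⟩
  have h1 := heval _ h
  rw [hr, map_mul, hP, zero_mul, evalAt_xFun] at h1
  simpa using h1.symm

theorem infinite_point [IsAlgClosed K] [W.IsElliptic] : Infinite W.Point := by
  have : ∀ x : K, ∃ P : W.Point, P.xRep = ![x, 1] := by
    intro x
    obtain ⟨y, hy⟩ := IsAlgClosed.exists_root (k := K)
      (Polynomial.X ^ 2 + Polynomial.C (W.a₁ * x + W.a₃) * Polynomial.X -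
        Polynomial.C (x ^ 3 + W.a₂ * x ^ 2 + W.a₄ * x + W.a₆)) (by
        have : (Polynomial.X ^ 2 + Polynomial.C (W.a₁ * x + W.a₃) * Polynomial.X -
          Polynomial.C (x ^ 3 + W.a₂ * x ^ 2 + W.a₄ * x + W.a₆)).degree = 2 := by compute_degree!
        rw [this]; decide)
    have h : W.Equation x y := by
      rw [equation_iff]
      simp only [Polynomial.IsRoot, Polynomial.eval_sub, Polynomial.eval_add, Polynomial.eval_mul,
        Polynomial.eval_pow, Polynomial.eval_X, Polynomial.eval_C] at hy
      linear_combination hy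
    exact ⟨.some x y (equation_iff_nonsingular.1 h), rfl⟩
  choose P hP using this
  have : Infinite K := IsAlgClosed.instInfinite
  refine Infinite.of_injective P fun x x' h => ?_
  have := (hP x).symm.trans ((congrArg xRep h).trans (hP x'))
  simpa using congrFun this 0

/-- Functions that agree on infinitely many points agree. -/
theorem eq_of_infinite {f g : W.CoordinateRing} {s : Set W.Point} (hs : s.Infinite)
    (h : ∀ P ∈ s, ∀ h0 : P ≠ 0, evalAt P h0 f = evalAt P h0 g) : f = g := by
  by_contra hne
  have hfin := (finite_zeros (sub_ne_zero.2 hne)).union (Set.finite_singleton (0 : W.Point))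
  refine hs (hfin.subset fun P hP => ?_)
  by_cases h0 : P = 0
  · exact Or.inr h0
  · exact Or.inl ⟨h0, by rw [map_sub, h P hP h0, sub_self]⟩

end Point

end WeierstrassCurve.Affine

/-! ### Regular maps between Weierstrass curves -/

namespace WeierstrassCurve.Affine.Point

section Basic

variable {K : Type*} [Field K] {W W' : WeierstrassCurve.Affine K}

/-- Homogeneous coordinates of a point of a Weierstrass curve. -/
def coordVec : W.Point → Fin 3 → K
  | .zero => ![0, 1, 0]
  | .some x y _ => ![x, y, 1]

theorem isLift_coordVec : IsLift (weierstrassToPlane W) coordVec := by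
  rintro (_ | ⟨x, y, h⟩)
  · exact ⟨fun h => by simpa [coordVec] using congrFun h 1, rfl⟩
  · exact ⟨fun h => by simpa [coordVec] using congrFun h 2, rfl⟩

theorem coordVec_zero : coordVec (0 : W.Point) = ![0, 1, 0] := rfl

theorem coordVec_two {P : W.Point} (h : P ≠ 0) : coordVec P 2 = 1 := by
  rcases P with _ | ⟨x, y, hxy⟩
  · exact (h rfl).elim
  · rfl

theorem coordVec_eq {P : W.Point} (h : P ≠ 0) :
    coordVec P = ![evalAt P h (xFun W), evalAt P h (yFun W), 1] := by
  rcases P with _ | ⟨x, y, hxy⟩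
  · exact (h rfl).elim
  · rw [evalAt_xFun, evalAt_yFun, coordVec]

theorem coordVec_injective : Function.Injective (coordVec (W := W)) := by
  rintro (_ | ⟨x, y, hxy⟩) (_ | ⟨x', y', hxy'⟩) h
  · rfl
  · simpa [coordVec] using congrFun h 2
  · simpa [coordVec] using congrFun h 2
  · have h0 : x = x' := congrFun h 0
    have h1 : y = y' := congrFun h 1
    subst h0 h1
    rfl

theorem exists_evalAt_eq_form {d : ℕ} {g : (Fin 3 → K) → K} (hg : IsForm d g) :
    ∃ a : W.CoordinateRing, ∀ P, ∀ h : P ≠ 0, evalAt P h a = g (coordVec P) := by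
  obtain ⟨p, -, hp⟩ := hg
  refine ⟨aeval ![xFun W, yFun W, 1] p, fun P h => ?_⟩
  rw [← hp, ← AlgHom.comp_apply, comp_aeval, ← coe_aeval_eq_eval, coordVec_eq h]
  change (aeval _) p = (aeval _) p
  congr 2
  ext i
  fin_cases i <;> simp

variable [IsAlgClosed K] [W.IsElliptic]

/-- A regular map respecting the points at infinity pulls functions on the affine part back. -/
theorem exists_pullback {ψ : W.Point → W'.Point}
    (hψ : IsRegularMap (weierstrassToPlane W) (weierstrassToPlane W') ψ)
    (h0 : ∀ P, ψ P = 0 ↔ P = 0) : ∃ e : W'.CoordinateRing →ₐ[K] W.CoordinateRing,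
      ∀ P, ∀ h : P ≠ 0, ∀ h' : ψ P ≠ 0, ∀ f, evalAt P h (e f) = evalAt (ψ P) h' f := by
  rw [isRegularMap_iff isLift_coordVec isLift_coordVec] at hψ
  have key : ∀ i : Fin 3, ∃ a : W.CoordinateRing, ∀ Q, ∀ h : Q ≠ 0,
      evalAt Q h a = coordVec (ψ Q) i := by
    intro i
    refine exists_eq_evalAt (fun Q => coordVec (ψ Q) i) fun P h => ?_
    obtain ⟨d, g, hg, hgP, hgQ⟩ := hψ P
    obtain ⟨a, ha⟩ := exists_evalAt_eq_form (W := W) (hg i)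
    obtain ⟨b, hb⟩ := exists_evalAt_eq_form (W := W) (hg 2)
    -- the factor between the forms and the coordinates is the value of the last form
    have hc : ∀ Q, Q ≠ 0 → g (coordVec Q) = g (coordVec Q) 2 • coordVec (ψ Q) := by
      intro Q hQ
      obtain ⟨c, hc⟩ := hgQ Q
      have h2 := congrFun hc 2
      rw [Pi.smul_apply, coordVec_two (mt (h0 Q).1 hQ), smul_eq_mul, mul_one] at h2
      rw [h2, hc]
    refine ⟨a, b, fun hb0 => hgP ?_, fun Q hQ => ?_⟩
    · rw [hb] at hb0
      rw [hc P h, hb0, zero_smul]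
    · rw [ha, hb]
      exact (congrFun (hc Q hQ) i).symm
  obtain ⟨a, ha⟩ := key 0
  obtain ⟨b, hb⟩ := key 1
  have ha' : ∀ Q, ∀ h : Q ≠ 0, ∀ h' : ψ Q ≠ 0, evalAt Q h a = evalAt (ψ Q) h' (xFun W') :=
    fun Q h h' => by rw [ha, coordVec_eq h']; rfl
  have hb' : ∀ Q, ∀ h : Q ≠ 0, ∀ h' : ψ Q ≠ 0, evalAt Q h b = evalAt (ψ Q) h' (yFun W') :=
    fun Q h h' => by rw [hb, coordVec_eq h']; rfl
  have : Infinite W.Point := infinite_point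
  have heq : b ^ 2 + algebraMap K W.CoordinateRing W'.a₁ * a * b + algebraMap K _ W'.a₃ * b =
      a ^ 3 + algebraMap K _ W'.a₂ * a ^ 2 + algebraMap K _ W'.a₄ * a + algebraMap K _ W'.a₆ := by
    refine eq_of_infinite Set.infinite_univ fun Q _ h => ?_
    have h' := mt (h0 Q).1 h
    have := congrArg (evalAt (ψ Q) h') (xFun_yFun_equation (W := W'))
    simpa only [map_add, map_mul, map_pow, AlgHom.commutes, ha' Q h h', hb' Q h h'] using this
  refine ⟨coordLift a b heq, fun P h h' f => ?_⟩
  · have : (evalAt P h).comp (coordLift (W := W') a b heq) = evalAt (ψ P) h' :=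
      coordHom_ext (by rw [AlgHom.comp_apply, coordLift_xFun, ha' P h h'])
        (by rw [AlgHom.comp_apply, coordLift_yFun, hb' P h h'])
    exact DFunLike.congr_fun this f

theorem eq_of_infinite_eq {ψ χ : W.Point → W'.Point}
    (hψ : IsRegularMap (weierstrassToPlane W) (weierstrassToPlane W') ψ)
    (hχ : IsRegularMap (weierstrassToPlane W) (weierstrassToPlane W') χ)
    (hψ0 : ∀ P, ψ P = 0 ↔ P = 0) (hχ0 : ∀ P, χ P = 0 ↔ P = 0) (h : {P | ψ P = χ P}.Infinite) :
    ψ = χ := by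
  obtain ⟨e, he⟩ := exists_pullback hψ hψ0
  obtain ⟨e', he'⟩ := exists_pullback hχ hχ0
  have key : e = e' := by
    refine AlgHom.ext fun f => eq_of_infinite h fun P hP hP0 => ?_
    have h1 := mt (hψ0 P).1 hP0
    have h2 := mt (hχ0 P).1 hP0
    rw [he P hP0 h1, he' P hP0 h2]
    congr 2
  subst key
  funext P
  by_cases hP0 : P = 0
  · rw [(hψ0 P).2 hP0, (hχ0 P).2 hP0]
  · have h1 := mt (hψ0 P).1 hP0
    have h2 := mt (hχ0 P).1 hP0
    apply coordVec_injective
    rw [coordVec_eq h1, coordVec_eq h2, ← he P hP0 h1, ← he P hP0 h1, ← he' P hP0 h2,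
      ← he' P hP0 h2]

/-- An isomorphism of Weierstrass curves which respects the points at infinity is additive: it
induces an isomorphism of the coordinate rings, and the group law is the multiplication of ideal
classes. -/
theorem map_add_of_isRegularMap [DecidableEq K] [W'.IsElliptic] (ψ : W.Point ≃ W'.Point)
    (hψ : IsRegularMap (weierstrassToPlane W) (weierstrassToPlane W') ψ)
    (hψ' : IsRegularMap (weierstrassToPlane W') (weierstrassToPlane W) ψ.symm)
    (h0 : ψ 0 = 0) (P Q : W.Point) : ψ (P + Q) = ψ P + ψ Q := by
  have hz : ∀ P, ψ P = 0 ↔ P = 0 := fun P => by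
    rw [← ψ.apply_eq_iff_eq, h0]
  have hz' : ∀ P, ψ.symm P = 0 ↔ P = 0 := fun P => ψ.symm_apply_eq.trans (by rw [h0])
  obtain ⟨e, he⟩ := exists_pullback hψ hz
  obtain ⟨e', he'⟩ := exists_pullback hψ' hz'
  have : Infinite W.Point := infinite_point
  have : Infinite W'.Point := infinite_point
  have h1 : e.comp e' = AlgHom.id K _ := AlgHom.ext fun f =>
    eq_of_infinite Set.infinite_univ fun P _ hP => by
      have hP' := mt (hz P).1 hP
      have hP'' := mt (hz' _).1 hP'
      rw [AlgHom.comp_apply, he P hP hP', he' (ψ P) hP' hP'']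
      congr 2
      exact ψ.symm_apply_apply P
  have h2 : e'.comp e = AlgHom.id K _ := AlgHom.ext fun f =>
    eq_of_infinite Set.infinite_univ fun P _ hP => by
      have hP' := mt (hz' P).1 hP
      have hP'' := mt (hz _).1 hP'
      rw [AlgHom.comp_apply, he' P hP hP', he _ hP' hP'']
      congr 2
      exact ψ.apply_symm_apply P
  let E : W.CoordinateRing ≃+* W'.CoordinateRing := (AlgEquiv.ofAlgHom e' e h2 h1).toRingEquiv
  have hI : ∀ P, (ideal P).map E = ideal (ψ P) := by
    intro P
    by_cases hP : P = 0
    · rw [hP, h0, ideal_zero, ideal_zero, Ideal.map_top]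
    · have hP' := mt (hz P).1 hP
      have hP'' := mt (hz' _).1 hP'
      ext f
      rw [mem_ideal_iff _ hP', Ideal.mem_map_of_equiv E]
      constructor
      · rintro ⟨g, hg, rfl⟩
        rw [mem_ideal_iff P hP] at hg
        refine (he' (ψ P) hP' hP'' g).trans ?_
        rw [← hg]
        congr 2
        exact ψ.symm_apply_apply P
      · intro hf
        refine ⟨e f, ?_, E.apply_symm_apply f⟩
        rw [mem_ideal_iff P hP, he P hP hP', hf]
  obtain ⟨f, g, hf, hg, hfg⟩ := (add_eq_iff P Q (P + Q)).1 rfl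
  refine Eq.symm ((add_eq_iff _ _ _).2 ⟨E f, E g, ?_, ?_, ?_⟩)
  · simpa using hf
  · simpa using hg
  · have := congrArg (Ideal.map E) hfg
    simpa only [Ideal.map_mul, Ideal.map_span, Set.image_singleton, hI] using this

end Basic

end WeierstrassCurve.Affine.Point

/-! ### Translations and involutions of a Weierstrass curve -/

namespace WeierstrassCurve.Affine.Point

variable {K : Type*} [Field K] {W : WeierstrassCurve.Affine K}

theorem isRegularMap_neg :
    IsRegularMap (weierstrassToPlane W) (weierstrassToPlane W) (fun P => -P) := by
  refine isRegularMap_of_forall (d := 1) isLift_coordVec isLift_coordVec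
    (fun v => ![v 0, -v 1 - W.a₁ * v 0 - W.a₃ * v 2, v 2]) ?_ ?_
  · intro j
    fin_cases j
    · exact .coord 0
    · exact ((IsForm.coord 1).neg.sub ((IsForm.coord 0).const_mul _)).sub
        ((IsForm.coord 2).const_mul _)
    · exact .coord 2
  · rintro (_ | ⟨x, y, h⟩)
    · refine ⟨-1, by simp, ?_⟩
      change _ = (-1 : K) • coordVec (0 : W.Point)
      ext i
      fin_cases i <;> simp [coordVec]
    · refine ⟨1, one_ne_zero, ?_⟩
      rw [neg_some]
      ext i
      fin_cases i <;> simp [coordVec, negY]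

theorem equation_coordVec (P : W.Point) : Projective.Equation W (coordVec P) := by
  rcases P with _ | ⟨x, y, h⟩
  · exact Projective.equation_zero
  · exact (Projective.equation_some x y).2 h.1

/-- The addition formulas in homogeneous coordinates fail only on the diagonal. -/
theorem addXYZ_coordVec [DecidableEq K] (P Q : W.Point) : ∃ c : K, (P ≠ Q → c ≠ 0) ∧
    Projective.addXYZ W (coordVec P) (coordVec Q) = c • coordVec (P + Q) := by
  by_cases hP : P = 0
  · subst hP
    refine ⟨coordVec Q 2, fun h => by rw [coordVec_two h.symm]; exact one_ne_zero, ?_⟩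
    rw [Projective.addXYZ_of_Z_eq_zero_left (equation_coordVec _) rfl, zero_add]
    simp [coordVec_zero]
  by_cases hQ : Q = 0
  · subst hQ
    refine ⟨-1, fun _ => by simp, ?_⟩
    rw [Projective.addXYZ_of_Z_eq_zero_right (equation_coordVec _) rfl, add_zero, coordVec_two hP]
    simp [coordVec_zero]
  have hPz : coordVec P 2 ≠ 0 := by rw [coordVec_two hP]; exact one_ne_zero
  have hQz : coordVec Q 2 ≠ 0 := by rw [coordVec_two hQ]; exact one_ne_zero
  have hPe := equation_coordVec P
  have hQe := equation_coordVec Q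
  rcases P with _ | ⟨x, y, h⟩
  · exact (hP rfl).elim
  rcases Q with _ | ⟨x', y', h'⟩
  · exact (hQ rfl).elim
  by_cases hx : x = x'
  · subst hx
    rw [Projective.addXYZ_of_X_eq hPe hQe hPz hQz (by simp [coordVec])]
    by_cases hy : y = W.negY x y'
    · rw [add_of_Y_eq rfl hy]
      refine ⟨_, fun hne => ?_, rfl⟩
      have : y ≠ y' := fun e => hne (by subst e; rfl)
      simpa [Projective.addU, coordVec, sub_eq_zero] using this
    · have : y = y' := Y_eq_of_Y_ne h.1 h'.1 rfl hy
      subst this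
      exact ⟨0, fun hne => (hne rfl).elim, by simp [Projective.addU]⟩
  · have hx' : coordVec (.some x y h) 0 * coordVec (.some x' y' h') 2 ≠
      coordVec (.some x' y' h') 0 * coordVec (.some x y h) 2 := by simpa [coordVec] using hx
    rw [Projective.addXYZ_of_Z_ne_zero hPe hQe hPz hQz hx', add_of_X_ne hx]
    refine ⟨_, fun _ => Projective.addZ_ne_zero_of_X_ne hPe hQe hx', ?_⟩
    simp [coordVec]

/-- A function of three variables which is determined by its values at sums of unit vectors in the
way a quadratic form is, is a quadratic form. -/
theorem _root_.IsForm.of_ternary {f : (Fin 3 → K) → K} (hf : ∀ v, f v =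
    f ![1, 0, 0] * (v 0 * v 0) + (f ![1, 1, 0] - f ![1, 0, 0] - f ![0, 1, 0]) * (v 0 * v 1) +
    (f ![1, 0, 1] - f ![1, 0, 0] - f ![0, 0, 1]) * (v 0 * v 2) + f ![0, 1, 0] * (v 1 * v 1) +
    (f ![0, 1, 1] - f ![0, 1, 0] - f ![0, 0, 1]) * (v 1 * v 2) + f ![0, 0, 1] * (v 2 * v 2)) :
    IsForm 2 f := by
  have x := IsForm.coord (K := K) (m := 3) 0
  have y := IsForm.coord (K := K) (m := 3) 1
  have z := IsForm.coord (K := K) (m := 3) 2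
  rw [funext hf]
  exact ((((((x.mul x).const_mul _).add ((x.mul y).const_mul _)).add ((x.mul z).const_mul _)).add
    ((y.mul y).const_mul _)).add ((y.mul z).const_mul _)).add ((z.mul z).const_mul _)

theorem isForm_addXYZ (T : Fin 3 → K) (j : Fin 3) :
    IsForm 2 (fun v => Projective.addXYZ W v T j) := by
  refine IsForm.of_ternary fun v => ?_
  fin_cases j
  · simp [Projective.addXYZ, Projective.addX]
    ring
  · simp [Projective.addXYZ, Projective.addY, Projective.negY, Projective.negAddY, Projective.addX,
      Projective.addZ]
    ring
  · simp [Projective.addXYZ, Projective.addZ]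
    ring

section

variable [DecidableEq K]

theorem isRegularAt_add_right {P T : W.Point} (h : P ≠ T) :
    IsRegularAt coordVec coordVec (fun P : W.Point => P + T) P := by
  refine ⟨2, fun v => Projective.addXYZ W v (coordVec T), isForm_addXYZ _, ?_, fun Q => ?_⟩
  · obtain ⟨c, hc, e⟩ := addXYZ_coordVec P T
    beta_reduce
    rw [e]
    exact smul_ne_zero (hc h) (isLift_coordVec _).1
  · obtain ⟨c, -, e⟩ := addXYZ_coordVec Q T
    exact ⟨c, e⟩

/-- The affine `2`-torsion points are the zeros of `2 y + a₁ x + a₃`. -/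
theorem finite_eq_neg (h2 : (2 : K) ≠ 0) : {P : W.Point | P = -P}.Finite := by
  have hne : 2 * yFun W + algebraMap K _ W.a₁ * xFun W + algebraMap K _ W.a₃ ≠ 0 := by
    intro h
    have := (CoordinateRing.smul_basis_eq_zero (W' := W)
      (p := Polynomial.C W.a₁ * Polynomial.X + Polynomial.C W.a₃) (q := 2) (by
        rw [← h, CoordinateRing.smul, CoordinateRing.smul]
        simp only [map_add, map_mul, xFun, yFun, mul_one, map_ofNat]
        change _ = _ + CoordinateRing.mk W (Polynomial.C (Polynomial.C W.a₁)) * _ +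
          CoordinateRing.mk W (Polynomial.C (Polynomial.C W.a₃))
        ring)).2
    apply h2
    have := congrArg (Polynomial.eval 0) this
    simpa using this
  refine ((finite_zeros hne).union (Set.finite_singleton 0)).subset fun P hP => ?_
  by_cases h0 : P = 0
  · exact Or.inr h0
  refine Or.inl ⟨h0, ?_⟩
  rcases P with _ | ⟨x, y, h⟩
  · exact (h0 rfl).elim
  have hy : y = W.negY x y := by
    have := congrFun (congrArg coordVec (show Point.some x y h = _ from hP)) 1
    rwa [neg_some] at this
  simp only [map_add, map_mul, map_ofNat, evalAt_xFun, evalAt_yFun, AlgHom.commutes]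
  rw [negY] at hy
  change 2 * y + W.a₁ * x + W.a₃ = 0
  linear_combination hy

variable [IsAlgClosed K] [W.IsElliptic]

/-- Translations are regular.  The addition formulas cover all points but one, and that point is
reached by splitting the translation into two. -/
theorem isRegularMap_add_right (h2 : (2 : K) ≠ 0) (T : W.Point) :
    IsRegularMap (weierstrassToPlane W) (weierstrassToPlane W) (fun P => P + T) := by
  refine (isRegularMap_iff isLift_coordVec isLift_coordVec).2 fun P => ?_
  by_cases hP : P = T
  swap
  · exact isRegularAt_add_right hP
  subst hP
  have : Infinite W.Point := infinite_point
  obtain ⟨S, -, hS⟩ := Set.infinite_univ.exists_notMem_finite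
    ((finite_eq_neg (W := W) h2).union (Set.finite_singleton P))
  rw [Set.mem_union, not_or, Set.mem_ofPred_eq, Set.mem_singleton_iff] at hS
  have h1 : IsRegularAt coordVec coordVec (fun Q : W.Point => Q + S) P :=
    isRegularAt_add_right (Ne.symm hS.2)
  have h3 : IsRegularAt coordVec coordVec (fun Q : W.Point => Q + (P - S)) (P + S) :=
    isRegularAt_add_right fun h => hS.1 (eq_neg_of_add_eq_zero_left (by
      rw [← sub_eq_zero] at h
      rw [← h]
      abel))
  have h4 := IsRegularAt.comp (f := fun Q : W.Point => Q + S) h3 h1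
  convert h4 using 1
  funext Q
  change Q + P = Q + S + (P - S)
  abel

/-- A regular involution `ψ` of an elliptic curve is a reflection `P ↦ c - P` or a translation.  The
map `ε P = ψ P - ψ 0` is an automorphism of the group with `ε² = 1`.  If it has infinitely many
fixed points, it is the identity.  Otherwise the fixed points `P + ε P` take only finitely many
values, so one value is taken infinitely often; then `ε = -1` at the differences of infinitely many
points, hence everywhere. -/
theorem reflection_or_translation (h2 : (2 : K) ≠ 0) (ψ : W.Point → W.Point)
    (hψ : IsRegularMap (weierstrassToPlane W) (weierstrassToPlane W) ψ)
    (hinv : ∀ P, ψ (ψ P) = P) : (∀ P, P + ψ P = ψ 0) ∨ ∀ P, ψ P = P + ψ 0 := by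
  -- `ε` is the part of `ψ` that fixes the origin
  let ε : W.Point ≃ W.Point :=
    { toFun := fun P => ψ P + -ψ 0
      invFun := fun P => ψ (P + ψ 0)
      left_inv := fun P => by simp [hinv]
      right_inv := fun P => by simp [hinv] }
  have hε : IsRegularMap (weierstrassToPlane W) (weierstrassToPlane W) ε :=
    (isRegularMap_add_right h2 (-ψ 0)).comp hψ
  have hε' : IsRegularMap (weierstrassToPlane W) (weierstrassToPlane W) ε.symm :=
    hψ.comp (isRegularMap_add_right h2 (ψ 0))
  have hψε : ∀ P, ψ P = ε P + ψ 0 := fun P => by simp [ε]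
  have h0 : ε 0 = 0 := add_neg_cancel _
  have hadd := map_add_of_isRegularMap ε hε hε' h0
  have hεc : ε (ψ 0) = -ψ 0 := by simp [ε, hinv]
  have hεε : ∀ P, ε (ε P) = P := by
    intro P
    have := hinv P
    rw [hψε, hψε P, hadd, hεc] at this
    simpa using this
  have hz : ∀ P, ε P = 0 ↔ P = 0 := fun P =>
    ⟨fun h => ε.injective (h.trans h0.symm), fun h => by rw [h, h0]⟩
  have : Infinite W.Point := infinite_point
  by_cases hfin : {P : W.Point | ε P = id P}.Infinite
  · right
    have := eq_of_infinite_eq hε isRegularMap_id hz (fun _ => Iff.rfl) hfin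
    intro P
    rw [hψε, this, id]
  · left
    rw [Set.not_infinite] at hfin
    have : Finite {P : W.Point | ε P = id P} := hfin
    obtain ⟨⟨Q, hQ⟩, hfib⟩ := Finite.exists_infinite_fiber
      (fun P : W.Point => (⟨P + ε P, by
        rw [Set.mem_ofPred_eq, hadd, hεε, add_comm, id]⟩ : {P : W.Point | ε P = id P}))
    have hinf : {P : W.Point | P + ε P = Q}.Infinite := by
      rw [← Set.infinite_coe_iff]
      refine hfib.of_injective (fun P => ⟨P.1, congrArg Subtype.val P.2⟩) ?_
      intro P P' h
      exact Subtype.ext (congrArg (fun x => x.1) h)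
    obtain ⟨P₀, hP₀⟩ := hinf.nonempty
    have hneg : ∀ P, ε (-P) = -ε P := fun P =>
      eq_neg_of_add_eq_zero_left (by rw [← hadd, neg_add_cancel, h0])
    have hinf' : {P : W.Point | ε P = -P}.Infinite := by
      refine (hinf.image (f := fun P => P + -P₀)
        (fun P _ P' _ h => add_right_cancel h)).mono ?_
      rintro _ ⟨P, hP, rfl⟩
      have hP : P + ε P = Q := hP
      have hP₀ : P₀ + ε P₀ = Q := hP₀
      change ε (P + -P₀) = -(P + -P₀)
      rw [hadd, hneg, ← sub_eq_zero]
      rw [← hP₀, ← sub_eq_zero] at hP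
      rw [← hP]
      abel
    have := eq_of_infinite_eq hε isRegularMap_neg hz (fun _ => neg_eq_zero) hinf'
    intro P
    rw [hψε, this]
    exact add_neg_cancel_left P _

end

end WeierstrassCurve.Affine.Point

/-! ### Points of a double equation and linear maps between such curves -/

theorem IsForm.linearMap {K : Type*} [Field K] {m : ℕ} (ℓ : (Fin m → K) →ₗ[K] K) : IsForm 1 ℓ := by
  refine ⟨∑ i, C (ℓ (Pi.single i 1)) * X i, ?_, fun v => ?_⟩
  · exact IsHomogeneous.sum _ _ _ fun i _ => isHomogeneous_C_mul_X _ _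
  · rw [ℓ.pi_apply_eq_sum_univ v]
    simp only [map_sum, map_mul, eval_C, eval_X, smul_eq_mul]
    refine Finset.sum_congr rfl fun i _ => ?_
    rw [mul_comm]
    congr 2
    ext j
    simp [Pi.single_apply, eq_comm]

namespace DoubleEquation

section Basic

variable {k : Type*} [Field k] (E : DoubleEquation k) (K : Type*) [Field K] [Algebra k K]

/-- The quadratic form `p₁(x, z) = a₁ x² + b₁ x z + c₁ z²`. -/
noncomputable def p₁ (x z : K) : K :=
  algebraMap k K E.a₁ * x ^ 2 + algebraMap k K E.b₁ * x * z + algebraMap k K E.c₁ * z ^ 2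

/-- The quadratic form `p₂(x, z) = a₂ x² + b₂ x z + c₂ z²`. -/
noncomputable def p₂ (x z : K) : K :=
  algebraMap k K E.a₂ * x ^ 2 + algebraMap k K E.b₂ * x * z + algebraMap k K E.c₂ * z ^ 2

theorem onCurve_iff (w : Fin 4 → K) : E.OnCurve K w ↔
    E.p₁ K (w 0) (w 3) = w 1 ^ 2 ∧ E.p₂ K (w 0) (w 3) = w 2 ^ 2 := by
  simp only [OnCurve, form₁, form₂, map_add, map_sub, map_mul, map_pow, aeval_X, algHom_C, p₁, p₂,
    sub_eq_zero]

variable {E K}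

theorem onCurve_rep (P : E.Pt K) : E.OnCurve K (E.toSpace K P).rep := P.2

theorem mkPt_eq_mkPt_iff {w w' : Fin 4 → K} {hw hw' h h'} :
    E.mkPt K w hw h = E.mkPt K w' hw' h' ↔ ∃ a : K, a • w' = w :=
  Subtype.ext_iff.trans (Projectivization.mk_eq_mk_iff' K _ _ hw hw')

theorem mkPt_rep (P : E.Pt K) :
    E.mkPt K (E.toSpace K P).rep (E.toSpace K P).rep_nonzero (onCurve_rep P) = P :=
  Subtype.ext (Projectivization.mk_rep _)

theorem rep_mkPt (w : Fin 4 → K) (hw h) :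
    ∃ a : K, a ≠ 0 ∧ (E.toSpace K (E.mkPt K w hw h)).rep = a • w := by
  obtain ⟨a, ha⟩ := Projectivization.exists_smul_eq_mk_rep K w hw
  exact ⟨a, a.ne_zero, ha.symm⟩

theorem exists_mkPt (P : E.Pt K) : ∃ w hw h, P = E.mkPt K w hw h :=
  ⟨_, _, _, (mkPt_rep P).symm⟩

/-- A linear change of coordinates, as a map of curves. -/
noncomputable def mapPt {k' : Type*} [Field k'] [Algebra k' K] {E' : DoubleEquation k'}
    (L : (Fin 4 → K) ≃ₗ[K] (Fin 4 → K)) (hL : ∀ w, E.OnCurve K w → E'.OnCurve K (L w))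
    (P : E.Pt K) : E'.Pt K :=
  E'.mkPt K (L (E.toSpace K P).rep) (L.map_ne_zero_iff.2 (E.toSpace K P).rep_nonzero)
    (hL _ (onCurve_rep P))

section mapPt

variable {k' : Type*} [Field k'] [Algebra k' K] {E' : DoubleEquation k'}
  (L : (Fin 4 → K) ≃ₗ[K] (Fin 4 → K)) (hL : ∀ w, E.OnCurve K w → E'.OnCurve K (L w))

theorem mapPt_mkPt (w : Fin 4 → K) (hw h) : mapPt L hL (E.mkPt K w hw h) =
    E'.mkPt K (L w) (L.map_ne_zero_iff.2 hw) (hL w h) := by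
  obtain ⟨a, -, ha⟩ := rep_mkPt w hw h
  exact mkPt_eq_mkPt_iff.2 ⟨a, by rw [ha, map_smul]⟩

theorem isRegularMap_mapPt : IsRegularMap (E.toSpace K) (E'.toSpace K) (mapPt L hL) := by
  refine isRegularMap_of_forall (d := 1) (isLift_rep _) (isLift_rep _) (fun v => L v) ?_ ?_
  · intro j
    exact IsForm.linearMap ((LinearMap.proj j).comp L.toLinearMap)
  · intro P
    obtain ⟨a, ha0, ha⟩ := rep_mkPt (E := E') (L (E.toSpace K P).rep)
      (L.map_ne_zero_iff.2 (E.toSpace K P).rep_nonzero) (hL _ (onCurve_rep P))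
    refine ⟨a⁻¹, inv_ne_zero ha0, ?_⟩
    rw [mapPt, ha, smul_smul, inv_mul_cancel₀ ha0, one_smul]

theorem mapPt_mapPt_symm (hL' : ∀ w, E'.OnCurve K w → E.OnCurve K (L.symm w)) (P : E'.Pt K) :
    mapPt L hL (mapPt L.symm hL' P) = P := by
  obtain ⟨w, hw, h, rfl⟩ := exists_mkPt P
  rw [mapPt_mkPt, mapPt_mkPt]
  exact mkPt_eq_mkPt_iff.2 ⟨1, by simp⟩

end mapPt

end Basic

/-! ### Consequences of smoothness -/

section Smooth

variable {k : Type*} [Field k] {E : DoubleEquation k} {K : Type*} [Field K] [Algebra k K]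

theorem IsSmooth.eq_zero (hE : E.IsSmooth K) {w : Fin 4 → K} (hw : w ≠ 0) (h : E.OnCurve K w)
    {α β : K}
    (h0 : α * (2 * algebraMap k K E.a₁ * w 0 + algebraMap k K E.b₁ * w 3) +
      β * (2 * algebraMap k K E.a₂ * w 0 + algebraMap k K E.b₂ * w 3) = 0)
    (h1 : α * w 1 = 0) (h2 : β * w 2 = 0)
    (h3 : α * (algebraMap k K E.b₁ * w 0 + 2 * algebraMap k K E.c₁ * w 3) +
      β * (algebraMap k K E.b₂ * w 0 + 2 * algebraMap k K E.c₂ * w 3) = 0) : α = 0 ∧ β = 0 := by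
  obtain ⟨a, -, ha⟩ := rep_mkPt w hw h
  have := hE (E.mkPt K w hw h)
  rw [LinearIndependent.pair_iff] at this
  refine this α β (funext fun j => ?_)
  rw [ha]
  fin_cases j
  · simp [form₁, form₂, pderiv_X, Pi.single_apply]
    linear_combination a * h0
  · simp [form₁, form₂, pderiv_X, Pi.single_apply]
    rcases mul_eq_zero.1 h1 with h | h <;> simp [h]
  · simp [form₁, form₂, pderiv_X, Pi.single_apply]
    rcases mul_eq_zero.1 h2 with h | h <;> simp [h]
  · simp [form₁, form₂, pderiv_X, Pi.single_apply]
    linear_combination a * h3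

/-- The two quadratic forms have no common zero. -/
theorem IsSmooth.eq_zero_of_p (hE : E.IsSmooth K) {x z : K} (h₁ : E.p₁ K x z = 0)
    (h₂ : E.p₂ K x z = 0) : x = 0 ∧ z = 0 := by
  by_contra hne
  have hw : (![x, 0, 0, z] : Fin 4 → K) ≠ 0 := fun h =>
    hne ⟨congrFun h 0, congrFun h 3⟩
  have h : E.OnCurve K ![x, 0, 0, z] := (onCurve_iff ..).2 ⟨by simpa using h₁, by simpa using h₂⟩
  have key := fun α β : K => hE.eq_zero hw h (α := α) (β := β)
  simp only [Matrix.cons_val, mul_zero, forall_const] at key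
  rw [p₁] at h₁
  rw [p₂] at h₂
  -- by Euler's identity both gradients in `(x, z)` are orthogonal to the vector `(x, z)`
  generalize algebraMap k K E.a₁ = A₁, algebraMap k K E.b₁ = B₁, algebraMap k K E.c₁ = C₁,
    algebraMap k K E.a₂ = A₂, algebraMap k K E.b₂ = B₂, algebraMap k K E.c₂ = C₂ at *
  rcases not_and_or.1 hne with hx | hz
  · obtain ⟨h3, h4⟩ := key (B₂ * x + 2 * C₂ * z) (-(B₁ * x + 2 * C₁ * z))
      (mul_left_cancel₀ hx (by
        linear_combination (2 * (B₂ * x + 2 * C₂ * z)) * h₁ - (2 * (B₁ * x + 2 * C₁ * z)) * h₂))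
      (by ring)
    refine one_ne_zero (key 1 0 (mul_left_cancel₀ hx ?_) ?_).1
    · linear_combination 2 * h₁ + z * h4
    · linear_combination -h4
  · obtain ⟨h3, h4⟩ := key (2 * A₂ * x + B₂ * z) (-(2 * A₁ * x + B₁ * z)) (by ring)
      (mul_left_cancel₀ hz (by
        linear_combination (2 * (2 * A₂ * x + B₂ * z)) * h₁ - (2 * (2 * A₁ * x + B₁ * z)) * h₂))
    refine one_ne_zero (key 1 0 ?_ (mul_left_cancel₀ hz ?_)).1
    · linear_combination -h4
    · linear_combination 2 * h₁ + x * h4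

theorem exists_sq_eq [IsAlgClosed K] (a : K) : ∃ b : K, b ^ 2 = a :=
  IsAlgClosed.exists_pow_nat_eq a two_pos

/-- A binary quadratic form of discriminant zero has a singular zero. -/
theorem exists_gradient_eq_zero {a b c : K} (h : b ^ 2 - 4 * a * c = 0) :
    ∃ x z : K, ¬(x = 0 ∧ z = 0) ∧ 2 * a * x + b * z = 0 ∧ b * x + 2 * c * z = 0 := by
  by_cases h1 : b = 0 ∧ 2 * a = 0
  · exact ⟨1, 0, by simp, by linear_combination h1.2, by linear_combination h1.1⟩
  · exact ⟨b, -(2 * a), by rwa [neg_eq_zero], by ring, by linear_combination h⟩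

variable [IsAlgClosed K] [CharZero K]

theorem IsSmooth.discr₁_ne_zero (hE : E.IsSmooth K) : algebraMap k K E.b₁ ^ 2 -
    4 * algebraMap k K E.a₁ * algebraMap k K E.c₁ ≠ 0 := by
  intro hd
  obtain ⟨x, z, hne, hx, hz⟩ := exists_gradient_eq_zero hd
  obtain ⟨v, hv⟩ := exists_sq_eq (E.p₂ K x z)
  have h1 : E.p₁ K x z = 0 := by
    rw [p₁]
    linear_combination (x / 2) * hx + (z / 2) * hz
  have hw : (![x, 0, v, z] : Fin 4 → K) ≠ 0 := fun h => hne ⟨congrFun h 0, congrFun h 3⟩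
  have h : E.OnCurve K ![x, 0, v, z] := (onCurve_iff ..).2
    ⟨by simpa using h1, by simpa using hv.symm⟩
  refine one_ne_zero (hE.eq_zero hw h (α := 1) (β := 0) ?_ ?_ ?_ ?_).1
  · simpa using hx
  · simp
  · simp
  · simpa using hz

theorem IsSmooth.discr₂_ne_zero (hE : E.IsSmooth K) : algebraMap k K E.b₂ ^ 2 -
    4 * algebraMap k K E.a₂ * algebraMap k K E.c₂ ≠ 0 := by
  intro hd
  obtain ⟨x, z, hne, hx, hz⟩ := exists_gradient_eq_zero hd
  obtain ⟨u, hu⟩ := exists_sq_eq (E.p₁ K x z)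
  have h1 : E.p₂ K x z = 0 := by
    rw [p₂]
    linear_combination (x / 2) * hx + (z / 2) * hz
  have hw : (![x, u, 0, z] : Fin 4 → K) ≠ 0 := fun h => hne ⟨congrFun h 0, congrFun h 3⟩
  have h : E.OnCurve K ![x, u, 0, z] := (onCurve_iff ..).2
    ⟨by simpa using hu.symm, by simpa using h1⟩
  refine one_ne_zero (hE.eq_zero hw h (α := 0) (β := 1) ?_ ?_ ?_ ?_).2
  · simpa using hx
  · simp
  · simp
  · simpa using hz

end Smooth

end DoubleEquation

/-! ### The normal form `u² = x z`, `v² = x² + b x z + c z²` and its Weierstrass model -/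

namespace DoubleEquation

section NormalForm

variable {K : Type*} [Field K] (b c : K)

/-- The double equation `x = u²`, `x² + b x + c = v²`. -/
def normalForm : DoubleEquation K := ⟨0, 1, 0, 1, b, c⟩

/-- The Weierstrass curve `y² = (x + b) (x² - 4 c)`.  With `x = 2 (X + V) / Z` and
`y = 2 U (x + b) / Z` it is birational to the curve `U² = X Z`, `V² = X² + b X Z + c Z²`. -/
def normalWeierstrass : WeierstrassCurve.Affine K := ⟨0, b, 0, -4 * c, -4 * b * c⟩

variable {b c}

theorem normalForm_onCurve_iff (w : Fin 4 → K) : (normalForm b c).OnCurve K w ↔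
    w 0 * w 3 = w 1 ^ 2 ∧ w 0 ^ 2 + b * w 0 * w 3 + c * w 3 ^ 2 = w 2 ^ 2 := by
  rw [onCurve_iff]
  simp [p₁, p₂, normalForm]

theorem isElliptic_normalWeierstrass [CharZero K] (hc : c ≠ 0) (hd : b ^ 2 - 4 * c ≠ 0) :
    (normalWeierstrass b c).IsElliptic := by
  refine ⟨isUnit_iff_ne_zero.2 ?_⟩
  have : (normalWeierstrass b c).Δ = 256 * c * (b ^ 2 - 4 * c) ^ 2 := by
    simp only [normalWeierstrass, WeierstrassCurve.Δ, WeierstrassCurve.b₂, WeierstrassCurve.b₄,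
      WeierstrassCurve.b₆, WeierstrassCurve.b₈]
    ring
  rw [this]
  exact mul_ne_zero (mul_ne_zero (by norm_num) hc) (pow_ne_zero _ hd)

theorem normalWeierstrass_equation {x y : K} (h : (normalWeierstrass b c).Nonsingular x y) :
    y ^ 2 = (x + b) * (x ^ 2 - 4 * c) := by
  have := (WeierstrassCurve.Affine.equation_iff _ _).1 h.1
  simp only [normalWeierstrass] at this
  linear_combination this

open WeierstrassCurve.Affine WeierstrassCurve.Affine.Point

/-- Coordinates on the space curve of a point of the Weierstrass model. -/
def spaceVec : (normalWeierstrass b c).Point → Fin 4 → K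
  | .zero => ![1, 0, 1, 0]
  | .some x y _ => ![x ^ 2 - 4 * c, 2 * y, x ^ 2 + 2 * b * x + 4 * c, 4 * (x + b)]

/-- The hyperplane `2 V - 2 X - b Z = 0` meets the space curve only in `(1 : 0 : 1 : 0)`. -/
theorem spaceVec_hyperplane {x y : K} (h : (normalWeierstrass b c).Nonsingular x y) :
    2 * spaceVec (.some x y h) 2 - 2 * spaceVec (.some x y h) 0 - b * spaceVec (.some x y h) 3 =
      -4 * (b ^ 2 - 4 * c) := by
  simp only [spaceVec, Matrix.cons_val]
  ring

theorem onCurve_spaceVec (P : (normalWeierstrass b c).Point) :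
    (normalForm b c).OnCurve K (spaceVec P) := by
  rw [normalForm_onCurve_iff]
  rcases P with _ | ⟨x, y, h⟩
  · simp [spaceVec]
  · have := normalWeierstrass_equation h
    simp only [spaceVec, Matrix.cons_val]
    exact ⟨by linear_combination -4 * this, by ring⟩

variable [CharZero K]

theorem spaceVec_ne_zero (hd : b ^ 2 - 4 * c ≠ 0) (P : (normalWeierstrass b c).Point) :
    spaceVec P ≠ 0 := by
  rcases P with _ | ⟨x, y, h⟩
  · exact fun h => by simpa [spaceVec] using congrFun h 0
  · intro h0
    have := spaceVec_hyperplane h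
    rw [h0] at this
    refine mul_ne_zero (by norm_num : (-4 : K) ≠ 0) hd ?_
    simpa using this.symm

theorem spaceVec_injective (hd : b ^ 2 - 4 * c ≠ 0) {P Q : (normalWeierstrass b c).Point} {a : K}
    (h : a • spaceVec P = spaceVec Q) : P = Q := by
  have hd' : -4 * (b ^ 2 - 4 * c) ≠ 0 := mul_ne_zero (by norm_num) hd
  have hl : a * (2 * spaceVec P 2 - 2 * spaceVec P 0 - b * spaceVec P 3) =
      2 * spaceVec Q 2 - 2 * spaceVec Q 0 - b * spaceVec Q 3 := by
    rw [← h]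
    simp only [Pi.smul_apply, smul_eq_mul]
    ring
  rcases P with _ | ⟨x, y, hxy⟩ <;> rcases Q with _ | ⟨x', y', hxy'⟩
  · rfl
  · rw [spaceVec_hyperplane] at hl
    exact (hd' (by rw [← hl]; simp [spaceVec])).elim
  · rw [spaceVec_hyperplane] at hl
    have ha : a = 0 := (mul_eq_zero.1 (hl.trans (by simp [spaceVec]))).resolve_right hd'
    rw [ha, zero_smul] at h
    exact (spaceVec_ne_zero hd _ h.symm).elim
  · rw [spaceVec_hyperplane, spaceVec_hyperplane] at hl
    have ha : a = 1 := mul_right_cancel₀ hd' (by rw [hl, one_mul])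
    rw [ha, one_smul] at h
    have h1 : y = y' := by simpa [spaceVec] using congrFun h 1
    have h3 : x = x' := by simpa [spaceVec] using congrFun h 3
    subst h1 h3
    rfl

/-- Away from the hyperplane `2 V - 2 X - b Z = 0` the inverse of `spaceVec` is `x = Z / 4 - b`,
`y = U / 2`, after scaling. -/
theorem exists_smul_spaceVec (hc : c ≠ 0) (hd : b ^ 2 - 4 * c ≠ 0) {w : Fin 4 → K}
    (h : (normalForm b c).OnCurve K w) : ∃ (P : (normalWeierstrass b c).Point) (a : K),
      a • spaceVec P = w := by
  have := isElliptic_normalWeierstrass hc hd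
  obtain ⟨h1, h2⟩ := (normalForm_onCurve_iff w).1 h
  by_cases hl : 2 * w 2 - 2 * w 0 - b * w 3 = 0
  · have hz : w 3 = 0 := by
      have : (b ^ 2 - 4 * c) * w 3 ^ 2 = 0 := by
        linear_combination -4 * h2 + (2 * w 0 + b * w 3 + 2 * w 2) * (-1) * hl
      exact pow_eq_zero_iff two_ne_zero |>.1 ((mul_eq_zero.1 this).resolve_left hd)
    have hu : w 1 = 0 := by
      rw [hz, mul_zero] at h1
      exact pow_eq_zero_iff two_ne_zero |>.1 h1.symm
    have hv : w 2 = w 0 := by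
      rw [hz] at hl
      linear_combination hl / 2
    refine ⟨0, w 0, ?_⟩
    change w 0 • ![1, 0, 1, 0] = w
    ext i
    fin_cases i <;> simp [hz, hu, hv]
  · -- scale so that the linear form takes its value on the affine part
    have hd' : -4 * (b ^ 2 - 4 * c) ≠ 0 := mul_ne_zero (by norm_num) hd
    obtain ⟨a, ha0, ha⟩ : ∃ a : K, a ≠ 0 ∧
        2 * w 2 - 2 * w 0 - b * w 3 = a * (-4 * (b ^ 2 - 4 * c)) :=
      ⟨_, div_ne_zero hl hd', (div_mul_cancel₀ _ hd').symm⟩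
    obtain ⟨w, rfl⟩ : ∃ w' : Fin 4 → K, w = a • w' := ⟨a⁻¹ • w, by rw [smul_inv_smul₀ ha0]⟩
    simp only [Pi.smul_apply, smul_eq_mul] at h1 h2 ha
    have e0 : 2 * w 2 - 2 * w 0 - b * w 3 = -4 * (b ^ 2 - 4 * c) :=
      mul_left_cancel₀ ha0 (by linear_combination ha)
    have e1 : w 0 * w 3 = w 1 ^ 2 := mul_left_cancel₀ (pow_ne_zero 2 ha0) (by linear_combination h1)
    have e2 : w 0 ^ 2 + b * w 0 * w 3 + c * w 3 ^ 2 = w 2 ^ 2 :=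
      mul_left_cancel₀ (pow_ne_zero 2 ha0) (by linear_combination h2)
    have e3 : w 2 = w 0 + b * w 3 / 2 - 2 * (b ^ 2 - 4 * c) := by linear_combination e0 / 2
    have e4 : w 0 = (w 3 / 4 - b) ^ 2 - 4 * c := by
      rw [e3] at e2
      refine mul_left_cancel₀ hd' ?_
      linear_combination -e2
    have heq : (normalWeierstrass b c).Equation (w 3 / 4 - b) (w 1 / 2) := by
      rw [equation_iff]
      simp only [normalWeierstrass]
      linear_combination -e1 / 4 + (w 3 / 4) * e4
    refine ⟨.some _ _ (equation_iff_nonsingular.1 heq), a, congrArg (a • ·) ?_⟩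
    ext i
    fin_cases i
    · exact e4.symm
    · simp [spaceVec]
      ring
    · simp [spaceVec]
      linear_combination -e3 - e4
    · simp [spaceVec]
      ring

/-- The normal form and its Weierstrass model are isomorphic curves. -/
theorem exists_equiv_normalWeierstrass (hc : c ≠ 0) (hd : b ^ 2 - 4 * c ≠ 0) :
    ∃ φ : (normalForm b c).Pt K ≃ (normalWeierstrass b c).Point,
      IsRegularMap ((normalForm b c).toSpace K) (weierstrassToPlane (normalWeierstrass b c)) φ ∧
      IsRegularMap (weierstrassToPlane (normalWeierstrass b c)) ((normalForm b c).toSpace K)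
        φ.symm := by
  let f : (normalWeierstrass b c).Point → (normalForm b c).Pt K := fun P =>
    (normalForm b c).mkPt K (spaceVec P) (spaceVec_ne_zero hd P) (onCurve_spaceVec P)
  have hf : Function.Bijective f := by
    refine ⟨fun P Q h => ?_, fun P => ?_⟩
    · obtain ⟨a, ha⟩ := mkPt_eq_mkPt_iff.1 h.symm
      exact spaceVec_injective hd ha
    · obtain ⟨w, hw, h, rfl⟩ := exists_mkPt P
      obtain ⟨P, a, ha⟩ := exists_smul_spaceVec hc hd h
      have ha0 : a ≠ 0 := by
        rintro rfl
        exact hw (by rw [← ha, zero_smul])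
      exact ⟨P, mkPt_eq_mkPt_iff.2 ⟨a⁻¹, by rw [← ha, inv_smul_smul₀ ha0]⟩⟩
  let e := Equiv.ofBijective f hf
  have hlift : IsLift ((normalForm b c).toSpace K) (fun Q => spaceVec (e.symm Q)) := fun Q =>
    ⟨spaceVec_ne_zero hd _, congrArg Subtype.val (e.apply_symm_apply Q).symm⟩
  refine ⟨e.symm, ?_, ?_⟩
  · rw [isRegularMap_iff hlift isLift_coordVec]
    suffices h : ∀ P, ∃ (d : ℕ) (g : (Fin 4 → K) → Fin 3 → K), (∀ j, IsForm d (fun x => g x j)) ∧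
        g (spaceVec P) ≠ 0 ∧
        ∀ Q : (normalWeierstrass b c).Point, ∃ a : K, g (spaceVec Q) = a • coordVec Q from by
      intro P
      obtain ⟨d, g, hg, hP, hQ⟩ := h (e.symm P)
      exact ⟨d, g, hg, hP, fun Q => hQ _⟩
    have hd' : -4 * (b ^ 2 - 4 * c) ≠ 0 := mul_ne_zero (by norm_num) hd
    obtain ⟨κ, hκ⟩ : ∃ κ : K, κ * (-4 * (b ^ 2 - 4 * c)) = 1 := ⟨_, inv_mul_cancel₀ hd'⟩
    have X := IsForm.coord (K := K) (m := 4) 0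
    have U := IsForm.coord (K := K) (m := 4) 1
    have V := IsForm.coord (K := K) (m := 4) 2
    have Z := IsForm.coord (K := K) (m := 4) 3
    rintro (_ | ⟨x, y, hxy⟩)
    · -- Near the point at infinity: on the affine part `X (V + X) = 2 x y²`, and
      -- `2 c (V + X) - b² X - b c Z = -(b² - 4 c) x²`, so that the three forms below are the
      -- multiples of `x`, `y`, `1` by `8 x² y³`.
      have hT := (U.pow 3).mul ((((V.add X).const_mul (2 * c)).sub (X.const_mul (b ^ 2))).sub
        (Z.const_mul (b * c)))
      refine ⟨4, fun v => ![v 0 * v 1 * (v 2 + v 0) ^ 2 - (4 * b * κ) *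
          (v 1 ^ 3 * (2 * c * (v 2 + v 0) - b ^ 2 * v 0 - b * c * v 3)),
          2 * (v 0 ^ 2 * (v 2 + v 0) ^ 2),
          4 * κ * (v 1 ^ 3 * (2 * c * (v 2 + v 0) - b ^ 2 * v 0 - b * c * v 3))], ?_, ?_, ?_⟩
      · intro j
        fin_cases j
        · exact ((X.mul U).mul ((V.add X).pow 2)).sub (hT.const_mul (4 * b * κ))
        · exact ((X.pow 2).mul ((V.add X).pow 2)).const_mul 2
        · exact hT.const_mul (4 * κ)
      · intro h
        have := congrFun h 1
        simp [spaceVec] at this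
      · rintro (_ | ⟨x, y, hxy⟩)
        · refine ⟨8, ?_⟩
          ext i
          fin_cases i
          · simp [spaceVec, coordVec]
          · simp [spaceVec, coordVec]
            norm_num
          · simp [spaceVec, coordVec]
        · refine ⟨8 * x ^ 2 * y ^ 3, ?_⟩
          have he := normalWeierstrass_equation hxy
          ext i
          fin_cases i
          · simp [spaceVec, coordVec]
            linear_combination 8 * y * x ^ 2 * (-(x + b)) * he - 8 * b * y ^ 3 * x ^ 2 * hκ
          · simp [spaceVec, coordVec]
            linear_combination 8 * x ^ 2 * (-(y ^ 2 + (x + b) * (x ^ 2 - 4 * c))) * he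
          · simp [spaceVec, coordVec]
            linear_combination 8 * y ^ 3 * x ^ 2 * hκ
    · -- on the affine part the inverse is a linear projection
      have hL := ((V.const_mul 2).sub (X.const_mul 2)).sub (Z.const_mul b)
      refine ⟨1, fun v => ![4⁻¹ * v 3 - (b * κ) * (2 * v 2 - 2 * v 0 - b * v 3), 2⁻¹ * v 1,
        κ * (2 * v 2 - 2 * v 0 - b * v 3)], ?_, ?_, ?_⟩
      · intro j
        fin_cases j
        · exact (Z.const_mul 4⁻¹).sub (hL.const_mul (b * κ))
        · exact U.const_mul 2⁻¹
        · exact hL.const_mul κ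
      · intro h
        have := congrFun h 2
        simp only [Matrix.cons_val, spaceVec_hyperplane, hκ] at this
        simp at this
      · rintro (_ | ⟨x, y, hxy⟩)
        · refine ⟨0, ?_⟩
          ext i
          fin_cases i <;> simp [spaceVec]
        · refine ⟨1, ?_⟩
          have hl := spaceVec_hyperplane hxy
          ext i
          fin_cases i
          · simp only [hl, Fin.zero_eta, Matrix.cons_val]
            simp [spaceVec, coordVec]
            linear_combination -b * hκ
          · simp [spaceVec, coordVec]
          · simp only [hl, Fin.reduceFinMk, Matrix.cons_val]
            simp only [coordVec, Pi.smul_apply, Matrix.cons_val, smul_eq_mul, mul_one]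
            exact hκ
  · rw [isRegularMap_iff isLift_coordVec hlift]
    have hsymm : ∀ Q, spaceVec (e.symm (e.symm.symm Q)) = spaceVec Q := fun Q =>
      congrArg spaceVec (e.symm_apply_apply Q)
    rintro (_ | ⟨x, y, hxy⟩)
    · -- multiplication by `x + b` turns `x² - 4 c` into `y²` and extends the formulas to infinity
      refine ⟨2, fun v => ![v 1 ^ 2, 2 * v 1 * (v 0 + b * v 2),
        v 1 ^ 2 + (2 * b * v 0 + 8 * c * v 2) * (v 0 + b * v 2), 4 * (v 0 + b * v 2) ^ 2],
        ?_, ?_, ?_⟩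
      · intro j
        fin_cases j <;> refine IsForm.of_ternary fun v => ?_ <;> simp <;> ring
      · intro h
        simpa [coordVec] using congrFun h 0
      · intro Q
        beta_reduce
        rw [hsymm]
        rcases Q with _ | ⟨x, y, hxy⟩
        · refine ⟨1, ?_⟩
          ext i
          fin_cases i <;> simp [spaceVec, coordVec]
        · refine ⟨x + b, ?_⟩
          have he := normalWeierstrass_equation hxy
          ext i
          fin_cases i
          · simp [spaceVec, coordVec]
            linear_combination he
          · simp [spaceVec, coordVec]
            ring
          · simp [spaceVec, coordVec]
            linear_combination he
          · simp [spaceVec, coordVec]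
            ring
    · have key : ∀ Q : (normalWeierstrass b c).Point, ∃ a : K,
          ![coordVec Q 0 ^ 2 - 4 * c * coordVec Q 2 ^ 2, 2 * coordVec Q 1 * coordVec Q 2,
            coordVec Q 0 ^ 2 + 2 * b * coordVec Q 0 * coordVec Q 2 + 4 * c * coordVec Q 2 ^ 2,
            4 * (coordVec Q 0 + b * coordVec Q 2) * coordVec Q 2] = a • spaceVec Q ∧
          (Q ≠ 0 → a = 1) := by
        rintro (_ | ⟨x, y, hxy⟩)
        · refine ⟨0, ?_, fun h => (h rfl).elim⟩
          ext i
          fin_cases i <;> simp [coordVec]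
        · refine ⟨1, ?_, fun _ => rfl⟩
          ext i
          fin_cases i <;> simp [coordVec, spaceVec]
      refine ⟨2, fun v => ![v 0 ^ 2 - 4 * c * v 2 ^ 2, 2 * v 1 * v 2,
        v 0 ^ 2 + 2 * b * v 0 * v 2 + 4 * c * v 2 ^ 2, 4 * (v 0 + b * v 2) * v 2], ?_, ?_, ?_⟩
      · intro j
        fin_cases j <;> refine IsForm.of_ternary fun v => ?_ <;> simp <;> ring
      · obtain ⟨a, ha, ha'⟩ := key (.some x y hxy)
        beta_reduce
        rw [ha, ha' (some_ne_zero _), one_smul]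
        exact spaceVec_ne_zero hd _
      · intro Q
        beta_reduce
        rw [hsymm]
        obtain ⟨a, ha, -⟩ := key Q
        exact ⟨a, ha⟩

end NormalForm

/-! ### Existence of the group law -/

section Existence

variable {k : Type*} [Field k] {E : DoubleEquation k} {K : Type*} [Field K] [Algebra k K]
  [IsAlgClosed K] [CharZero K]

/-- A binary quadratic form splits into linear factors. -/
theorem exists_linear_factors (a b c : K) :
    ∃ p q r s : K, p * r = a ∧ p * s + q * r = b ∧ q * s = c := by
  by_cases ha : a = 0
  · exact ⟨0, 1, b, c, by simp [ha], by ring, by ring⟩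
  · obtain ⟨δ, hδ⟩ := exists_sq_eq (b ^ 2 - 4 * a * c)
    refine ⟨1 / 2, (b + δ) / (4 * a), 2 * a, b - δ, by ring, ?_, ?_⟩
    · field_simp
      ring
    · field_simp
      linear_combination -hδ

/-- The linear change of coordinates `X = p x + q z`, `V = v / ν`, `Z = r x + s z`. -/
noncomputable def coordChange (p q r s ν : K) (h : p * s - q * r ≠ 0) (hν : ν ≠ 0) :
    (Fin 4 → K) ≃ₗ[K] (Fin 4 → K) where
  toFun w := ![p * w 0 + q * w 3, w 1, w 2 / ν, r * w 0 + s * w 3]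
  invFun w := ![(s * w 0 - q * w 3) / (p * s - q * r), w 1, ν * w 2,
    (p * w 3 - r * w 0) / (p * s - q * r)]
  map_add' w w' := by
    ext i
    fin_cases i <;> simp <;> ring
  map_smul' a w := by
    ext i
    fin_cases i <;> simp <;> ring
  left_inv w := by
    ext i
    fin_cases i
    · simp only [Fin.zero_eta, Matrix.cons_val]
      rw [div_eq_iff h]
      ring
    · rfl
    · exact mul_div_cancel₀ _ hν
    · simp only [Fin.reduceFinMk, Matrix.cons_val]
      rw [div_eq_iff h]
      ring
  right_inv w := by
    ext i
    fin_cases i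
    · simp only [Fin.zero_eta, Matrix.cons_val]
      rw [← mul_div_assoc, ← mul_div_assoc, ← add_div, div_eq_iff h]
      ring
    · rfl
    · exact mul_div_cancel_left₀ _ hν
    · simp only [Fin.reduceFinMk, Matrix.cons_val]
      rw [← mul_div_assoc, ← mul_div_assoc, ← add_div, div_eq_iff h]
      ring

/-- Over an algebraically closed field a smooth double equation has the normal form
`u² = x z`, `v² = x² + b x z + c z²`: factor the first quadratic form. -/
theorem IsSmooth.exists_equiv_normalForm (hE : E.IsSmooth K) :
    ∃ (b c : K) (e : E.Pt K ≃ (normalForm b c).Pt K), c ≠ 0 ∧ b ^ 2 - 4 * c ≠ 0 ∧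
      IsRegularMap (E.toSpace K) ((normalForm b c).toSpace K) e ∧
      IsRegularMap ((normalForm b c).toSpace K) (E.toSpace K) e.symm := by
  have hd₁ := hE.discr₁_ne_zero
  have hd₂ := hE.discr₂_ne_zero
  have hp := fun x z => hE.eq_zero_of_p (x := x) (z := z)
  have hon := E.onCurve_iff K
  simp only [p₁, p₂] at hp hon
  generalize algebraMap k K E.a₁ = A₁, algebraMap k K E.b₁ = B₁, algebraMap k K E.c₁ = C₁,
    algebraMap k K E.a₂ = A₂, algebraMap k K E.b₂ = B₂, algebraMap k K E.c₂ = C₂ at *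
  obtain ⟨p, q, r, s, rfl, rfl, rfl⟩ := exists_linear_factors A₁ B₁ C₁
  have hdet : p * s - q * r ≠ 0 := fun h => hd₁ (by linear_combination (p * s - q * r) * h)
  obtain ⟨a, ha⟩ : ∃ a, a = A₂ * s ^ 2 - B₂ * s * r + C₂ * r ^ 2 := ⟨_, rfl⟩
  obtain ⟨c, hc⟩ : ∃ c, c = A₂ * q ^ 2 - B₂ * q * p + C₂ * p ^ 2 := ⟨_, rfl⟩
  obtain ⟨b, hb⟩ : ∃ b, b = -2 * A₂ * s * q + B₂ * (s * p + q * r) - 2 * C₂ * r * p := ⟨_, rfl⟩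
  have ha0 : a ≠ 0 := by
    intro h
    obtain ⟨h1, h2⟩ := hp s (-r) (by ring) (by linear_combination h - ha)
    exact hdet (by linear_combination p * h1 + q * h2)
  have hc0 : c ≠ 0 := by
    intro h
    obtain ⟨h1, h2⟩ := hp (-q) p (by ring) (by linear_combination h - hc)
    exact hdet (by linear_combination r * h1 + s * h2)
  have hbac : b ^ 2 - 4 * a * c ≠ 0 := by
    have : b ^ 2 - 4 * a * c = (B₂ ^ 2 - 4 * A₂ * C₂) * (p * s - q * r) ^ 2 := by
      rw [ha, hb, hc]
      ring
    rw [this]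
    exact mul_ne_zero hd₂ (pow_ne_zero _ hdet)
  obtain ⟨ν, hν⟩ := exists_sq_eq (a / (p * s - q * r) ^ 2)
  have hν0 : ν ≠ 0 := by
    rintro rfl
    exact div_ne_zero ha0 (pow_ne_zero 2 hdet) (by rw [← hν]; ring)
  have hν' : ν ^ 2 * (p * s - q * r) ^ 2 = a := by
    rw [hν, div_mul_cancel₀ _ (pow_ne_zero 2 hdet)]
  -- `p₂` in the new coordinates
  have key : ∀ x z : K, (p * s - q * r) ^ 2 * (A₂ * x ^ 2 + B₂ * x * z + C₂ * z ^ 2) =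
      a * (p * x + q * z) ^ 2 + b * (p * x + q * z) * (r * x + s * z) +
        c * (r * x + s * z) ^ 2 := by
    intro x z
    rw [ha, hb, hc]
    ring
  let L := coordChange p q r s ν hdet hν0
  have hL : ∀ w, E.OnCurve K w ↔ (normalForm (b / a) (c / a)).OnCurve K (L w) := by
    intro w
    rw [hon, normalForm_onCurve_iff]
    have e0 : L w 0 = p * w 0 + q * w 3 := rfl
    have e1 : L w 1 = w 1 := rfl
    have e2 : L w 2 = w 2 / ν := rfl
    have e3 : L w 3 = r * w 0 + s * w 3 := rfl
    have h2 : (L w 0 ^ 2 + b / a * L w 0 * L w 3 + c / a * L w 3 ^ 2) * a =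
        (p * s - q * r) ^ 2 * (A₂ * w 0 ^ 2 + B₂ * w 0 * w 3 + C₂ * w 3 ^ 2) := by
      rw [key, e0, e3]
      field_simp
    have h3 : L w 2 ^ 2 * a = (p * s - q * r) ^ 2 * w 2 ^ 2 := by
      rw [e2, ← hν']
      field_simp
    refine and_congr ?_ ?_
    · rw [e0, e1, e3]
      constructor <;> intro h <;> linear_combination h
    · rw [← (mul_left_injective₀ ha0).eq_iff (a := L w 0 ^ 2 + _ + _), h2, h3,
        (mul_right_injective₀ (pow_ne_zero 2 hdet)).eq_iff]
  have hL1 : ∀ w, E.OnCurve K w → (normalForm (b / a) (c / a)).OnCurve K (L w) :=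
    fun w => (hL w).1
  have hL2 : ∀ w, (normalForm (b / a) (c / a)).OnCurve K w → E.OnCurve K (L.symm w) :=
    fun w h => (hL _).2 (by rwa [L.apply_symm_apply])
  refine ⟨b / a, c / a, ⟨mapPt L hL1, mapPt L.symm hL2, fun P => ?_, fun P => ?_⟩,
    div_ne_zero hc0 ha0, ?_, isRegularMap_mapPt L hL1, isRegularMap_mapPt L.symm hL2⟩
  · exact mapPt_mapPt_symm L.symm hL2 hL1 P
  · exact mapPt_mapPt_symm L hL1 hL2 P
  · intro h
    field_simp at h
    exact hbac (by linear_combination h)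

/-- The addition of the Weierstrass model, transported to the curve, after a translation which takes
`O` to the point at infinity. -/
theorem IsSmooth.exists_isGroupLaw (hE : E.IsSmooth K) (O : E.Pt K) :
    ∃ G : AddCommGroup (E.Pt K), IsGroupLaw O G := by
  classical
  obtain ⟨b, c, e, hc, hd, he, he'⟩ := hE.exists_equiv_normalForm
  obtain ⟨φ, hφ, hφ'⟩ := exists_equiv_normalWeierstrass hc hd
  have := isElliptic_normalWeierstrass hc hd
  have h2 : (2 : K) ≠ 0 := two_ne_zero
  let ψ := (e.trans φ).trans (Equiv.addRight (-φ (e O)))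
  refine ⟨ψ.addCommGroup, normalWeierstrass b c, ψ, this, ?_, ?_, ?_, ?_⟩
  · exact (WeierstrassCurve.Affine.Point.isRegularMap_add_right h2 (-φ (e O))).comp (hφ.comp he)
  · have := he'.comp (hφ'.comp (WeierstrassCurve.Affine.Point.isRegularMap_add_right h2 (φ (e O))))
    convert this using 1
    funext P
    simp [ψ]
  · exact add_neg_cancel _
  · intro P Q
    convert ψ.apply_symm_apply (ψ P + ψ Q)
    rfl

end Existence

end DoubleEquation

/-! ### Uniqueness of the group law and involutions of the curve -/

namespace DoubleEquation

section Group

variable {k : Type*} [Field k] {E : DoubleEquation k} {K : Type*} [Field K] [Algebra k K]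
  {O : E.Pt K}

theorem IsGroupLaw.origin_eq_zero [G : AddCommGroup (E.Pt K)] (hG : IsGroupLaw O G) : O = 0 := by
  classical
  obtain ⟨W, φ, -, -, -, h0, hadd⟩ := hG
  apply φ.injective
  have : φ 0 = φ 0 + φ 0 := by
    convert hadd 0 0
    exact (add_zero _).symm
  rw [h0]
  exact (left_eq_add.1 this).symm

variable [IsAlgClosed K]

/-- Two group laws with the same origin differ by an isomorphism of Weierstrass curves that
respects the points at infinity, and such an isomorphism is additive. -/
theorem IsGroupLaw.unique {G G' : AddCommGroup (E.Pt K)} (hG : IsGroupLaw O G)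
    (hG' : IsGroupLaw O G') : G = G' := by
  classical
  obtain ⟨W, φ, hW, hφ, hφ', h0, hadd⟩ := hG
  obtain ⟨W', φ', hW', hχ, hχ', h0', hadd'⟩ := hG'
  have key := WeierstrassCurve.Affine.Point.map_add_of_isRegularMap (φ.symm.trans φ')
    (hχ.comp hφ') (hφ.comp hχ') (by
      change φ' (φ.symm 0) = 0
      rw [← h0, φ.symm_apply_apply, h0'])
  apply AddCommGroup.ext
  funext P Q
  apply φ'.injective
  refine Eq.trans ?_ (hadd' P Q).symm
  have := key (φ P) (φ Q)
  simp only [Equiv.trans_apply, φ.symm_apply_apply] at this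
  rw [← this]
  congr 1
  rw [φ.eq_symm_apply]
  convert hadd P Q

theorem IsGroupLaw.reflection_or_translation [CharZero K] [G : AddCommGroup (E.Pt K)]
    (hG : IsGroupLaw O G) {σ : E.Pt K → E.Pt K}
    (hσ : IsRegularMap (E.toSpace K) (E.toSpace K) σ) (hinv : ∀ P, σ (σ P) = P) :
    (∀ P, P + σ P = σ O) ∨ ∀ P, σ P = P + σ O := by
  classical
  obtain ⟨W, φ, hW, hφ, hφ', h0, hadd⟩ := hG
  have hadd : ∀ P Q, φ (P + Q) = φ P + φ Q := fun P Q => by convert hadd P Q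
  have hO : φ.symm 0 = O := by rw [← h0, φ.symm_apply_apply]
  rcases WeierstrassCurve.Affine.Point.reflection_or_translation two_ne_zero
    (φ ∘ σ ∘ φ.symm) (hφ.comp (hσ.comp hφ')) (fun P => by simp [hinv]) with h | h
  · left
    intro P
    apply φ.injective
    simpa [hadd, hO] using h (φ P)
  · right
    intro P
    apply φ.injective
    simpa [hadd, hO] using h (φ P)

end Group

/-! ### The sign changes of `u` and `v` -/

section Flip

variable {k : Type*} [Field k] {E : DoubleEquation k} {K : Type*} [Field K] [Algebra k K]

/-- The sign change of one coordinate. -/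
def flip (K : Type*) [Field K] (i : Fin 4) : (Fin 4 → K) ≃ₗ[K] (Fin 4 → K) :=
  LinearEquiv.ofInvolutive
    { toFun := fun w j => if j = i then -w j else w j
      map_add' := fun w w' => by
        ext j
        by_cases h : j = i <;> simp [h, add_comm]
      map_smul' := fun a w => by
        ext j
        by_cases h : j = i <;> simp [h] }
    fun w => by
      ext j
      by_cases h : j = i <;> simp [h]

theorem flip_apply (i j : Fin 4) (w : Fin 4 → K) : flip K i w j = if j = i then -w j else w j := rfl

theorem onCurve_flip₁ (w : Fin 4 → K) (h : E.OnCurve K w) : E.OnCurve K (flip K 1 w) := by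
  rw [onCurve_iff] at h ⊢
  simpa [flip_apply] using h

theorem onCurve_flip₂ (w : Fin 4 → K) (h : E.OnCurve K w) : E.OnCurve K (flip K 2 w) := by
  rw [onCurve_iff] at h ⊢
  simpa [flip_apply] using h

/-- The involution `u ↦ -u` of the curve. -/
noncomputable def flip₁ : E.Pt K → E.Pt K := mapPt (flip K 1) onCurve_flip₁

/-- The involution `v ↦ -v` of the curve. -/
noncomputable def flip₂ : E.Pt K → E.Pt K := mapPt (flip K 2) onCurve_flip₂

theorem flip₁_flip₁ (P : E.Pt K) : flip₁ (flip₁ P) = P :=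
  mapPt_mapPt_symm (flip K 1) onCurve_flip₁ onCurve_flip₁ P

theorem flip₂_flip₂ (P : E.Pt K) : flip₂ (flip₂ P) = P :=
  mapPt_mapPt_symm (flip K 2) onCurve_flip₂ onCurve_flip₂ P

theorem flip₁_mkPt (w : Fin 4 → K) (hw h) : flip₁ (E.mkPt K w hw h) =
    E.mkPt K (flip K 1 w) ((flip K 1).map_ne_zero_iff.2 hw) (onCurve_flip₁ w h) := mapPt_mkPt ..

theorem flip₂_mkPt (w : Fin 4 → K) (hw h) : flip₂ (E.mkPt K w hw h) =
    E.mkPt K (flip K 2 w) ((flip K 2).map_ne_zero_iff.2 hw) (onCurve_flip₂ w h) := mapPt_mkPt ..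

theorem flip₁_eq_self {w : Fin 4 → K} {hw h} (h1 : w 1 = 0) :
    flip₁ (E.mkPt K w hw h) = E.mkPt K w hw h := by
  rw [flip₁_mkPt]
  refine mkPt_eq_mkPt_iff.2 ⟨1, ?_⟩
  ext j
  by_cases hj : j = 1 <;> simp [flip_apply, hj, h1]

theorem flip₂_eq_self {w : Fin 4 → K} {hw h} (h2 : w 2 = 0) :
    flip₂ (E.mkPt K w hw h) = E.mkPt K w hw h := by
  rw [flip₂_mkPt]
  refine mkPt_eq_mkPt_iff.2 ⟨1, ?_⟩
  ext j
  by_cases hj : j = 2 <;> simp [flip_apply, hj, h2]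

/-- A binary quadratic form over an algebraically closed field has a nontrivial zero. -/
theorem exists_quadratic_eq_zero [IsAlgClosed K] [CharZero K] (a b c : K) :
    ∃ x z : K, ¬(x = 0 ∧ z = 0) ∧ a * x ^ 2 + b * x * z + c * z ^ 2 = 0 := by
  obtain ⟨p, q, r, s, rfl, rfl, rfl⟩ := exists_linear_factors a b c
  by_cases h : q = 0 ∧ p = 0
  · exact ⟨1, 0, by simp, by simp [h]⟩
  · exact ⟨q, -p, by rwa [neg_eq_zero], by ring⟩

theorem exists_quadratic_ne_zero {a b c : K} (h : b ^ 2 - 4 * a * c ≠ 0) :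
    ∃ x z : K, a * x ^ 2 + b * x * z + c * z ^ 2 ≠ 0 := by
  by_contra! hall
  have h1 := hall 1 0
  have h2 := hall 0 1
  have h3 := hall 1 1
  apply h
  ring_nf at h1 h2 h3
  rw [h1, h2] at h3
  rw [h1, h2]
  simp only [zero_add, add_zero] at h3
  simp [h3]

variable [IsAlgClosed K] [CharZero K]

/-- The involution `u ↦ -u` has fixed points, so it is a reflection for the group law. -/
theorem IsGroupLaw.add_flip₁ [G : AddCommGroup (E.Pt K)] {O : E.Pt K} (hE : E.IsSmooth K)
    (hG : IsGroupLaw O G) (P : E.Pt K) : P + flip₁ P = flip₁ O := by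
  rcases hG.reflection_or_translation (isRegularMap_mapPt _ onCurve_flip₁) flip₁_flip₁ with h | h
  · exact h P
  exfalso
  obtain ⟨x, z, hxz, hp⟩ := exists_quadratic_eq_zero (algebraMap k K E.a₁) (algebraMap k K E.b₁)
    (algebraMap k K E.c₁)
  obtain ⟨v, hv⟩ := exists_sq_eq (E.p₂ K x z)
  have hw : (![x, 0, v, z] : Fin 4 → K) ≠ 0 := fun h => hxz ⟨congrFun h 0, congrFun h 3⟩
  have hon : E.OnCurve K ![x, 0, v, z] := (onCurve_iff ..).2
    ⟨by simpa [p₁] using hp, by simpa using hv.symm⟩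
  have h0 : flip₁ O = 0 := by
    have := h (E.mkPt K _ hw hon)
    change flip₁ _ = _ + flip₁ O at this
    rw [flip₁_eq_self rfl] at this
    exact left_eq_add.1 this
  obtain ⟨x, z, hp⟩ := exists_quadratic_ne_zero hE.discr₁_ne_zero
  obtain ⟨u, hu⟩ := exists_sq_eq (E.p₁ K x z)
  obtain ⟨v, hv⟩ := exists_sq_eq (E.p₂ K x z)
  have hu0 : u ≠ 0 := by
    rintro rfl
    exact hp (hu.symm.trans (by simp))
  have hw : (![x, u, v, z] : Fin 4 → K) ≠ 0 := fun h => hu0 (congrFun h 1)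
  have hon : E.OnCurve K ![x, u, v, z] := (onCurve_iff ..).2
    ⟨by simpa using hu.symm, by simpa using hv.symm⟩
  have := h (E.mkPt K _ hw hon)
  change flip₁ _ = _ + flip₁ O at this
  rw [h0, add_zero, flip₁_mkPt] at this
  obtain ⟨a, ha⟩ := mkPt_eq_mkPt_iff.1 this
  have h1 : a * u = -u := by simpa [flip_apply] using congrFun ha 1
  have h2 : a * x = x := by simpa [flip_apply] using congrFun ha 0
  have h3 : a * z = z := by simpa [flip_apply] using congrFun ha 3
  have ha1 : a = -1 := mul_right_cancel₀ hu0 (by rw [h1]; ring)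
  subst ha1
  have hx : x = 0 := by linear_combination -h2 / 2
  have hz : z = 0 := by linear_combination -h3 / 2
  simp [hx, hz] at hp

/-- The involution `v ↦ -v` has fixed points, so it is a reflection for the group law. -/
theorem IsGroupLaw.add_flip₂ [G : AddCommGroup (E.Pt K)] {O : E.Pt K} (hE : E.IsSmooth K)
    (hG : IsGroupLaw O G) (P : E.Pt K) : P + flip₂ P = flip₂ O := by
  rcases hG.reflection_or_translation (isRegularMap_mapPt _ onCurve_flip₂) flip₂_flip₂ with h | h
  · exact h P
  exfalso
  obtain ⟨x, z, hxz, hp⟩ := exists_quadratic_eq_zero (algebraMap k K E.a₂) (algebraMap k K E.b₂)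
    (algebraMap k K E.c₂)
  obtain ⟨u, hu⟩ := exists_sq_eq (E.p₁ K x z)
  have hw : (![x, u, 0, z] : Fin 4 → K) ≠ 0 := fun h => hxz ⟨congrFun h 0, congrFun h 3⟩
  have hon : E.OnCurve K ![x, u, 0, z] := (onCurve_iff ..).2
    ⟨by simpa using hu.symm, by simpa [p₂] using hp⟩
  have h0 : flip₂ O = 0 := by
    have := h (E.mkPt K _ hw hon)
    change flip₂ _ = _ + flip₂ O at this
    rw [flip₂_eq_self rfl] at this
    exact left_eq_add.1 this
  obtain ⟨x, z, hp⟩ := exists_quadratic_ne_zero hE.discr₂_ne_zero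
  obtain ⟨u, hu⟩ := exists_sq_eq (E.p₁ K x z)
  obtain ⟨v, hv⟩ := exists_sq_eq (E.p₂ K x z)
  have hv0 : v ≠ 0 := by
    rintro rfl
    exact hp (hv.symm.trans (by simp))
  have hw : (![x, u, v, z] : Fin 4 → K) ≠ 0 := fun h => hv0 (congrFun h 2)
  have hon : E.OnCurve K ![x, u, v, z] := (onCurve_iff ..).2
    ⟨by simpa using hu.symm, by simpa using hv.symm⟩
  have := h (E.mkPt K _ hw hon)
  change flip₂ _ = _ + flip₂ O at this
  rw [h0, add_zero, flip₂_mkPt] at this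
  obtain ⟨a, ha⟩ := mkPt_eq_mkPt_iff.1 this
  have h1 : a * v = -v := by simpa [flip_apply] using congrFun ha 2
  have h2 : a * x = x := by simpa [flip_apply] using congrFun ha 0
  have h3 : a * z = z := by simpa [flip_apply] using congrFun ha 3
  have ha1 : a = -1 := mul_right_cancel₀ hv0 (by rw [h1]; ring)
  subst ha1
  have hx : x = 0 := by linear_combination -h2 / 2
  have hz : z = 0 := by linear_combination -h3 / 2
  simp [hx, hz] at hp

end Flip

end DoubleEquation

namespace DoubleEquation

variable {k : Type*} [Field k]

/-! ### Lines of the pencil attached to a point -/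

section Secant

variable (E : DoubleEquation k) (K : Type*) [Field K] [Algebra k K]

/-- The quadratic form `p₂(x, z) - v²`. -/
noncomputable def quad₂ (w : Fin 4 → K) : K := E.p₂ K (w 0) (w 3) - w 2 ^ 2

/-- The polar form of `quad₂`. -/
noncomputable def polar₂ (w d : Fin 4 → K) : K :=
  2 * algebraMap k K E.a₂ * w 0 * d 0 + algebraMap k K E.b₂ * (w 0 * d 3 + w 3 * d 0) +
    2 * algebraMap k K E.c₂ * w 3 * d 3 - 2 * w 2 * d 2

/-- For a zero `w` of `quad₂`, the second zero on the line through `w` and `d`. -/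
noncomputable def secant (w d : Fin 4 → K) : Fin 4 → K := E.quad₂ K d • w - E.polar₂ K w d • d

variable {E K}

theorem quad₂_add (w d : Fin 4 → K) (α β : K) : E.quad₂ K (α • w + β • d) =
    α ^ 2 * E.quad₂ K w + α * β * E.polar₂ K w d + β ^ 2 * E.quad₂ K d := by
  simp only [quad₂, polar₂, p₂, Pi.add_apply, Pi.smul_apply, smul_eq_mul]
  ring

theorem quad₂_secant {w : Fin 4 → K} (hw : E.quad₂ K w = 0) (d : Fin 4 → K) :
    E.quad₂ K (E.secant K w d) = 0 := by
  have := quad₂_add (E := E) w d (E.quad₂ K d) (-E.polar₂ K w d)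
  rw [hw] at this
  rw [secant, sub_eq_add_neg, ← neg_smul, this]
  ring

/-- The second zero does not depend on the vector chosen on the line. -/
theorem secant_add {w : Fin 4 → K} (hw : E.quad₂ K w = 0) (d : Fin 4 → K) (α β : K) :
    E.secant K w (α • w + β • d) = β ^ 2 • E.secant K w d := by
  have h1 : E.polar₂ K w (α • w + β • d) = β * E.polar₂ K w d := by
    have : E.polar₂ K w (α • w + β • d) = 2 * α * E.quad₂ K w + β * E.polar₂ K w d := by
      simp only [quad₂, polar₂, p₂, Pi.add_apply, Pi.smul_apply, smul_eq_mul]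
      ring
    rw [this, hw]
    ring
  rw [secant, h1, quad₂_add, hw, secant]
  ext j
  simp only [Pi.add_apply, Pi.sub_apply, Pi.smul_apply, smul_eq_mul]
  ring

theorem isForm_secant {d : (Fin 4 → K) → Fin 4 → K} {n : ℕ}
    (hd : ∀ j, IsForm n (fun w => d w j)) (j : Fin 4) :
    IsForm (n + n + 1) (fun w => E.secant K w (d w) j) := by
  have hw := fun i : Fin 4 => IsForm.coord (K := K) (m := 4) i
  have h1 : IsForm (n + n) (fun w => E.quad₂ K (d w)) := by
    have := (((((hd 0).mul (hd 0)).const_mul (algebraMap k K E.a₂)).add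
      (((hd 0).mul (hd 3)).const_mul (algebraMap k K E.b₂))).add
      (((hd 3).mul (hd 3)).const_mul (algebraMap k K E.c₂))).sub ((hd 2).mul (hd 2))
    refine cast (congrArg (IsForm _) (funext fun w => ?_)) this
    simp only [quad₂, p₂]
    ring
  have h2 : IsForm (1 + n) (fun w => E.polar₂ K w (d w)) := by
    have := ((((((hw 0).mul (hd 0)).const_mul (2 * algebraMap k K E.a₂)).add
      ((((hw 0).mul (hd 3)).add ((hw 3).mul (hd 0))).const_mul (algebraMap k K E.b₂))).add
      (((hw 3).mul (hd 3)).const_mul (2 * algebraMap k K E.c₂))).sub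
      (((hw 2).mul (hd 2)).const_mul 2))
    refine cast (congrArg (IsForm _) (funext fun w => ?_)) this
    simp only [polar₂]
    ring
  have h3 := h2.mul (hd j)
  rw [show 1 + n + n = n + n + 1 by ring] at h3
  exact (h1.mul (hw j)).sub h3

end Secant

section Pencil

variable (E : DoubleEquation k) (K : Type*) [Field K] [Algebra k K]

/-- A point of the curve with `u v ≠ 0`, given by coordinates, and the linear form `h` attached to
it; the lines `s (v₀ u + u₀ v) = t h`, `t (v₀ u - u₀ v) = s (z₀ x - x₀ z)` form one ruling of the
quadric `(v₀ u + u₀ v) (v₀ u - u₀ v) = (z₀ x - x₀ z) h`. -/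
structure Pencil where
  /-- coordinates `(x₀, u₀, v₀, z₀)` of the point -/
  w₀ : Fin 4 → K
  /-- coefficient of `x` in `h` -/
  h₀ : K
  /-- coefficient of `z` in `h` -/
  h₁ : K
  onCurve : E.OnCurve K w₀
  isCofactor : E.IsCofactor K w₀ h₀ h₁
  hu : w₀ 1 ≠ 0
  hv : w₀ 2 ≠ 0

namespace Pencil

variable {E K} (L : E.Pencil K)

/-- `v₀ u + u₀ v` -/
def A (w : Fin 4 → K) : K := L.w₀ 2 * w 1 + L.w₀ 1 * w 2

/-- `v₀ u - u₀ v` -/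
def B (w : Fin 4 → K) : K := L.w₀ 2 * w 1 - L.w₀ 1 * w 2

/-- `z₀ x - x₀ z` -/
def C (x z : K) : K := L.w₀ 3 * x - L.w₀ 0 * z

/-- `h(x, z)` -/
def D (x z : K) : K := L.h₀ * x + L.h₁ * z

/-- The vector `w` lies on the line with parameter `t / s`. -/
def OnLine (s t : K) (w : Fin 4 → K) : Prop := OnPencilLine L.w₀ L.h₀ L.h₁ s t w

theorem onLine_iff {s t : K} {w : Fin 4 → K} : L.OnLine s t w ↔
    s * L.A w = t * L.D (w 0) (w 3) ∧ t * L.B w = s * L.C (w 0) (w 3) := Iff.rfl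

theorem onLine_smul {s t a : K} {w : Fin 4 → K} (h : L.OnLine s t w) : L.OnLine s t (a • w) := by
  rw [onLine_iff] at h ⊢
  simp only [A, B, C, D, Pi.smul_apply, smul_eq_mul] at h ⊢
  exact ⟨by linear_combination a * h.1, by linear_combination a * h.2⟩

theorem onLine_smul_iff {s t a : K} (ha : a ≠ 0) {w : Fin 4 → K} :
    L.OnLine s t (a • w) ↔ L.OnLine s t w :=
  ⟨fun h => by simpa [ha] using L.onLine_smul (a := a⁻¹) h, L.onLine_smul⟩

theorem onLine_add {s t : K} {w w' : Fin 4 → K} (h : L.OnLine s t w) (h' : L.OnLine s t w') :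
    L.OnLine s t (w + w') := by
  rw [onLine_iff] at h h' ⊢
  simp only [A, B, C, D, Pi.add_apply] at h h' ⊢
  exact ⟨by linear_combination h.1 + h'.1, by linear_combination h.2 + h'.2⟩

theorem onLine_secant {s t : K} {w d : Fin 4 → K} (h : L.OnLine s t w) (h' : L.OnLine s t d) :
    L.OnLine s t (E.secant K w d) := by
  rw [secant, sub_eq_add_neg, ← neg_smul]
  exact L.onLine_add (L.onLine_smul h) (L.onLine_smul h')

theorem quadric (x z : K) :
    L.w₀ 2 ^ 2 * E.p₁ K x z - L.w₀ 1 ^ 2 * E.p₂ K x z = L.C x z * L.D x z := by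
  obtain ⟨h1, h2, h3⟩ := L.isCofactor
  simp only [p₁, p₂, C, D]
  linear_combination x ^ 2 * h1 + x * z * h2 + z ^ 2 * h3

theorem A_mul_B {w : Fin 4 → K} (h : E.OnCurve K w) :
    L.A w * L.B w = L.C (w 0) (w 3) * L.D (w 0) (w 3) := by
  obtain ⟨h1, h2⟩ := (onCurve_iff ..).1 h
  rw [← quadric, h1, h2, A, B]
  ring

/-- On a line of the pencil one of the two equations of the curve suffices. -/
theorem onCurve_iff_quad₂ {s t : K} (hst : s ≠ 0 ∨ t ≠ 0) {w : Fin 4 → K} (h : L.OnLine s t w) :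
    E.OnCurve K w ↔ E.quad₂ K w = 0 := by
  have hq : L.A w * L.B w = L.C (w 0) (w 3) * L.D (w 0) (w 3) := by
    obtain ⟨h1, h2⟩ := L.onLine_iff.1 h
    rcases hst with hs | ht
    · refine mul_left_cancel₀ hs ?_
      linear_combination L.B w * h1 + L.D (w 0) (w 3) * h2
    · refine mul_left_cancel₀ ht ?_
      linear_combination L.A w * h2 + L.C (w 0) (w 3) * h1
  rw [onCurve_iff, quad₂, sub_eq_zero]
  refine ⟨fun h => h.2, fun h2 => ⟨?_, h2⟩⟩
  refine mul_left_cancel₀ (pow_ne_zero 2 L.hv) ?_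
  rw [← quadric, A, B] at hq
  linear_combination L.w₀ 1 ^ 2 * h2 - hq

theorem w₀_ne_zero : ¬(L.w₀ 3 = 0 ∧ L.w₀ 0 = 0) := by
  rintro ⟨h3, h0⟩
  have := ((onCurve_iff ..).1 L.onCurve).1
  rw [h3, h0] at this
  exact L.hu (by simpa [p₁] using this.symm)

theorem h_ne_zero [IsAlgClosed K] [CharZero K] (hE : E.IsSmooth K) :
    ¬(L.h₀ = 0 ∧ L.h₁ = 0) := by
  rintro ⟨h0, h1⟩
  -- otherwise `p₁` and `p₂` are proportional
  obtain ⟨x, z, hxz, hp⟩ := exists_quadratic_eq_zero (algebraMap k K E.a₁) (algebraMap k K E.b₁)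
    (algebraMap k K E.c₁)
  have hp : E.p₁ K x z = 0 := hp
  have := L.quadric x z
  rw [hp, D, h0, h1] at this
  refine hxz (hE.eq_zero_of_p hp ?_)
  refine (mul_eq_zero.1 ?_).resolve_left (pow_ne_zero 2 L.hu)
  linear_combination -this

/-- A vector on the line with parameter `t / s`, with `x : z = ξ : ζ` when `s t ≠ 0`. -/
def dir (ξ ζ s t : K) : Fin 4 → K :=
  ![2 * L.w₀ 1 * L.w₀ 2 * (s * t) * ξ, L.w₀ 1 * (t ^ 2 * L.D ξ ζ + s ^ 2 * L.C ξ ζ),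
    L.w₀ 2 * (t ^ 2 * L.D ξ ζ - s ^ 2 * L.C ξ ζ), 2 * L.w₀ 1 * L.w₀ 2 * (s * t) * ζ]

theorem onLine_dir (ξ ζ s t : K) : L.OnLine s t (L.dir ξ ζ s t) := by
  rw [onLine_iff]
  simp only [A, B, C, D, dir, Matrix.cons_val]
  exact ⟨by ring, by ring⟩

end Pencil

theorem eq_zero_of_onCurve {E : DoubleEquation k} {K : Type*} [Field K] [Algebra k K]
    {w : Fin 4 → K} (h : E.OnCurve K w) (hx : w 0 = 0) (hz : w 3 = 0) : w = 0 := by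
  obtain ⟨h1, h2⟩ := (onCurve_iff ..).1 h
  rw [hx, hz] at h1 h2
  have hu : w 1 = 0 := by simpa [p₁] using h1.symm
  have hv : w 2 = 0 := by simpa [p₂] using h2.symm
  ext j
  fin_cases j <;> simp [hx, hz, hu, hv]

/-- Solutions of a nontrivial linear equation in two unknowns are proportional. -/
theorem exists_eq_mul_of_linear {K : Type*} [Field K] {a b x z x' z' : K} (hab : ¬(a = 0 ∧ b = 0))
    (hxz : ¬(x = 0 ∧ z = 0)) (h : a * x = b * z) (h' : a * x' = b * z') :
    ∃ α : K, x' = α * x ∧ z' = α * z := by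
  have hdet : x * z' = x' * z := by
    rcases not_and_or.1 hab with h0 | h0
    · refine mul_left_cancel₀ h0 ?_
      linear_combination z' * h - z * h'
    · refine mul_left_cancel₀ h0 ?_
      linear_combination x' * h - x * h'
  rcases not_and_or.1 hxz with h0 | h0
  · exact ⟨x' / x, (div_mul_cancel₀ _ h0).symm, by field_simp; linear_combination hdet⟩
  · exact ⟨z' / z, by field_simp; linear_combination -hdet, (div_mul_cancel₀ _ h0).symm⟩

namespace Pencil

variable {E : DoubleEquation k} {K : Type*} [Field K] [Algebra k K] (L : E.Pencil K)

/-- When `s t ≠ 0` a vector on the line is determined by its coordinates `x` and `z`. -/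
theorem ext_of_onLine [CharZero K] {s t : K} (hs : s ≠ 0) (ht : t ≠ 0) {w w' : Fin 4 → K}
    (h : L.OnLine s t w) (h' : L.OnLine s t w') (h0 : w 0 = w' 0) (h3 : w 3 = w' 3) : w = w' := by
  obtain ⟨h1, h2⟩ := L.onLine_iff.1 h
  obtain ⟨h1', h2'⟩ := L.onLine_iff.1 h'
  rw [h0, h3] at h1 h2
  have hA : L.A w = L.A w' := mul_left_cancel₀ hs (h1.trans h1'.symm)
  have hB : L.B w = L.B w' := mul_left_cancel₀ ht (h2.trans h2'.symm)
  rw [A, A] at hA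
  rw [B, B] at hB
  have hu : w 1 = w' 1 := mul_left_cancel₀ L.hv (by linear_combination hA / 2 + hB / 2)
  have hv : w 2 = w' 2 := mul_left_cancel₀ L.hu (by linear_combination hA / 2 - hB / 2)
  ext j
  fin_cases j <;> assumption

variable [IsAlgClosed K] [CharZero K]

/-- No line of the pencil lies on the curve: on such a line `p₁` would be the square of a linear
form. -/
theorem exists_quad₂_ne_zero (hE : E.IsSmooth K) {s t : K} (hs : s ≠ 0) (ht : t ≠ 0) :
    ∃ w, L.OnLine s t w ∧ E.quad₂ K w ≠ 0 := by
  by_contra! hall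
  have hon := fun w hw => ((onCurve_iff ..).1
    ((L.onCurve_iff_quad₂ (Or.inl hs) hw).2 (hall w hw))).1
  have h1 := hon _ (L.onLine_dir 1 0 s t)
  have h2 := hon _ (L.onLine_dir 0 1 s t)
  have h3 := hon _ (L.onLine_add (L.onLine_dir 1 0 s t) (L.onLine_dir 0 1 s t))
  obtain ⟨κ, hκ⟩ : ∃ κ, κ = 2 * L.w₀ 1 * L.w₀ 2 * (s * t) := ⟨_, rfl⟩
  have hκ0 : κ ≠ 0 := by
    rw [hκ]
    exact mul_ne_zero (mul_ne_zero (mul_ne_zero two_ne_zero L.hu) L.hv) (mul_ne_zero hs ht)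
  generalize hm : L.dir 1 0 s t 1 = m at h1 h3
  generalize hn : L.dir 0 1 s t 1 = n at h2 h3
  simp only [p₁, Pi.add_apply, hm, hn] at h1 h2 h3
  simp only [dir, Matrix.cons_val, ← hκ, mul_one, mul_zero, add_zero, zero_add] at h1 h2 h3
  refine hE.discr₁_ne_zero (mul_left_cancel₀ (pow_ne_zero 4 hκ0) ?_)
  have h4 : algebraMap k K E.b₁ * κ ^ 2 = 2 * m * n := by linear_combination h3 - h1 - h2
  have h1' : algebraMap k K E.a₁ * κ ^ 2 = m ^ 2 := by linear_combination h1
  have h2' : algebraMap k K E.c₁ * κ ^ 2 = n ^ 2 := by linear_combination h2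
  linear_combination (algebraMap k K E.b₁ * κ ^ 2 + 2 * m * n) * h4 -
    4 * (algebraMap k K E.c₁ * κ ^ 2) * h1' - 4 * m ^ 2 * h2'

/-- One of two standard vectors completes a point of the curve to a basis of its line. -/
theorem exists_dir (hE : E.IsSmooth K) {s t : K} (hst : s ≠ 0 ∨ t ≠ 0) {w : Fin 4 → K}
    (hw : w ≠ 0) (hon : E.OnCurve K w) (hl : L.OnLine s t w) :
    ∃ ξ ζ : K, (ξ = 1 ∧ ζ = 0 ∨ ξ = 0 ∧ ζ = 1) ∧ E.secant K w (L.dir ξ ζ s t) ≠ 0 ∧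
      ∀ w', L.OnLine s t w' → ∃ α β : K, w' = α • w + β • L.dir ξ ζ s t := by
  have hxz : ¬(w 0 = 0 ∧ w 3 = 0) := fun h => hw (eq_zero_of_onCurve hon h.1 h.2)
  by_cases hs : s = 0
  · -- the line `h = 0`, `v₀ u = u₀ v`
    subst hs
    have ht : t ≠ 0 := by simpa using hst
    obtain ⟨ξ, ζ, hξ, hD⟩ : ∃ ξ ζ : K, (ξ = 1 ∧ ζ = 0 ∨ ξ = 0 ∧ ζ = 1) ∧ L.D ξ ζ ≠ 0 := by
      rcases not_and_or.1 (L.h_ne_zero hE) with h | h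
      · exact ⟨1, 0, by simp, by simpa [D] using h⟩
      · exact ⟨0, 1, by simp, by simpa [D] using h⟩
    have hd0 : L.dir ξ ζ 0 t 0 = 0 := by simp [dir]
    have hd3 : L.dir ξ ζ 0 t 3 = 0 := by simp [dir]
    have hd1 : L.dir ξ ζ 0 t 1 = L.w₀ 1 * (t ^ 2 * L.D ξ ζ) := by simp [dir]
    have hd2 : L.dir ξ ζ 0 t 2 = L.w₀ 2 * (t ^ 2 * L.D ξ ζ) := by simp [dir]
    have htD : t ^ 2 * L.D ξ ζ ≠ 0 := mul_ne_zero (pow_ne_zero 2 ht) hD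
    refine ⟨ξ, ζ, hξ, fun h0 => ?_, fun w' hl' => ?_⟩
    · have hq : E.quad₂ K (L.dir ξ ζ 0 t) ≠ 0 := by
        rw [quad₂, hd0, hd3, hd2]
        simpa [p₂] using ⟨L.hv, ht, hD⟩
      have h3 := congrFun h0 0
      have h4 := congrFun h0 3
      simp only [secant, Pi.sub_apply, Pi.smul_apply, hd0, hd3, smul_eq_mul, mul_zero, sub_zero,
        Pi.zero_apply, mul_eq_zero, hq, false_or] at h3 h4
      exact hxz ⟨h3, h4⟩
    · obtain ⟨h1, h2⟩ := L.onLine_iff.1 hl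
      obtain ⟨h1', h2'⟩ := L.onLine_iff.1 hl'
      rw [zero_mul, eq_comm, mul_eq_zero, or_iff_right ht, D] at h1 h1'
      rw [zero_mul, mul_eq_zero, or_iff_right ht, B] at h2 h2'
      obtain ⟨α, h3, h4⟩ := exists_eq_mul_of_linear (a := L.h₀) (b := -L.h₁)
        (x' := w' 0) (z' := w' 3) (by simpa using L.h_ne_zero hE) hxz
        (by linear_combination h1) (by linear_combination h1')
      refine ⟨α, (w' 1 - α * w 1) / (L.w₀ 1 * (t ^ 2 * L.D ξ ζ)), ?_⟩
      have hβ := div_mul_cancel₀ (w' 1 - α * w 1) (mul_ne_zero L.hu htD)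
      generalize (w' 1 - α * w 1) / (L.w₀ 1 * (t ^ 2 * L.D ξ ζ)) = β at hβ
      ext j
      simp only [Pi.add_apply, Pi.smul_apply, smul_eq_mul]
      fin_cases j
      · simp [hd0, h3]
      · simp only [Fin.mk_one, hd1]
        linear_combination -hβ
      · simp only [Fin.reduceFinMk, hd2]
        refine mul_left_cancel₀ L.hu ?_
        linear_combination -L.w₀ 2 * hβ - h2' + α * h2
      · simp [hd3, h4]
  by_cases ht : t = 0
  · -- the line `z₀ x = x₀ z`, `v₀ u = -u₀ v`
    subst ht
    obtain ⟨ξ, ζ, hξ, hC⟩ : ∃ ξ ζ : K, (ξ = 1 ∧ ζ = 0 ∨ ξ = 0 ∧ ζ = 1) ∧ L.C ξ ζ ≠ 0 := by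
      rcases not_and_or.1 L.w₀_ne_zero with h | h
      · exact ⟨1, 0, by simp, by simpa [C] using h⟩
      · exact ⟨0, 1, by simp, by simpa [C] using h⟩
    have hd0 : L.dir ξ ζ s 0 0 = 0 := by simp [dir]
    have hd3 : L.dir ξ ζ s 0 3 = 0 := by simp [dir]
    have hd1 : L.dir ξ ζ s 0 1 = L.w₀ 1 * (s ^ 2 * L.C ξ ζ) := by simp [dir]
    have hd2 : L.dir ξ ζ s 0 2 = -(L.w₀ 2 * (s ^ 2 * L.C ξ ζ)) := by simp [dir]
    have hsC : s ^ 2 * L.C ξ ζ ≠ 0 := mul_ne_zero (pow_ne_zero 2 hs) hC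
    refine ⟨ξ, ζ, hξ, fun h0 => ?_, fun w' hl' => ?_⟩
    · have hq : E.quad₂ K (L.dir ξ ζ s 0) ≠ 0 := by
        rw [quad₂, hd0, hd3, hd2]
        simpa [p₂] using ⟨L.hv, hs, hC⟩
      have h3 := congrFun h0 0
      have h4 := congrFun h0 3
      simp only [secant, Pi.sub_apply, Pi.smul_apply, hd0, hd3, smul_eq_mul, mul_zero, sub_zero,
        Pi.zero_apply, mul_eq_zero, hq, false_or] at h3 h4
      exact hxz ⟨h3, h4⟩
    · obtain ⟨h1, h2⟩ := L.onLine_iff.1 hl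
      obtain ⟨h1', h2'⟩ := L.onLine_iff.1 hl'
      rw [zero_mul, mul_eq_zero, or_iff_right hs, A] at h1 h1'
      rw [zero_mul, eq_comm, mul_eq_zero, or_iff_right hs, C] at h2 h2'
      obtain ⟨α, h3, h4⟩ := exists_eq_mul_of_linear (x' := w' 0) (z' := w' 3) L.w₀_ne_zero hxz
        (by linear_combination h2) (by linear_combination h2')
      refine ⟨α, (w' 1 - α * w 1) / (L.w₀ 1 * (s ^ 2 * L.C ξ ζ)), ?_⟩
      have hβ := div_mul_cancel₀ (w' 1 - α * w 1) (mul_ne_zero L.hu hsC)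
      generalize (w' 1 - α * w 1) / (L.w₀ 1 * (s ^ 2 * L.C ξ ζ)) = β at hβ
      ext j
      simp only [Pi.add_apply, Pi.smul_apply, smul_eq_mul]
      fin_cases j
      · simp [hd0, h3]
      · simp only [Fin.mk_one, hd1]
        linear_combination -hβ
      · simp only [Fin.reduceFinMk, hd2]
        refine mul_left_cancel₀ L.hu ?_
        linear_combination L.w₀ 2 * hβ + h1' - α * h1
      · simp [hd3, h4]
  · -- the general line, where `x` and `z` are coordinates
    have hκ : 2 * L.w₀ 1 * L.w₀ 2 * (s * t) ≠ 0 :=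
      mul_ne_zero (mul_ne_zero (mul_ne_zero two_ne_zero L.hu) L.hv) (mul_ne_zero hs ht)
    have hd0 : ∀ ξ ζ, L.dir ξ ζ s t 0 = 2 * L.w₀ 1 * L.w₀ 2 * (s * t) * ξ := fun _ _ => rfl
    have hd3 : ∀ ξ ζ, L.dir ξ ζ s t 3 = 2 * L.w₀ 1 * L.w₀ 2 * (s * t) * ζ := fun _ _ => rfl
    generalize 2 * L.w₀ 1 * L.w₀ 2 * (s * t) = κ at hκ hd0 hd3
    have hq : E.quad₂ K w = 0 := (L.onCurve_iff_quad₂ hst hl).1 hon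
    -- the secant vector vanishes only if the whole line lies on the curve
    have key : ∀ ξ ζ, (∀ w', L.OnLine s t w' → ∃ α β : K, w' = α • w + β • L.dir ξ ζ s t) →
        ¬(E.quad₂ K (L.dir ξ ζ s t) = 0 ∧ E.polar₂ K w (L.dir ξ ζ s t) = 0) := by
      rintro ξ ζ hspan ⟨h1, h2⟩
      obtain ⟨w', hw', hne⟩ := L.exists_quad₂_ne_zero hE hs ht
      obtain ⟨α, β, rfl⟩ := hspan w' hw'
      rw [quad₂_add, hq, h1, h2] at hne
      exact hne (by ring)
    by_cases hz : w 3 = 0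
    · have hx : w 0 ≠ 0 := fun h => hxz ⟨h, hz⟩
      have hspan : ∀ w', L.OnLine s t w' → ∃ α β : K, w' = α • w + β • L.dir 0 1 s t := by
        intro w' hl'
        refine ⟨w' 0 / w 0, w' 3 / κ, L.ext_of_onLine hs ht hl' (L.onLine_add (L.onLine_smul hl)
          (L.onLine_smul (L.onLine_dir ..))) ?_ ?_⟩
        · simp [hd0, hx]
        · simp [hd3, hz, hκ]
      refine ⟨0, 1, by simp, fun h0 => key 0 1 hspan ?_, hspan⟩
      have h3 := congrFun h0 0
      have h4 := congrFun h0 3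
      simp only [secant, Pi.sub_apply, Pi.smul_apply, hd0, hd3, smul_eq_mul, mul_zero, sub_zero,
        Pi.zero_apply, mul_eq_zero, hx, or_false, hz, zero_sub, neg_eq_zero, hκ, mul_one] at h3 h4
      exact ⟨h3, h4⟩
    · have hspan : ∀ w', L.OnLine s t w' → ∃ α β : K, w' = α • w + β • L.dir 1 0 s t := by
        intro w' hl'
        refine ⟨w' 3 / w 3, (w' 0 - w' 3 / w 3 * w 0) / κ, L.ext_of_onLine hs ht hl'
          (L.onLine_add (L.onLine_smul hl) (L.onLine_smul (L.onLine_dir ..))) ?_ ?_⟩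
        · simp [hd0, hκ]
        · simp [hd3, hz]
      refine ⟨1, 0, by simp, fun h0 => key 1 0 hspan ?_, hspan⟩
      have h3 := congrFun h0 3
      simp only [secant, Pi.sub_apply, Pi.smul_apply, hd3, smul_eq_mul, mul_zero, sub_zero,
        Pi.zero_apply, mul_eq_zero, hz, or_false] at h3
      have h4 := congrFun h0 0
      simp only [secant, h3, Pi.sub_apply, Pi.smul_apply, hd0, smul_eq_mul, zero_mul, zero_sub,
        Pi.zero_apply, neg_eq_zero, mul_eq_zero, hκ, mul_one, or_false] at h4
      exact ⟨h3, h4⟩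

end Pencil

end Pencil

end DoubleEquation

namespace DoubleEquation

/-! ### The involution of the curve defined by a pencil -/

namespace Pencil

variable {k : Type*} [Field k] {E : DoubleEquation k} {K : Type*} [Field K] [Algebra k K]
  (L : E.Pencil K)

theorem onLine_congr {s t s' t' : K} (hst : s ≠ 0 ∨ t ≠ 0) (h : s * t' = s' * t) {w : Fin 4 → K}
    (hw : L.OnLine s t w) : L.OnLine s' t' w := by
  rw [onLine_iff] at hw ⊢
  obtain ⟨h1, h2⟩ := hw
  rcases hst with hs | ht
  · constructor
    · refine mul_left_cancel₀ hs ?_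
      linear_combination s' * h1 - L.D (w 0) (w 3) * h
    · refine mul_left_cancel₀ hs ?_
      linear_combination s' * h2 + L.B w * h
  · constructor
    · refine mul_left_cancel₀ ht ?_
      linear_combination t' * h1 - L.A w * h
    · refine mul_left_cancel₀ ht ?_
      linear_combination t' * h2 + L.C (w 0) (w 3) * h

theorem onLine_rep_mkPt {s t : K} {w : Fin 4 → K} {hw h} :
    L.OnLine s t (E.toSpace K (E.mkPt K w hw h)).rep ↔ L.OnLine s t w := by
  obtain ⟨a, ha0, ha⟩ := rep_mkPt w hw h
  rw [ha, L.onLine_smul_iff ha0]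

/-- `Q` and `R` are the two points of the curve on some line of the pencil. -/
def Joined (Q R : E.Pt K) : Prop :=
  ∃ s t : K, (s ≠ 0 ∨ t ≠ 0) ∧ ∀ X : E.Pt K, L.OnLine s t (E.toSpace K X).rep ↔ X = Q ∨ X = R

theorem Joined.symm {L : E.Pencil K} {Q R : E.Pt K} (h : L.Joined Q R) : L.Joined R Q := by
  obtain ⟨s, t, hst, h⟩ := h
  exact ⟨s, t, hst, fun X => (h X).trans or_comm⟩

/-- A second element of an unordered pair is determined by the pair and the first element. -/
theorem _root_.eq_of_pair {α : Type*} {a b c : α} (h : ∀ x, x = a ∨ x = b ↔ x = a ∨ x = c) :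
    b = c := by
  rcases (h b).1 (Or.inr rfl) with h1 | h1
  · rcases (h c).2 (Or.inr rfl) with h2 | h2
    · rw [h1, h2]
    · exact h2.symm
  · exact h1

/-- The parameter of the line through a point of the curve is `A / D`, and also `C / B`. -/
theorem onLine_D_A {w : Fin 4 → K} (hon : E.OnCurve K w) :
    L.OnLine (L.D (w 0) (w 3)) (L.A w) w :=
  L.onLine_iff.2 ⟨mul_comm _ _, by rw [L.A_mul_B hon, mul_comm]⟩

theorem onLine_B_C {w : Fin 4 → K} (hon : E.OnCurve K w) :
    L.OnLine (L.B w) (L.C (w 0) (w 3)) w :=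
  L.onLine_iff.2 ⟨by rw [← L.A_mul_B hon, mul_comm], mul_comm _ _⟩

theorem w₀_ne_zero' : L.w₀ ≠ 0 := fun h => L.hu (by rw [h]; rfl)

/-- The point to which the pencil is attached. -/
noncomputable def base : E.Pt K := E.mkPt K L.w₀ L.w₀_ne_zero' L.onCurve

variable [CharZero K]

theorem A_ne_zero_or_B_ne_zero (hE : E.IsSmooth K) {w : Fin 4 → K} (hw : w ≠ 0)
    (hon : E.OnCurve K w) : L.A w ≠ 0 ∨ L.B w ≠ 0 := by
  by_contra! h
  obtain ⟨hA, hB⟩ := h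
  rw [A] at hA
  rw [B] at hB
  have hu : w 1 = 0 := (mul_eq_zero.1 (show L.w₀ 2 * w 1 = 0 by
    linear_combination hA / 2 + hB / 2)).resolve_left L.hv
  have hv : w 2 = 0 := (mul_eq_zero.1 (show L.w₀ 1 * w 2 = 0 by
    linear_combination hA / 2 - hB / 2)).resolve_left L.hu
  obtain ⟨h1, h2⟩ := (onCurve_iff ..).1 hon
  rw [hu] at h1
  rw [hv] at h2
  obtain ⟨hx, hz⟩ := hE.eq_zero_of_p (h1.trans (zero_pow two_ne_zero))
    (h2.trans (zero_pow two_ne_zero))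
  exact hw (eq_zero_of_onCurve hon hx hz)

/-- Different lines of the pencil do not meet on the curve. -/
theorem param_unique (hE : E.IsSmooth K) {s t s' t' : K} {w : Fin 4 → K} (hw : w ≠ 0)
    (hon : E.OnCurve K w) (h : L.OnLine s t w) (h' : L.OnLine s' t' w) : s * t' = s' * t := by
  obtain ⟨h1, h2⟩ := L.onLine_iff.1 h
  obtain ⟨h1', h2'⟩ := L.onLine_iff.1 h'
  rcases L.A_ne_zero_or_B_ne_zero hE hw hon with h0 | h0
  · refine mul_left_cancel₀ h0 ?_
    linear_combination t' * h1 - t * h1'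
  · refine mul_left_cancel₀ h0 ?_
    linear_combination s * h2' - s' * h2

theorem onLine_iff_of_onLine (hE : E.IsSmooth K) {s t s' t' : K} (hst : s ≠ 0 ∨ t ≠ 0)
    (hst' : s' ≠ 0 ∨ t' ≠ 0) {w : Fin 4 → K} (hw : w ≠ 0)
    (hon : E.OnCurve K w) (h : L.OnLine s t w) (h' : L.OnLine s' t' w) (w' : Fin 4 → K) :
    L.OnLine s t w' ↔ L.OnLine s' t' w' :=
  ⟨L.onLine_congr hst (L.param_unique hE hw hon h h'),
    L.onLine_congr hst' (L.param_unique hE hw hon h' h)⟩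

variable {L} in
theorem Joined.unique (hE : E.IsSmooth K) {Q R R' : E.Pt K} (h : L.Joined Q R)
    (h' : L.Joined Q R') : R = R' := by
  obtain ⟨s, t, hst, h⟩ := h
  obtain ⟨s', t', hst', h'⟩ := h'
  refine eq_of_pair (a := Q) fun X => ?_
  rw [← h X, ← h' X]
  exact L.onLine_iff_of_onLine hE hst hst' (E.toSpace K Q).rep_nonzero (onCurve_rep Q)
    ((h Q).2 (Or.inl rfl)) ((h' Q).2 (Or.inl rfl)) _

variable [IsAlgClosed K]

/-- A line of the pencil through a point of the curve has exactly one further point on the curve,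
which may coincide with the given one. -/
theorem exists_secant (hE : E.IsSmooth K) {s t : K} (hst : s ≠ 0 ∨ t ≠ 0) {w : Fin 4 → K}
    (hw : w ≠ 0) (hon : E.OnCurve K w) (hl : L.OnLine s t w) :
    ∃ ξ ζ : K, (ξ = 1 ∧ ζ = 0 ∨ ξ = 0 ∧ ζ = 1) ∧ ∃ hr hc,
      (∀ X : E.Pt K, L.OnLine s t (E.toSpace K X).rep ↔
        X = E.mkPt K w hw hon ∨ X = E.mkPt K (E.secant K w (L.dir ξ ζ s t)) hr hc) ∧
      ∀ d, L.OnLine s t d → ∃ c : K, E.secant K w d = c • E.secant K w (L.dir ξ ζ s t) := by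
  obtain ⟨ξ, ζ, hξ, hr, hspan⟩ := L.exists_dir hE hst hw hon hl
  have hq := (L.onCurve_iff_quad₂ hst hl).1 hon
  have hlr := L.onLine_secant hl (L.onLine_dir ξ ζ s t)
  have hc := (L.onCurve_iff_quad₂ hst hlr).2 (quad₂_secant hq _)
  refine ⟨ξ, ζ, hξ, hr, hc, fun X => ?_, fun d hd => ?_⟩
  · constructor
    · obtain ⟨w', hw', hon', rfl⟩ := exists_mkPt X
      rw [onLine_rep_mkPt]
      intro hl'
      have hq' := (L.onCurve_iff_quad₂ hst hl').1 hon'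
      obtain ⟨α, β, rfl⟩ := hspan w' hl'
      rw [quad₂_add, hq] at hq'
      by_cases hβ : β = 0
      · left
        exact mkPt_eq_mkPt_iff.2 ⟨α, by rw [hβ, zero_smul, add_zero]⟩
      · right
        have h1 : α * E.polar₂ K w (L.dir ξ ζ s t) = -(β * E.quad₂ K (L.dir ξ ζ s t)) :=
          mul_left_cancel₀ hβ (by linear_combination hq')
        by_cases hp : E.polar₂ K w (L.dir ξ ζ s t) = 0
        · rw [hp, mul_zero, zero_eq_neg, mul_eq_zero, or_iff_right hβ] at h1
          exact (hr (by rw [secant, h1, hp, zero_smul, zero_smul, sub_zero])).elim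
        · refine mkPt_eq_mkPt_iff.2 ⟨-(β / E.polar₂ K w (L.dir ξ ζ s t)), ?_⟩
          have h2 := div_mul_cancel₀ β hp
          generalize β / E.polar₂ K w (L.dir ξ ζ s t) = γ at h2
          have h3 : α = -(γ * E.quad₂ K (L.dir ξ ζ s t)) :=
            mul_right_cancel₀ hp (by linear_combination h1 + E.quad₂ K (L.dir ξ ζ s t) * h2)
          rw [h3, ← h2]
          ext j
          simp only [secant, Pi.add_apply, Pi.sub_apply, Pi.smul_apply, smul_eq_mul]
          ring
    · rintro (rfl | rfl)
      · rwa [onLine_rep_mkPt]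
      · rwa [onLine_rep_mkPt]
  · obtain ⟨α, β, rfl⟩ := hspan d hd
    exact ⟨β ^ 2, secant_add hq _ _ _⟩

theorem exists_joined (hE : E.IsSmooth K) {s t : K} (hst : s ≠ 0 ∨ t ≠ 0) {Q : E.Pt K}
    (hl : L.OnLine s t (E.toSpace K Q).rep) : ∃ R,
      ∀ X : E.Pt K, L.OnLine s t (E.toSpace K X).rep ↔ X = Q ∨ X = R := by
  obtain ⟨ξ, ζ, -, hr, hc, h, -⟩ := L.exists_secant hE hst (E.toSpace K Q).rep_nonzero
    (onCurve_rep Q) hl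
  rw [mkPt_rep] at h
  exact ⟨_, h⟩

theorem joined_of_onLine (hE : E.IsSmooth K) {s t : K} (hst : s ≠ 0 ∨ t ≠ 0) {Q R : E.Pt K}
    (hQ : L.OnLine s t (E.toSpace K Q).rep) (hR : L.OnLine s t (E.toSpace K R).rep) (hne : R ≠ Q) :
    L.Joined Q R := by
  obtain ⟨R', h⟩ := L.exists_joined hE hst hQ
  have : R = R' := ((h R).1 hR).resolve_left hne
  subst this
  exact ⟨s, t, hst, h⟩

theorem exists_joined_right (hE : E.IsSmooth K) (Q : E.Pt K) : ∃ R, L.Joined Q R := by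
  rcases L.A_ne_zero_or_B_ne_zero hE (E.toSpace K Q).rep_nonzero (onCurve_rep Q) with h | h
  · obtain ⟨R, hR⟩ := L.exists_joined hE (Or.inr h) (L.onLine_D_A (onCurve_rep Q))
    exact ⟨R, _, _, Or.inr h, hR⟩
  · obtain ⟨R, hR⟩ := L.exists_joined hE (Or.inl h) (L.onLine_B_C (onCurve_rep Q))
    exact ⟨R, _, _, Or.inl h, hR⟩

/-- Where the parameter of the line through a point is `T / S` for linear forms `S`, `T`, the second
point of the line is given by forms of degree `5`. -/
theorem isRegularAt_of_joined (hE : E.IsSmooth K) {ι : E.Pt K → E.Pt K}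
    (hι : ∀ Q, L.Joined Q (ι Q)) {S T : (Fin 4 → K) → K} (hS : IsForm 1 S) (hT : IsForm 1 T)
    (hST : ∀ w, E.OnCurve K w → L.OnLine (S w) (T w) w) {P : E.Pt K}
    (hP : S (E.toSpace K P).rep ≠ 0 ∨ T (E.toSpace K P).rep ≠ 0) :
    IsRegularAt (fun Q : E.Pt K => (E.toSpace K Q).rep) (fun Q : E.Pt K => (E.toSpace K Q).rep)
      ι P := by
  obtain ⟨ξ, ζ, -, hr, -⟩ := L.exists_secant hE hP (E.toSpace K P).rep_nonzero (onCurve_rep P)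
    (hST _ (onCurve_rep P))
  have hST2 := hS.mul hT
  have hD := (hT.mul hT).mul_const (L.D ξ ζ)
  have hC := (hS.mul hS).mul_const (L.C ξ ζ)
  have hdir : ∀ j, IsForm 2 (fun w => L.dir ξ ζ (S w) (T w) j) := by
    intro j
    fin_cases j
    · exact (hST2.const_mul (2 * L.w₀ 1 * L.w₀ 2)).mul_const ξ
    · simp only [dir, Fin.mk_one, Matrix.cons_val, sq]
      exact (hD.add hC).const_mul (L.w₀ 1)
    · simp only [dir, Fin.reduceFinMk, Matrix.cons_val, sq]
      exact (hD.sub hC).const_mul (L.w₀ 2)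
    · exact (hST2.const_mul (2 * L.w₀ 1 * L.w₀ 2)).mul_const ζ
  refine ⟨2 + 2 + 1, fun w => E.secant K w (L.dir ξ ζ (S w) (T w)), isForm_secant hdir, hr,
    fun Q => ?_⟩
  by_cases hQ : S (E.toSpace K Q).rep ≠ 0 ∨ T (E.toSpace K Q).rep ≠ 0
  · obtain ⟨ξ', ζ', -, hr', hc', hX, hd⟩ := L.exists_secant hE hQ (E.toSpace K Q).rep_nonzero
      (onCurve_rep Q) (hST _ (onCurve_rep Q))
    rw [mkPt_rep] at hX
    have hιQ : ι Q = _ := (hι Q).unique hE ⟨_, _, hQ, hX⟩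
    obtain ⟨c, hc⟩ := hd _ (L.onLine_dir ξ ζ _ _)
    obtain ⟨a, ha0, ha⟩ := rep_mkPt _ hr' hc'
    refine ⟨c * a⁻¹, ?_⟩
    beta_reduce
    rw [hc, hιQ, ha, smul_smul, inv_mul_cancel_right₀ ha0]
  · push Not at hQ
    refine ⟨0, ?_⟩
    have h0 : L.dir ξ ζ 0 0 = 0 := by
      ext j
      fin_cases j <;> simp [dir]
    beta_reduce
    rw [hQ.1, hQ.2, h0, zero_smul, secant]
    simp [quad₂, p₂]

theorem isRegularMap_of_joined (hE : E.IsSmooth K) {ι : E.Pt K → E.Pt K}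
    (hι : ∀ Q, L.Joined Q (ι Q)) : IsRegularMap (E.toSpace K) (E.toSpace K) ι := by
  refine (isRegularMap_iff (isLift_rep _) (isLift_rep _)).2 fun P => ?_
  have x := IsForm.coord (K := K) (m := 4) 0
  have u := IsForm.coord (K := K) (m := 4) 1
  have v := IsForm.coord (K := K) (m := 4) 2
  have z := IsForm.coord (K := K) (m := 4) 3
  rcases L.A_ne_zero_or_B_ne_zero hE (E.toSpace K P).rep_nonzero (onCurve_rep P) with h | h
  · exact L.isRegularAt_of_joined hE hι
      (S := fun w => L.D (w 0) (w 3)) (T := L.A) ((x.const_mul _).add (z.const_mul _))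
      ((u.const_mul _).add (v.const_mul _)) (fun w hw => L.onLine_D_A hw) (Or.inr h)
  · exact L.isRegularAt_of_joined hE hι
      (S := L.B) (T := fun w => L.C (w 0) (w 3)) ((u.const_mul _).sub (v.const_mul _))
      ((x.const_mul _).sub (z.const_mul _)) (fun w hw => L.onLine_B_C hw) (Or.inl h)

/-- The line `v₀ u + u₀ v = 0`, `z₀ x = x₀ z` joins `(x₀ : -u₀ : v₀ : z₀)` and
`(x₀ : u₀ : -v₀ : z₀)`. -/
theorem joined_flip (hE : E.IsSmooth K) : L.Joined (flip₁ L.base) (flip₂ L.base) := by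
  rw [base, flip₁_mkPt, flip₂_mkPt]
  refine L.joined_of_onLine hE (s := 1) (t := 0) (Or.inl one_ne_zero) ?_ ?_ ?_
  · rw [onLine_rep_mkPt, onLine_iff]
    simp [A, C, flip_apply]
    ring_nf
    simp
  · rw [onLine_rep_mkPt, onLine_iff]
    simp [A, C, flip_apply]
    ring_nf
    simp
  · intro h
    obtain ⟨a, ha⟩ := mkPt_eq_mkPt_iff.1 h
    have h0 : a * L.w₀ 0 = L.w₀ 0 := by simpa [flip_apply] using congrFun ha 0
    have h1 : -(a * L.w₀ 1) = L.w₀ 1 := by simpa [flip_apply] using congrFun ha 1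
    have h3 : a * L.w₀ 3 = L.w₀ 3 := by simpa [flip_apply] using congrFun ha 3
    have ha1 : a = -1 := mul_right_cancel₀ L.hu (by linear_combination -h1)
    subst ha1
    exact L.w₀_ne_zero ⟨by linear_combination -h3 / 2, by linear_combination -h0 / 2⟩

/-- For a general point `(x : u : v : z)`, the point `(x : -u : -v : z)` is not on the same line of
the pencil. -/
theorem exists_not_joined_flip (hE : E.IsSmooth K) :
    ∃ Q : E.Pt K, ¬L.Joined Q (flip₂ (flip₁ Q)) := by
  obtain ⟨x, z, hC, hD⟩ : ∃ x z, L.C x z ≠ 0 ∧ L.D x z ≠ 0 := by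
    by_contra! h
    have h1 := h 1 0
    have h2 := h 0 1
    have h3 := h 1 1
    simp only [C, D, mul_one, mul_zero, sub_zero, zero_sub, add_zero, zero_add, ne_eq,
      neg_eq_zero] at h1 h2 h3
    have hw := L.w₀_ne_zero
    have hh := L.h_ne_zero hE
    by_cases h4 : L.w₀ 3 = 0
    · have h5 := h2 fun h => hw ⟨h4, h⟩
      have h6 := h3 (by
        rw [h4, zero_sub, neg_eq_zero]
        exact fun h => hw ⟨h4, h⟩)
      exact hh ⟨by rwa [h5, add_zero] at h6, h5⟩
    · have h5 := h1 h4
      by_cases h6 : L.w₀ 0 = 0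
      · have h7 := h3 (by rwa [h6, sub_zero])
        exact hh ⟨h5, by rwa [h5, zero_add] at h7⟩
      · exact hh ⟨h5, h2 h6⟩
  obtain ⟨u, hu⟩ := exists_sq_eq (E.p₁ K x z)
  obtain ⟨v, hv⟩ := exists_sq_eq (E.p₂ K x z)
  have hw : (![x, u, v, z] : Fin 4 → K) ≠ 0 := by
    intro h
    have hx : x = 0 := congrFun h 0
    have hz : z = 0 := congrFun h 3
    exact hC (by simp [C, hx, hz])
  have hon : E.OnCurve K ![x, u, v, z] := (onCurve_iff ..).2
    ⟨by simpa using hu.symm, by simpa using hv.symm⟩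
  refine ⟨E.mkPt K _ hw hon, ?_⟩
  rintro ⟨s, t, hst, h⟩
  have h1 := (h _).2 (Or.inl rfl)
  have h2 := (h _).2 (Or.inr rfl)
  rw [flip₁_mkPt, flip₂_mkPt] at h2
  rw [onLine_rep_mkPt, onLine_iff] at h1 h2
  simp only [A, B, flip_apply] at h1 h2
  simp at h1 h2
  have ht : t = 0 := (mul_eq_zero.1 (show t * L.D x z = 0 by
    linear_combination -(h1.1 + h2.1) / 2)).resolve_right hD
  have hs : s = 0 := (mul_eq_zero.1 (show s * L.C x z = 0 by
    linear_combination -(h1.2 + h2.2) / 2)).resolve_right hC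
  rcases hst with h | h
  · exact h hs
  · exact h ht

/-- Points of the curve on a line of the pencil have constant sum. -/
theorem add_eq_add (hE : E.IsSmooth K) [G : AddCommGroup (E.Pt K)] {O : E.Pt K}
    (hG : IsGroupLaw O G) {R : E.Pt K} (hR : L.Joined L.base R) :
    L.base + R = flip₁ L.base + flip₂ L.base := by
  choose ι hι using L.exists_joined_right hE
  have hinv : ∀ P, ι (ι P) = P := fun P => (hι (ι P)).unique hE (hι P).symm
  have h1 : ι L.base = R := (hι _).unique hE hR
  have h2 : ι (flip₁ L.base) = flip₂ L.base := (hι _).unique hE (L.joined_flip hE)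
  rcases hG.reflection_or_translation (L.isRegularMap_of_joined hE hι) hinv with h | h
  · rw [← h1, ← h2, h, h]
  · -- a translation would have to be `(x : u : v : z) ↦ (x : -u : -v : z)`
    exfalso
    obtain ⟨Q, hQ⟩ := L.exists_not_joined_flip hE
    have hf₁ := hG.add_flip₁ hE
    have hf₂ := hG.add_flip₂ hE
    have h3 := h (flip₁ L.base)
    rw [h2] at h3
    have h4 : ι Q = flip₂ (flip₁ Q) := by
      rw [h Q, ← sub_eq_iff_eq_add'.2 h3, ← sub_eq_iff_eq_add'.2 (hf₂ (flip₁ Q)).symm,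
        ← sub_eq_iff_eq_add'.2 (hf₁ Q).symm, ← sub_eq_iff_eq_add'.2 (hf₂ L.base).symm,
        ← sub_eq_iff_eq_add'.2 (hf₁ L.base).symm]
      abel
    exact hQ (h4 ▸ hι Q)

end Pencil

end DoubleEquation

namespace DoubleEquation

/-! ### The step of Diophantus and Fermat -/

section Step

variable {k : Type*} [Field k] {E : DoubleEquation k} {K : Type*} [Field K] [Algebra k K]

/-- The form `v₀² p₁ - u₀² p₂` vanishes at `(x₀, z₀)`, hence it is divisible by `z₀ x - x₀ z`. -/
theorem exists_isCofactor {w : Fin 4 → K} (hw : w ≠ 0) (hon : E.OnCurve K w) :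
    ∃ h₀ h₁, E.IsCofactor K w h₀ h₁ := by
  have hxz : ¬(w 3 = 0 ∧ w 0 = 0) := fun h => hw (eq_zero_of_onCurve hon h.2 h.1)
  obtain ⟨h1, h2⟩ := (onCurve_iff ..).1 hon
  rw [p₁] at h1
  rw [p₂] at h2
  simp only [IsCofactor]
  generalize algebraMap k K E.a₁ = A₁, algebraMap k K E.b₁ = B₁, algebraMap k K E.c₁ = C₁,
    algebraMap k K E.a₂ = A₂, algebraMap k K E.b₂ = B₂, algebraMap k K E.c₂ = C₂ at *
  by_cases hz : w 3 = 0
  · have hx : w 0 ≠ 0 := fun h => hxz ⟨hz, h⟩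
    rw [hz] at h1 h2 ⊢
    refine ⟨-(w 2 ^ 2 * B₁ - w 1 ^ 2 * B₂) / w 0, -(w 2 ^ 2 * C₁ - w 1 ^ 2 * C₂) / w 0, ?_, ?_, ?_⟩
    · refine mul_left_cancel₀ (pow_ne_zero 2 hx) ?_
      linear_combination w 2 ^ 2 * h1 - w 1 ^ 2 * h2
    · field_simp
      ring
    · field_simp
  · refine ⟨(w 2 ^ 2 * A₁ - w 1 ^ 2 * A₂) / w 3, (w 2 ^ 2 * B₁ - w 1 ^ 2 * B₂ +
      w 0 * ((w 2 ^ 2 * A₁ - w 1 ^ 2 * A₂) / w 3)) / w 3, ?_, ?_, ?_⟩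
    · field_simp
    · field_simp
      ring
    · field_simp
      linear_combination w 2 ^ 2 * h1 - w 1 ^ 2 * h2

theorem IsCofactor.unique {w : Fin 4 → K} (hw : w ≠ 0) (hon : E.OnCurve K w) {h₀ h₁ h₀' h₁' : K}
    (h : E.IsCofactor K w h₀ h₁) (h' : E.IsCofactor K w h₀' h₁') : h₀ = h₀' ∧ h₁ = h₁' := by
  have hxz : ¬(w 3 = 0 ∧ w 0 = 0) := fun h => hw (eq_zero_of_onCurve hon h.2 h.1)
  obtain ⟨h1, h2, h3⟩ := h
  obtain ⟨h1', h2', h3'⟩ := h'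
  by_cases hz : w 3 = 0
  · have hx : w 0 ≠ 0 := fun h => hxz ⟨hz, h⟩
    rw [hz] at h2 h2'
    exact ⟨mul_left_cancel₀ hx (by linear_combination h2 - h2'),
      mul_left_cancel₀ hx (by linear_combination h3 - h3')⟩
  · have h4 : h₀ = h₀' := mul_left_cancel₀ hz (by linear_combination h1' - h1)
    subst h4
    exact ⟨rfl, mul_left_cancel₀ hz (by linear_combination h2' - h2)⟩

theorem isCofactor_smul_iff {a : K} (ha : a ≠ 0) {w : Fin 4 → K} {h₀ h₁ : K} :
    E.IsCofactor K (a • w) (a * h₀) (a * h₁) ↔ E.IsCofactor K w h₀ h₁ := by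
  simp only [IsCofactor, Pi.smul_apply, smul_eq_mul]
  refine and_congr ?_ (and_congr ?_ ?_) <;>
    conv_rhs => rw [← mul_right_inj' (pow_ne_zero 2 ha)]
  all_goals ring_nf

theorem onPencilLine_smul_iff {a : K} (ha : a ≠ 0) {w : Fin 4 → K} {h₀ h₁ s t : K}
    {w' : Fin 4 → K} : OnPencilLine (a • w) (a * h₀) (a * h₁) s t w' ↔
      OnPencilLine w h₀ h₁ s t w' := by
  simp only [OnPencilLine, Pi.smul_apply, smul_eq_mul]
  refine and_congr ?_ ?_ <;>
    conv_rhs => rw [← mul_right_inj' ha]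
  all_goals ring_nf

theorem onPencilLine_smul_right_iff {a : K} (ha : a ≠ 0) {w : Fin 4 → K} {h₀ h₁ s t : K}
    {w' : Fin 4 → K} : OnPencilLine w h₀ h₁ s t (a • w') ↔ OnPencilLine w h₀ h₁ s t w' := by
  simp only [OnPencilLine, Pi.smul_apply, smul_eq_mul]
  refine and_congr ?_ ?_ <;>
    conv_rhs => rw [← mul_right_inj' ha]
  all_goals ring_nf

/-- The step does not depend on the homogeneous coordinates chosen for the point. -/
theorem fermatStep_mkPt_iff {w : Fin 4 → K} {hw hon} {R : E.Pt K} :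
    FermatStep (E.mkPt K w hw hon) R ↔ ∃ h₀ h₁ s t : K, (s ≠ 0 ∨ t ≠ 0) ∧
      E.IsCofactor K w h₀ h₁ ∧ ∀ X : E.Pt K, OnPencilLine w h₀ h₁ s t (E.toSpace K X).rep ↔
        X = E.mkPt K w hw hon ∨ X = R := by
  obtain ⟨a, ha0, ha⟩ := rep_mkPt w hw hon
  rw [FermatStep, ha]
  constructor
  · rintro ⟨h₀, h₁, s, t, hst, hc, h⟩
    refine ⟨a⁻¹ * h₀, a⁻¹ * h₁, s, t, hst, ?_, fun X => ?_⟩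
    · rw [← isCofactor_smul_iff ha0, mul_inv_cancel_left₀ ha0, mul_inv_cancel_left₀ ha0]
      exact hc
    · rw [← h X, ← onPencilLine_smul_iff ha0, mul_inv_cancel_left₀ ha0, mul_inv_cancel_left₀ ha0]
  · rintro ⟨h₀, h₁, s, t, hst, hc, h⟩
    exact ⟨a * h₀, a * h₁, s, t, hst, (isCofactor_smul_iff ha0).2 hc, fun X => by
      rw [onPencilLine_smul_iff ha0, h X]⟩

/-- In the ruling attached to a point with `u v ≠ 0` the step is the involution which exchanges the
two points of the curve on each line. -/
theorem Pencil.fermatStep_iff (L : E.Pencil K) {R : E.Pt K} :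
    FermatStep L.base R ↔ L.Joined L.base R := by
  rw [base, fermatStep_mkPt_iff]
  constructor
  · rintro ⟨h₀, h₁, s, t, hst, hc, h⟩
    obtain ⟨rfl, rfl⟩ := hc.unique L.w₀_ne_zero' L.onCurve L.isCofactor
    exact ⟨s, t, hst, h⟩
  · rintro ⟨s, t, hst, h⟩
    exact ⟨_, _, s, t, hst, L.isCofactor, h⟩

/-- The discriminant of `(z₀ x - x₀ z) h(x, z)` is `h(x₀, z₀)²`. -/
theorem IsCofactor.sq_eq {w : Fin 4 → K} {h₀ h₁ : K} (h : E.IsCofactor K w h₀ h₁) :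
    (h₀ * w 0 + h₁ * w 3) ^ 2 =
      (w 2 ^ 2 * algebraMap k K E.b₁ - w 1 ^ 2 * algebraMap k K E.b₂) ^ 2 -
        4 * (w 2 ^ 2 * algebraMap k K E.a₁ - w 1 ^ 2 * algebraMap k K E.a₂) *
          (w 2 ^ 2 * algebraMap k K E.c₁ - w 1 ^ 2 * algebraMap k K E.c₂) := by
  obtain ⟨h1, h2, h3⟩ := h
  rw [h1, h2, h3]
  ring

theorem exists_eq_mul_of_cross_eq_zero {w w' : Fin 4 → K} (hw : w ≠ 0) (hon : E.OnCurve K w)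
    (h : w 3 * w' 0 - w 0 * w' 3 = 0) : ∃ α, w' 0 = α * w 0 ∧ w' 3 = α * w 3 := by
  have hxz : ¬(w 3 = 0 ∧ w 0 = 0) := fun h => hw (eq_zero_of_onCurve hon h.2 h.1)
  exact exists_eq_mul_of_linear (a := w 3) (b := w 0) hxz (fun h => hxz h.symm) (mul_comm _ _)
    (sub_eq_zero.1 h)

variable [CharZero K] [IsAlgClosed K]

/-- At a point with `u = 0` the line through the point is `u = 0`, `z₀ x = x₀ z`. -/
theorem fermatStep_iff_of_u_eq_zero (hE : E.IsSmooth K) {w : Fin 4 → K} {hw hon} (hu : w 1 = 0)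
    {R : E.Pt K} : FermatStep (E.mkPt K w hw hon) R ↔ R = flip₂ (E.mkPt K w hw hon) := by
  obtain ⟨h1, h2⟩ := (onCurve_iff ..).1 hon
  have hv : w 2 ≠ 0 := by
    intro hv
    rw [hu, zero_pow two_ne_zero] at h1
    rw [hv, zero_pow two_ne_zero] at h2
    obtain ⟨hx, hz⟩ := hE.eq_zero_of_p h1 h2
    exact hw (eq_zero_of_onCurve hon hx hz)
  have key : ∀ (h₀ h₁ s : K), s ≠ 0 → ∀ X : E.Pt K,
      OnPencilLine w h₀ h₁ s 0 (E.toSpace K X).rep ↔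
        X = E.mkPt K w hw hon ∨ X = flip₂ (E.mkPt K w hw hon) := by
    intro h₀ h₁ s hs X
    obtain ⟨w', hw', hon', rfl⟩ := exists_mkPt X
    obtain ⟨a, ha0, ha⟩ := rep_mkPt w' hw' hon'
    rw [ha, onPencilLine_smul_right_iff ha0, flip₂_mkPt, mkPt_eq_mkPt_iff, mkPt_eq_mkPt_iff]
    simp only [OnPencilLine, hu, zero_mul, add_zero, mul_eq_zero, hs, hv, false_or,
      zero_eq_mul]
    constructor
    · rintro ⟨hu', hC⟩
      obtain ⟨α, h0, h3⟩ := exists_eq_mul_of_cross_eq_zero hw hon hC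
      have h2' := ((onCurve_iff ..).1 hon').2
      have hsq : w' 2 ^ 2 = (α * w 2) ^ 2 := by
        rw [mul_pow, ← h2, ← h2', h0, h3, p₂, p₂]
        ring
      rcases sq_eq_sq_iff_eq_or_eq_neg.1 hsq with hv' | hv'
      · exact Or.inl ⟨α, by ext j; fin_cases j <;> simp [*]⟩
      · exact Or.inr ⟨α, by ext j; fin_cases j <;> simp [*, flip_apply]⟩
    · rintro (⟨α, rfl⟩ | ⟨α, rfl⟩)
      · simp [hu]
        ring
      · simp [hu, flip_apply]
        ring
  rw [fermatStep_mkPt_iff]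
  constructor
  · rintro ⟨h₀, h₁, s, t, hst, hc, h⟩
    have hD : h₀ * w 0 + h₁ * w 3 ≠ 0 := by
      intro h0
      have := hc.sq_eq
      rw [h0, hu] at this
      exact hE.discr₁_ne_zero (mul_left_cancel₀ (pow_ne_zero 4 hv) (by linear_combination -this))
    -- at the point itself `v₀ u + u₀ v = 0`, but `h(x₀, z₀) ≠ 0`
    have ht : t = 0 := by
      obtain ⟨a, ha0, ha⟩ := rep_mkPt w hw hon
      have := (h _).2 (Or.inl rfl)
      rw [ha, onPencilLine_smul_right_iff ha0] at this
      have h3 := this.1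
      rw [hu, mul_zero, zero_mul, add_zero, mul_zero, zero_eq_mul] at h3
      exact h3.resolve_right hD
    subst ht
    refine eq_of_pair (a := E.mkPt K w hw hon) fun X => ?_
    rw [← h X, key h₀ h₁ s (by simpa using hst) X]
  · rintro rfl
    obtain ⟨h₀, h₁, hc⟩ := exists_isCofactor hw hon
    exact ⟨h₀, h₁, 1, 0, Or.inl one_ne_zero, hc, key h₀ h₁ 1 one_ne_zero⟩

/-- At a point with `v = 0` the line through the point is `v = 0`, `z₀ x = x₀ z`. -/
theorem fermatStep_iff_of_v_eq_zero (hE : E.IsSmooth K) {w : Fin 4 → K} {hw hon} (hv : w 2 = 0)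
    {R : E.Pt K} : FermatStep (E.mkPt K w hw hon) R ↔ R = flip₁ (E.mkPt K w hw hon) := by
  obtain ⟨h1, h2⟩ := (onCurve_iff ..).1 hon
  have hu : w 1 ≠ 0 := by
    intro hu
    rw [hu, zero_pow two_ne_zero] at h1
    rw [hv, zero_pow two_ne_zero] at h2
    obtain ⟨hx, hz⟩ := hE.eq_zero_of_p h1 h2
    exact hw (eq_zero_of_onCurve hon hx hz)
  have key : ∀ (h₀ h₁ s : K), s ≠ 0 → ∀ X : E.Pt K,
      OnPencilLine w h₀ h₁ s 0 (E.toSpace K X).rep ↔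
        X = E.mkPt K w hw hon ∨ X = flip₁ (E.mkPt K w hw hon) := by
    intro h₀ h₁ s hs X
    obtain ⟨w', hw', hon', rfl⟩ := exists_mkPt X
    obtain ⟨a, ha0, ha⟩ := rep_mkPt w' hw' hon'
    rw [ha, onPencilLine_smul_right_iff ha0, flip₁_mkPt, mkPt_eq_mkPt_iff, mkPt_eq_mkPt_iff]
    simp only [OnPencilLine, hv, zero_mul, zero_add, mul_eq_zero, hs, hu, false_or,
      zero_eq_mul]
    constructor
    · rintro ⟨hv', hC⟩
      obtain ⟨α, h0, h3⟩ := exists_eq_mul_of_cross_eq_zero hw hon hC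
      have h1' := ((onCurve_iff ..).1 hon').1
      have hsq : w' 1 ^ 2 = (α * w 1) ^ 2 := by
        rw [mul_pow, ← h1, ← h1', h0, h3, p₁, p₁]
        ring
      rcases sq_eq_sq_iff_eq_or_eq_neg.1 hsq with hu' | hu'
      · exact Or.inl ⟨α, by ext j; fin_cases j <;> simp [*]⟩
      · exact Or.inr ⟨α, by ext j; fin_cases j <;> simp [*, flip_apply]⟩
    · rintro (⟨α, rfl⟩ | ⟨α, rfl⟩)
      · simp [hv]
        ring
      · simp [hv, flip_apply]
        ring
  rw [fermatStep_mkPt_iff]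
  constructor
  · rintro ⟨h₀, h₁, s, t, hst, hc, h⟩
    have hD : h₀ * w 0 + h₁ * w 3 ≠ 0 := by
      intro h0
      have := hc.sq_eq
      rw [h0, hv] at this
      exact hE.discr₂_ne_zero (mul_left_cancel₀ (pow_ne_zero 4 hu) (by linear_combination -this))
    -- at the point itself `v₀ u + u₀ v = 0`, but `h(x₀, z₀) ≠ 0`
    have ht : t = 0 := by
      obtain ⟨a, ha0, ha⟩ := rep_mkPt w hw hon
      have := (h _).2 (Or.inl rfl)
      rw [ha, onPencilLine_smul_right_iff ha0] at this
      have h3 := this.1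
      rw [hv, mul_zero, zero_mul, add_zero, mul_zero, zero_eq_mul] at h3
      exact h3.resolve_right hD
    subst ht
    refine eq_of_pair (a := E.mkPt K w hw hon) fun X => ?_
    rw [← h X, key h₀ h₁ s (by simpa using hst) X]
  · rintro rfl
    obtain ⟨h₀, h₁, hc⟩ := exists_isCofactor hw hon
    exact ⟨h₀, h₁, 1, 0, Or.inl one_ne_zero, hc, key h₀ h₁ 1 one_ne_zero⟩

/-- The step is defined at every point and has one value. -/
theorem IsSmooth.existsUnique_fermatStep (hE : E.IsSmooth K) (P : E.Pt K) :
    ∃! R, FermatStep P R := by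
  obtain ⟨w, hw, hon, rfl⟩ := exists_mkPt P
  by_cases hu : w 1 = 0
  · simp only [fermatStep_iff_of_u_eq_zero hE hu, existsUnique_eq]
  by_cases hv : w 2 = 0
  · simp only [fermatStep_iff_of_v_eq_zero hE hv, existsUnique_eq]
  obtain ⟨h₀, h₁, hc⟩ := exists_isCofactor hw hon
  let L : E.Pencil K := ⟨w, h₀, h₁, hon, hc, hu, hv⟩
  change ∃! R, FermatStep L.base R
  simp only [L.fermatStep_iff]
  obtain ⟨R, hR⟩ := L.exists_joined_right hE L.base
  exact ⟨R, hR, fun R' hR' => Pencil.Joined.unique hE hR' hR⟩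

/-- In the group law `P + P' = P₃` and `P + P'' = P₄` for the conjugates `P'` and `P''` of `P`
under `u ↦ -u` and `v ↦ -v`, and `P + R = P' + P''`. -/
theorem FermatStep.eq_sub [G : AddCommGroup (E.Pt K)] {O P R : E.Pt K} (hE : E.IsSmooth K)
    (hG : IsGroupLaw O G) (h : FermatStep P R) : R = flip₁ O + flip₂ O - (3 : ℤ) • P := by
  obtain ⟨w, hw, hon, rfl⟩ := exists_mkPt P
  have h1 := hG.add_flip₁ hE (E.mkPt K w hw hon)
  have h2 := hG.add_flip₂ hE (E.mkPt K w hw hon)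
  rw [← h1, ← h2]
  by_cases hu : w 1 = 0
  · rw [fermatStep_iff_of_u_eq_zero hE hu] at h
    rw [h, flip₁_eq_self hu]
    abel
  by_cases hv : w 2 = 0
  · rw [fermatStep_iff_of_v_eq_zero hE hv] at h
    rw [h, flip₂_eq_self hv]
    abel
  obtain ⟨h₀, h₁, hc⟩ := exists_isCofactor hw hon
  let L : E.Pencil K := ⟨w, h₀, h₁, hon, hc, hu, hv⟩
  have h3 := L.add_eq_add hE hG (L.fermatStep_iff.1 h)
  change R = L.base + flip₁ L.base + (L.base + flip₂ L.base) - (3 : ℤ) • L.base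
  rw [eq_sub_of_add_eq' h3]
  abel

end Step

/-! ### Rationality -/

section Rational

variable {k : Type*} [Field k] {E : DoubleEquation k} {K : Type*} [Field K] [Algebra k K]

theorem onCurve_algebraMap_iff {w : Fin 4 → k} :
    E.OnCurve K (fun i => algebraMap k K (w i)) ↔ E.OnCurve k w := by
  simp only [onCurve_iff, p₁, p₂, Algebra.algebraMap_self, RingHom.id_apply, ← map_pow, ← map_mul,
    ← map_add, (algebraMap k K).injective.eq_iff]

theorem isCofactor_algebraMap {w : Fin 4 → k} {h₀ h₁ : k} (h : E.IsCofactor k w h₀ h₁) :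
    E.IsCofactor K (fun i => algebraMap k K (w i)) (algebraMap k K h₀) (algebraMap k K h₁) := by
  simpa only [IsCofactor, Algebra.algebraMap_self, RingHom.id_apply, ← map_pow, ← map_mul,
    ← map_sub, ← map_neg, (algebraMap k K).injective.eq_iff] using h

theorem secant_algebraMap (w d : Fin 4 → k) :
    E.secant K (fun i => algebraMap k K (w i)) (fun i => algebraMap k K (d i)) =
      fun i => algebraMap k K (E.secant k w d i) := by
  ext j
  simp [secant, quad₂, polar₂, p₂, map_ofNat (algebraMap k K) 2]

/-- A pencil defined over the ground field, over an extension field. -/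
def Pencil.baseChange (L : E.Pencil k) (K : Type*) [Field K] [Algebra k K] : E.Pencil K where
  w₀ i := algebraMap k K (L.w₀ i)
  h₀ := algebraMap k K L.h₀
  h₁ := algebraMap k K L.h₁
  onCurve := onCurve_algebraMap_iff.2 L.onCurve
  isCofactor := isCofactor_algebraMap L.isCofactor
  hu := by simpa using L.hu
  hv := by simpa using L.hv

theorem Pencil.dir_baseChange (L : E.Pencil k) (ξ ζ s t : k) :
    (L.baseChange K).dir (algebraMap k K ξ) (algebraMap k K ζ) (algebraMap k K s)
      (algebraMap k K t) = fun i => algebraMap k K (L.dir ξ ζ s t i) := by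
  ext j
  fin_cases j <;> simp [dir, baseChange, C, D, map_ofNat (algebraMap k K) 2]

theorem isRational_mkPt {w : Fin 4 → k} {w' : Fin 4 → K} {hw' hon'}
    (h : w' = fun i => algebraMap k K (w i)) : IsRational (E.mkPt K w' hw' hon') := by
  subst h
  exact ⟨w, hw', rfl⟩

theorem flip_algebraMap (i : Fin 4) (w : Fin 4 → k) :
    flip K i (fun j => algebraMap k K (w j)) = fun j => algebraMap k K (flip k i w j) := by
  ext j
  by_cases hj : j = i <;> simp [flip_apply, hj]

variable [CharZero K] [IsAlgClosed K]

/-- The line through a rational point has rational coefficients, so that its second point on the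
curve is rational. -/
theorem FermatStep.isRational {P R : E.Pt K} (hE : E.IsSmooth K) (h : FermatStep P R)
    (hP : IsRational P) : IsRational R := by
  obtain ⟨w, hw, hw'⟩ := hP
  have hon : E.OnCurve K (fun i => algebraMap k K (w i)) := by
    obtain ⟨a, ha⟩ := Projectivization.exists_smul_eq_mk_rep K _ hw
    have := E.onCurve_smul K (onCurve_rep P) (a⁻¹ : Kˣ)
    rw [hw', ← ha] at this
    rwa [Units.smul_def, smul_smul, Units.inv_mul, one_smul] at this
  obtain rfl : P = E.mkPt K _ hw hon := Subtype.ext hw'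
  have hon' := onCurve_algebraMap_iff.1 hon
  have hwk : w ≠ 0 := by
    rintro rfl
    exact hw (by ext; simp)
  by_cases hu : w 1 = 0
  · rw [fermatStep_iff_of_u_eq_zero hE (by simp [hu]), flip₂_mkPt] at h
    rw [h]
    exact isRational_mkPt (flip_algebraMap 2 w)
  by_cases hv : w 2 = 0
  · rw [fermatStep_iff_of_v_eq_zero hE (by simp [hv]), flip₁_mkPt] at h
    rw [h]
    exact isRational_mkPt (flip_algebraMap 1 w)
  obtain ⟨h₀, h₁, hc⟩ := exists_isCofactor hwk hon'
  let L : E.Pencil k := ⟨w, h₀, h₁, hon', hc, hu, hv⟩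
  have hA : algebraMap k K (L.A w) ≠ 0 := by
    have : algebraMap k K (L.A w) = 2 * algebraMap k K (w 1) * algebraMap k K (w 2) := by
      simp only [Pencil.A, L, map_add, map_mul]
      ring
    rw [this]
    simpa using ⟨hu, hv⟩
  have hl : (L.baseChange K).OnLine (algebraMap k K (L.D (w 0) (w 3))) (algebraMap k K (L.A w))
      (fun i => algebraMap k K (w i)) := by
    have := (L.baseChange K).onLine_D_A hon
    simpa [Pencil.D, Pencil.A, Pencil.baseChange] using this
  obtain ⟨ξ, ζ, hξ, hr, hrc, hX, -⟩ := (L.baseChange K).exists_secant hE (Or.inr hA) hw hon hl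
  have hR := ((L.baseChange K).fermatStep_iff.1 h).unique hE ⟨_, _, Or.inr hA, hX⟩
  obtain ⟨ξ', ζ', rfl, rfl⟩ : ∃ ξ' ζ' : k, algebraMap k K ξ' = ξ ∧ algebraMap k K ζ' = ζ := by
    rcases hξ with ⟨rfl, rfl⟩ | ⟨rfl, rfl⟩
    · exact ⟨1, 0, map_one _, map_zero _⟩
    · exact ⟨0, 1, map_zero _, map_one _⟩
  have hs := secant_algebraMap (E := E) (K := K) w (L.dir ξ' ζ' (L.D (w 0) (w 3)) (L.A w))
  rw [← L.dir_baseChange] at hs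
  rw [hR]
  exact isRational_mkPt hs

end Rational

end DoubleEquation

/-! ### The sequence of points -/

namespace DoubleEquation

section Sequence

variable {k : Type*} [Field k] {E : DoubleEquation k} {K : Type*} [Field K] [Algebra k K]

theorem flip₁_infPt (β₁ β₂ : k) (h₁ h₁' h₂) :
    flip₁ (E.infPt K β₁ β₂ h₁ h₂) = E.infPt K (-β₁) β₂ h₁' h₂ := by
  refine (flip₁_mkPt ..).trans (mkPt_eq_mkPt_iff.2 ⟨1, ?_⟩)
  ext j
  fin_cases j <;> simp [flip_apply]

theorem flip₂_infPt (β₁ β₂ : k) (h₁ h₂ h₂') :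
    flip₂ (E.infPt K β₁ β₂ h₁ h₂) = E.infPt K β₁ (-β₂) h₁ h₂' := by
  refine (flip₂_mkPt ..).trans (mkPt_eq_mkPt_iff.2 ⟨1, ?_⟩)
  ext j
  fin_cases j <;> simp [flip_apply]

end Sequence

end DoubleEquation

theorem four_dvd_one_sub_neg_three_pow (n : ℕ) : (4 : ℤ) ∣ 1 - (-3) ^ n := by
  simpa using sub_dvd_pow_sub_pow (1 : ℤ) (-3) n

theorem eq_zsmul_of_recurrence {A : Type*} [AddCommGroup A] {S : ℕ → A} {R : A} (h0 : S 0 = 0)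
    (h : ∀ n, S (n + 1) = R - (3 : ℤ) • S n) (n : ℕ) : S n = ((1 - (-3 : ℤ) ^ n) / 4) • R := by
  induction n with
  | zero => simp [h0]
  | succ n ih =>
    -- the quotients satisfy the same recurrence, because both divisions by `4` are exact
    have h4 : (1 - (-3 : ℤ) ^ (n + 1)) / 4 = 1 - 3 * ((1 - (-3 : ℤ) ^ n) / 4) := by
      obtain ⟨m, hm⟩ := four_dvd_one_sub_neg_three_pow n
      rw [hm, Int.mul_ediv_cancel_left _ four_ne_zero]
      refine Int.ediv_eq_of_eq_mul_right four_ne_zero ?_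
      rw [pow_succ]
      linear_combination 3 * (-hm)
    rw [h, ih, h4, sub_smul, one_smul, mul_smul]

theorem mainTheorem5 (E : DoubleEquation ℚ) (α₁ α₂ : ℚ) (h₁ : α₁ ^ 2 = E.a₁) (h₂ : α₂ ^ 2 = E.a₂)
    (hE : E.IsSmooth (AlgebraicClosure ℚ))
    (P₁ P₃ P₄ : E.Pt (AlgebraicClosure ℚ))
    -- `P₁ = (1 : α₁ : α₂ : 0)`, `P₃ = (1 : -α₁ : α₂ : 0)`, `P₄ = (1 : α₁ : -α₂ : 0)`
    (hP₁ : P₁ = E.infPt _ α₁ α₂ h₁ h₂)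
    (hP₃ : P₃ = E.infPt _ (-α₁) α₂ ((neg_sq α₁).trans h₁) h₂)
    (hP₄ : P₄ = E.infPt _ α₁ (-α₂) h₁ ((neg_sq α₂).trans h₂)) :
    -- the curve has exactly one group law with origin `P₁`
    (∃! G : AddCommGroup (E.Pt (AlgebraicClosure ℚ)), DoubleEquation.IsGroupLaw P₁ G) ∧
    -- the construction is defined at every point, and keeps rational points rational
    (∀ P : E.Pt (AlgebraicClosure ℚ), ∃! R, DoubleEquation.FermatStep P R) ∧
    (∀ P R : E.Pt (AlgebraicClosure ℚ), DoubleEquation.FermatStep P R →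
      DoubleEquation.IsRational P → DoubleEquation.IsRational R) ∧
    ∀ G : AddCommGroup (E.Pt (AlgebraicClosure ℚ)), DoubleEquation.IsGroupLaw P₁ G →
      (∀ P R : E.Pt (AlgebraicClosure ℚ), DoubleEquation.FermatStep P R →
        R = P₃ + P₄ - (3 : ℤ) • P) ∧
      ∀ S : ℕ → E.Pt (AlgebraicClosure ℚ), S 0 = P₁ →
        (∀ n, DoubleEquation.FermatStep (S n) (S (n + 1))) →
        S 1 = P₃ + P₄ ∧
        -- `4` divides `1 - (-3) ^ n`, so that the division of integers is exact
        ∀ n : ℕ, (4 : ℤ) ∣ 1 - (-3) ^ n ∧ S n = ((1 - (-3 : ℤ) ^ n) / 4) • (P₃ + P₄) := by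
  have hP₁₃ : DoubleEquation.flip₁ P₁ = P₃ := by
    rw [hP₁, hP₃, DoubleEquation.flip₁_infPt]
  have hP₁₄ : DoubleEquation.flip₂ P₁ = P₄ := by
    rw [hP₁, hP₄, DoubleEquation.flip₂_infPt]
  have key : ∀ G : AddCommGroup (E.Pt (AlgebraicClosure ℚ)), DoubleEquation.IsGroupLaw P₁ G →
      ∀ P R : E.Pt (AlgebraicClosure ℚ), DoubleEquation.FermatStep P R →
        R = P₃ + P₄ - (3 : ℤ) • P := by
    intro G hG P R h
    rw [← hP₁₃, ← hP₁₄]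
    exact h.eq_sub hE hG
  refine ⟨?_, hE.existsUnique_fermatStep, fun P R h hP => h.isRational hE hP, fun G hG =>
    ⟨key G hG, fun S hS0 hS => ?_⟩⟩
  · obtain ⟨G, hG⟩ := hE.exists_isGroupLaw P₁
    exact ⟨G, hG, fun G' hG' => hG'.unique hG⟩
  · have h0 : S 0 = 0 := hS0.trans hG.origin_eq_zero
    have hrec := fun n => key G hG _ _ (hS n)
    refine ⟨?_, fun n => ⟨four_dvd_one_sub_neg_three_pow n, eq_zsmul_of_recurrence h0 hrec n⟩⟩
    rw [hrec 0, h0, smul_zero, sub_zero]
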